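/- Let $d\ge 1$ and let $g:[0,\infty)\to\mathbb R$ be smooth. We consider the Gross--Pitaevskii type equation $$ i\partial_t\psi+\Delta\psi=\tfrac12\, g(|\psi|^2)\,\psi \qquad (1)$$ and the quantum Euler--Korteweg system $$ \partial_t\rho+\operatorname{div}(\rho u)=0,\qquad \partial_t u+u\cdot\nabla u+\nabla\big(g(\rho)\big)=2\nabla\Big(\frac{\Delta\sqrt\rho}{\sqrt\rho}\Big) \qquad (2)$$ on $\mathbb R^d$. Call $(\rho,u)$ a *solution of (2) that blows up by vacuum formation at $x_0\in\mathbb R^d$ in time $T\in\,]0,\infty[$* if: $\rho$ and $u$ are smooth on $[0,T[\times\mathbb R^d$ and satisfy (2) there; $\rho-1$ and $u$ belong to $C([0,T[;H^k(\mathbb R^d))$ for every $k\in\mathbb N$; for every $T'<T$, $\inf_{[0,T']\times\mathbb R^d}\rho>0$; $\rho(t,x_0)\to0$ as $t\to T^-$; and $$\int_0^{T}\big(\|u(t)\|_{L^\infty}+\|\nabla u(t)\|_{L^\infty}\big)\,dt=\infty .$$ (a) Let $\psi_0:\mathbb R^d\to\mathbb R$ satisfy $1-\psi_0\in\mathcal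 S(\mathbb R^d)$, $\psi_0>0$ on $\mathbb R^d\setminus\{0\}$, $\psi_0(0)=0$ and $\Delta\psi_0(0)\neq0$. Then there exist $T>0$ and a solution $\psi:[0,T]\times\mathbb R^d\to\mathbb C$ of (1), smooth on $[0,T]\times\mathbb R^d$, with $\psi(0,\cdot)=\psi_0$ and $\psi-e^{-ig(1)t/2}\in C([0,T];H^k(\mathbb R^d))$ for every $k\in\mathbb N$, such that $|\psi(t,x)|>0$ for all $(t,x)\in\,]0,T]\times\mathbb R^d$. Moreover the time-reversed function $\chi(t,x)=\overline{\psi(T-t,x)}$ is also a smooth solution of (1) on $[0,T]\times\mathbb R^d$, and $$\rho=|\chi|^2,\qquad u=\frac{2\operatorname{Im}(\overline\chi\,\nabla\chi)}{|\chi|^2}$$ is a solution of (2) that blows up by vacuum formation at $x_0=0$ in time $T$. (b) Consequently, there exists a solution of (2) that blows up by vacuum formation in finite time. -/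

import Mathlib

open Set Filter Topology MeasureTheory
open scoped ContDiff SchwartzMap ComplexConjugate

noncomputable section

/-- The space `ℝ^d` with its Euclidean norm. -/
abbrev RSpace (d : ℕ) : Type := EuclideanSpace ℝ (Fin d)

/-- The divergence `∑ i, ∂ᵢ vᵢ` of a vector field on `ℝ^d`. -/
def divergence {d : ℕ} (v : RSpace d → RSpace d) (x : RSpace d) : ℝ :=
  ∑ i : Fin d, (fderiv ℝ v x (EuclideanSpace.single i 1)) i

/-- `f ∈ C(I; H^k(ℝ^d))` for every `k`, for a family of smooth functions `f t`, `t ∈ I`: all the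
(classical) derivatives of `f t` are square integrable and depend continuously on `t ∈ I` in the
norm of `L²`. -/
def ContinuousInSobolev {d : ℕ} {F : Type*} [NormedAddCommGroup F] [NormedSpace ℝ F]
    (I : Set ℝ) (f : ℝ → RSpace d → F) : Prop :=
  ∀ t ∈ I, ContDiff ℝ ∞ (f t) ∧
    ∀ k : ℕ, MemLp (iteratedFDeriv ℝ k (f t)) 2 volume ∧
      Tendsto
        (fun s : ℝ => eLpNorm
          (fun x => iteratedFDeriv ℝ k (f s) x - iteratedFDeriv ℝ k (f t) x) 2 volume)
        (𝓝[I] t) (𝓝 0)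

/-- `ψ` is a solution on `[0, T] × ℝ^d`, smooth up to the boundary, of
`i ∂ₜψ + Δψ = g(|ψ|²) ψ / 2`. -/
structure IsSmoothGPSolution {d : ℕ} (g : ℝ → ℝ) (T : ℝ) (ψ : ℝ → RSpace d → ℂ) : Prop where
  smooth : ContDiffOn ℝ ∞ (fun p : ℝ × RSpace d => ψ p.1 p.2) (Icc 0 T ×ˢ univ)
  equation : ∀ t ∈ Icc (0 : ℝ) T, ∀ x : RSpace d,
    Complex.I * derivWithin (fun s => ψ s x) (Icc 0 T) t + Laplacian.laplacian (ψ t) x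
      = (g (‖ψ t x‖ ^ 2) : ℂ) * ψ t x / 2

/-- The solution `exp (-i g(1) t / 2)` of the equation `i ∂ₜψ + Δψ = g(|ψ|²) ψ / 2` with constant
initial value `1`; it is the limit at spatial infinity of solutions whose initial value tends to
`1`, and it is identically `1` when `g 1 = 0`. -/
def farField (g : ℝ → ℝ) (t : ℝ) : ℂ := Complex.exp (-(Complex.I * (g 1 : ℂ) * (t : ℂ) / 2))

/-- `ψ₀` is real valued, `1 - ψ₀` is in the Schwartz class, `ψ₀ > 0` away from the origin,
`ψ₀(0) = 0` and `Δψ₀(0) ≠ 0`. -/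
structure IsVacuumDatum {d : ℕ} (ψ₀ : RSpace d → ℝ) : Prop where
  schwartz : ∃ f : 𝓢(RSpace d, ℝ), ∀ x, f x = 1 - ψ₀ x
  pos : ∀ x, x ≠ 0 → 0 < ψ₀ x
  zero : ψ₀ 0 = 0
  laplacian_ne : Laplacian.laplacian ψ₀ 0 ≠ 0

/-- The density `ρ = |ψ|²` of a wave function. -/
def madelungDensity {d : ℕ} (ψ : ℝ → RSpace d → ℂ) (t : ℝ) (x : RSpace d) : ℝ := ‖ψ t x‖ ^ 2

/-- The velocity `u = 2 Im (conj ψ ∇ψ) / |ψ|²` of a wave function, that is `u = 2 ∇φ` where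
`ψ = √ρ exp (i φ)`. -/
def madelungVelocity {d : ℕ} (ψ : ℝ → RSpace d → ℂ) (t : ℝ) (x : RSpace d) : RSpace d :=
  WithLp.toLp 2 fun i : Fin d =>
    2 * (conj (ψ t x) * fderiv ℝ (ψ t) x (EuclideanSpace.single i 1)).im / ‖ψ t x‖ ^ 2

/-- `(ρ, u)` is a smooth solution without vacuum, on `[0, T[ × ℝ^d`, of the quantum
Euler--Korteweg system
`∂ₜρ + div (ρ u) = 0`, `∂ₜu + u · ∇u + ∇(g(ρ)) = 2 ∇(Δ√ρ / √ρ)`. -/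
structure IsQuantumEulerSolution {d : ℕ} (g : ℝ → ℝ) (T : ℝ)
    (ρ : ℝ → RSpace d → ℝ) (u : ℝ → RSpace d → RSpace d) : Prop where
  smooth_density : ContDiffOn ℝ ∞ (fun p : ℝ × RSpace d => ρ p.1 p.2) (Ico 0 T ×ˢ univ)
  smooth_velocity : ContDiffOn ℝ ∞ (fun p : ℝ × RSpace d => u p.1 p.2) (Ico 0 T ×ˢ univ)
  pos : ∀ t ∈ Ico (0 : ℝ) T, ∀ x, 0 < ρ t x
  mass : ∀ t ∈ Ico (0 : ℝ) T, ∀ x,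
    derivWithin (fun s => ρ s x) (Ico 0 T) t + divergence (fun y => ρ t y • u t y) x = 0
  momentum : ∀ t ∈ Ico (0 : ℝ) T, ∀ x,
    derivWithin (fun s => u s x) (Ico 0 T) t + fderiv ℝ (u t) x (u t x)
        + gradient (fun y => g (ρ t y)) x
      = (2 : ℝ) • gradient
          (fun y => Laplacian.laplacian (fun z => √(ρ t z)) y / √(ρ t y)) x

/-- `(ρ, u)` is a smooth solution of the quantum Euler--Korteweg system on `[0, T[ × ℝ^d`, with
`(ρ - 1, u)` continuous in time with values in all Sobolev spaces and with a density bounded away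
from `0` on `[0, T'] × ℝ^d` for every `T' < T`, that forms vacuum at the point `x₀` at the finite
time `T` and blows up there: the norm of `u` in `L¹(0, T; W^{1,∞})` is infinite. -/
structure IsBlowUpSolution {d : ℕ} (g : ℝ → ℝ) (T : ℝ) (x₀ : RSpace d)
    (ρ : ℝ → RSpace d → ℝ) (u : ℝ → RSpace d → RSpace d) : Prop where
  time_pos : 0 < T
  solution : IsQuantumEulerSolution g T ρ u
  sobolev_density : ContinuousInSobolev (Ico 0 T) (fun t x => ρ t x - 1)
  sobolev_velocity : ContinuousInSobolev (Ico 0 T) u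
  no_vacuum_before : ∀ T' ∈ Ico (0 : ℝ) T, ∃ c : ℝ, 0 < c ∧ ∀ t ∈ Icc 0 T', ∀ x, c ≤ ρ t x
  vacuum : Tendsto (fun t => ρ t x₀) (𝓝[<] T) (𝓝 0)
  blow_up : ∫⁻ t in Ico 0 T,
    (eLpNorm (u t) ⊤ volume + eLpNorm (fderiv ℝ (u t)) ⊤ volume) = ⊤

end

/-! The Schrödinger flow fills a nondegenerate vacuum of a real datum at once; run backwards, the
same flow creates one. Write `ψ = farField g t * (1 + w)`. Where `1 + w = 0` the nonlinear term
vanishes, so at the origin the initial speed of `1 + w` is `iκ` with `κ = Δψ₀(0)` real and nonzero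
(`IsProfile.profileDeriv_zero`). Near the origin `1 + w` is `ψ₀ + iκt` up to a small multiple of
`t`; as `ψ₀` is real, the imaginary part alone keeps the modulus above `|κ|t/2`. Away from the
origin `ψ₀` is bounded below and moves little in a short time (`IsProfile.exists_approx`,
`IsProfile.exists_pos`).

Conjugation combined with time reversal preserves the equation, so the reversed wave `χ` has no zero
before time `T`. Locally `χ = exp(A + iΦ)`; after division by `χ` the imaginary part of the equation
is conservation of mass, and the real part is a Bernoulli law whose gradient is the momentum
equation (`hydrodynamic_of_grossPitaevskii`, `isQuantumEulerSolution_madelung`). The blow-up uses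
only conservation of mass at the origin. With `s = T - t`, both `ρ` and `∇ρ` are `O(s²)`, because `1
+ w` and `∇w` vanish at the initial vacuum, whereas `|∂ₜρ|` is at least a constant times `s`. Hence
`|u| + |∇u|` is at least a constant over `s`, which is not integrable (`IsProfile.blow_up`).

The wave itself is constructed for a nonlinearity truncated to have bounded derivatives, by an
exponential Euler scheme with dyadic steps acting on Schwartz functions. A tame composition estimate
(`exists_sob_nonlin_le`) bounds every Sobolev norm of the scheme on one common time interval
(`exists_eulerBounded`). Comparing a step with its two halves gives geometric convergence in `L²`,
which interpolation lifts to all orders. In the limit each space derivative has a first order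
expansion in time with remainder `|t - s|^(3/2)` (`exists_limit_solution`), and bootstrapping this
gives joint smoothness (`contDiffOn_of_taylor`). Sobolev continuity of `ρ - 1` and `u` then follows
from a superposition theorem (`SobolevBounded.comp`). -/

/-! ### The `L²` norm of Schwartz functions and Fourier multipliers -/

section Multipliers

open FourierTransform LineDeriv

variable {d : ℕ}

/-- The Schwartz space of complex valued functions on `ℝ^d`. -/
abbrev Sch (d : ℕ) : Type := 𝓢(RSpace d, ℂ)

/-- The `L²` norm of a Schwartz function. -/
noncomputable def l2norm (f : Sch d) : ℝ := ‖f.toLp 2 volume‖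

lemma l2norm_nonneg (f : Sch d) : 0 ≤ l2norm f := norm_nonneg _

lemma l2norm_eq (f : Sch d) : l2norm f = (eLpNorm f 2 volume).toReal := SchwartzMap.norm_toLp

lemma ofReal_l2norm (f : Sch d) : ENNReal.ofReal (l2norm f) = eLpNorm f 2 volume := by
  rw [l2norm_eq, ENNReal.ofReal_toReal (f.memLp 2 volume).eLpNorm_ne_top]

lemma toLp_eq_clm (f : Sch d) : f.toLp 2 volume = SchwartzMap.toLpCLM ℂ ℂ 2 volume f := rfl

lemma l2norm_zero : l2norm (0 : Sch d) = 0 := by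
  rw [l2norm, toLp_eq_clm, map_zero, norm_zero]

lemma l2norm_add_le (f g : Sch d) : l2norm (f + g) ≤ l2norm f + l2norm g := by
  simp only [l2norm, toLp_eq_clm, map_add]
  exact norm_add_le _ _

lemma l2norm_sub_le (f g : Sch d) : l2norm (f - g) ≤ l2norm f + l2norm g := by
  simp only [l2norm, toLp_eq_clm, map_sub]
  exact norm_sub_le _ _

lemma l2norm_smul (c : ℂ) (f : Sch d) : l2norm (c • f) = ‖c‖ * l2norm f := by
  simp only [l2norm, toLp_eq_clm, map_smul, norm_smul]

lemma l2norm_fourier (f : Sch d) : l2norm (𝓕 f) = l2norm f :=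
  SchwartzMap.norm_fourier_toL2_eq f

lemma sch_fourier_fourierInv (f : Sch d) : 𝓕 (𝓕⁻ f : Sch d) = f :=
  fourier_fourierInv_eq f

lemma sch_fourier_sub (f g : Sch d) : 𝓕 (f - g) = 𝓕 f - 𝓕 g :=
  map_sub (fourierCLM ℂ (Sch d)) f g

/-- Pointwise domination by a finite sum gives domination in `L²`. -/
lemma l2norm_le_of_le_sum {ι : Type*} (s : Finset ι) (f : Sch d) (g : ι → Sch d) {C : ℝ}
    (hC : 0 ≤ C) (h : ∀ x, ‖f x‖ ≤ C * ∑ i ∈ s, ‖g i x‖) :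
    l2norm f ≤ C * ∑ i ∈ s, l2norm (g i) := by
  have h1 : eLpNorm f 2 volume ≤ ENNReal.ofReal C *
      eLpNorm (fun x => ∑ i ∈ s, ‖g i x‖) 2 volume := by
    refine eLpNorm_le_mul_eLpNorm_of_ae_le_mul (Eventually.of_forall fun x => ?_) 2
    refine (h x).trans ?_
    gcongr
    exact le_abs_self _
  have h2 : eLpNorm (fun x => ∑ i ∈ s, ‖g i x‖) 2 volume ≤ ∑ i ∈ s, eLpNorm (g i) 2 volume := by
    have h3 := eLpNorm_sum_le (μ := volume) (p := 2) (s := s)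
      (f := fun i => fun x => ‖g i x‖)
      (fun i _ => ((g i).continuous.norm).aestronglyMeasurable) (by norm_num)
    have h4 : (∑ i ∈ s, fun x => ‖g i x‖) = fun x => ∑ i ∈ s, ‖g i x‖ := by
      ext x; simp
    rw [h4] at h3
    simpa only [eLpNorm_norm] using h3
  rw [← ENNReal.ofReal_le_ofReal_iff 
    (mul_nonneg hC (Finset.sum_nonneg fun i _ => l2norm_nonneg (g i)))]
  rw [ENNReal.ofReal_mul hC, ENNReal.ofReal_sum_of_nonneg (fun i _ => l2norm_nonneg _)]
  simp only [ofReal_l2norm]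
  exact h1.trans (by gcongr)

lemma l2norm_le_of_le (f g : Sch d) {C : ℝ} (hC : 0 ≤ C) (h : ∀ x, ‖f x‖ ≤ C * ‖g x‖) :
    l2norm f ≤ C * l2norm g := by
  simpa using l2norm_le_of_le_sum (Finset.univ : Finset Unit) f (fun _ => g) hC (by simpa using h)

/-- The Fourier multiplier with symbol `g`. -/
noncomputable def mult (g : RSpace d → ℂ) : Sch d →L[ℂ] Sch d :=
  SchwartzMap.fourierMultiplierCLM ℂ g

lemma mult_apply (g : RSpace d → ℂ) (f : Sch d) :
    mult g f = 𝓕⁻ (SchwartzMap.smulLeftCLM ℂ g (𝓕 f)) := rfl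

lemma fourier_mult_apply {g : RSpace d → ℂ} (hg : g.HasTemperateGrowth) (f : Sch d)
    (ξ : RSpace d) : 𝓕 (mult g f) ξ = g ξ * 𝓕 f ξ := by
  rw [mult_apply, sch_fourier_fourierInv, SchwartzMap.smulLeftCLM_apply_apply hg, smul_eq_mul]

lemma mult_mult {g₁ g₂ : RSpace d → ℂ} (h₁ : g₁.HasTemperateGrowth) (h₂ : g₂.HasTemperateGrowth)
    (f : Sch d) : mult g₁ (mult g₂ f) = mult (fun ξ => g₁ ξ * g₂ ξ) f :=
  SchwartzMap.fourierMultiplierCLM_fourierMultiplierCLM_apply h₁ h₂ f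

/-- Plancherel comparison of two families of functions given on the Fourier side. -/
lemma l2norm_le_of_fourier_le (f g : Sch d) {C : ℝ} (hC : 0 ≤ C)
    (h : ∀ ξ, ‖𝓕 f ξ‖ ≤ C * ‖𝓕 g ξ‖) : l2norm f ≤ C * l2norm g := by
  rw [← l2norm_fourier f, ← l2norm_fourier g]
  exact l2norm_le_of_le _ _ hC h

lemma l2norm_mult_le {g₁ g₂ : RSpace d → ℂ} (h₁ : g₁.HasTemperateGrowth)
    (h₂ : g₂.HasTemperateGrowth) {C : ℝ} (hC : 0 ≤ C) (h : ∀ ξ, ‖g₁ ξ‖ ≤ C * ‖g₂ ξ‖) (f : Sch d) :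
    l2norm (mult g₁ f) ≤ C * l2norm (mult g₂ f) := by
  refine l2norm_le_of_fourier_le _ _ hC fun ξ => ?_
  rw [fourier_mult_apply h₁, fourier_mult_apply h₂, norm_mul, norm_mul, ← mul_assoc]
  gcongr
  exact h ξ

/-- The symbol `|2πξ|²` of `-Δ`. -/
noncomputable def symb (ξ : RSpace d) : ℝ := (2 * Real.pi) ^ 2 * ‖ξ‖ ^ 2

lemma symb_nonneg (ξ : RSpace d) : 0 ≤ symb ξ := by unfold symb; positivity

lemma symb_temperate : (fun ξ : RSpace d => (symb ξ : ℂ)).HasTemperateGrowth := by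
  unfold symb
  have h : (fun ξ : RSpace d => (2 * Real.pi) ^ 2 * ‖ξ‖ ^ 2).HasTemperateGrowth := by fun_prop
  exact Function.Complex.hasTemperateGrowth_ofReal.comp h

/-- Each derivative only multiplies the exponential by `-ih`, so all derivatives have constant
modulus and growth exponent `0` suffices. Composition with the polynomial `symb` then makes the
Schrödinger symbol an admissible multiplier. -/
lemma cexp_temperate (h : ℝ) :
    (fun x : ℝ => Complex.exp (-(Complex.I * h) * x)).HasTemperateGrowth := by
  have key : ∀ n : ℕ, iteratedDeriv n (fun x : ℝ => Complex.exp (-(Complex.I * h) * x)) =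
      fun x : ℝ => (-(Complex.I * h)) ^ n * Complex.exp (-(Complex.I * h) * x) := by
    intro n
    induction n with
    | zero => simp
    | succ n ih =>
      rw [iteratedDeriv_succ, ih]
      ext x
      have h1 : HasDerivAt (fun x : ℝ => -(Complex.I * h) * (x : ℂ)) (-(Complex.I * h)) x := by
        simpa using (Complex.ofRealCLM.hasDerivAt (x := x)).const_mul (-(Complex.I * (h : ℂ)))
      have h2 := (h1.cexp).const_mul ((-(Complex.I * (h : ℂ))) ^ n)
      rw [h2.deriv]
      ring
  have hs : ContDiff ℝ ∞ (fun x : ℝ => (x : ℂ)) := Complex.ofRealCLM.contDiff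
  refine ⟨by fun_prop, fun n => ⟨0, |h| ^ n, fun x => ?_⟩⟩
  rw [norm_iteratedFDeriv_eq_norm_iteratedDeriv, key]
  have : ‖Complex.exp (-(Complex.I * h) * x)‖ = 1 := by
    rw [Complex.norm_exp]; simp
  rw [norm_mul, this]
  simp

/-- The Schrödinger group `exp(ihΔ)`, as a symbol. -/
noncomputable def schrSymb (h : ℝ) (ξ : RSpace d) : ℂ :=
  Complex.exp (-(Complex.I * h) * (symb ξ : ℝ))

lemma schrSymb_temperate (h : ℝ) : (schrSymb h : RSpace d → ℂ).HasTemperateGrowth := by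
  have h1 : (fun ξ : RSpace d => symb ξ).HasTemperateGrowth := by
    unfold symb; fun_prop
  exact (cexp_temperate h).comp h1

lemma norm_schrSymb (h : ℝ) (ξ : RSpace d) : ‖schrSymb h ξ‖ = 1 := by
  rw [schrSymb, Complex.norm_exp]; simp

/-- The symbol `(1 + |2πξ|²)^k` of `(1 - Δ)^k`. -/
noncomputable def besselSymb (k : ℕ) (ξ : RSpace d) : ℂ := ((1 + symb ξ : ℝ) : ℂ) ^ k

lemma besselSymb_temperate (k : ℕ) : (besselSymb k : RSpace d → ℂ).HasTemperateGrowth := by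
  unfold besselSymb
  have h1 : (fun ξ : RSpace d => ((1 + symb ξ : ℝ) : ℂ)).HasTemperateGrowth := by
    unfold symb
    have h : (fun ξ : RSpace d => 1 + (2 * Real.pi) ^ 2 * ‖ξ‖ ^ 2).HasTemperateGrowth := by fun_prop
    exact Function.Complex.hasTemperateGrowth_ofReal.comp h
  exact h1.pow k

lemma norm_besselSymb (k : ℕ) (ξ : RSpace d) : ‖besselSymb k ξ‖ = (1 + symb ξ) ^ k := by
  have := symb_nonneg ξ
  rw [besselSymb, norm_pow, Complex.norm_real, Real.norm_of_nonneg (by positivity)]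

/-- The propagator `exp(ihΔ)`. -/
noncomputable def schrod (h : ℝ) : Sch d →L[ℂ] Sch d := mult (schrSymb h)

/-- The Sobolev norm `‖(1 - Δ)^k f‖` of order `2k`. -/
noncomputable def sob (k : ℕ) (f : Sch d) : ℝ := l2norm (mult (besselSymb k) f)

lemma sob_nonneg (k : ℕ) (f : Sch d) : 0 ≤ sob k f := l2norm_nonneg _

lemma sob_add_le (k : ℕ) (f g : Sch d) : sob k (f + g) ≤ sob k f + sob k g := by
  simp only [sob, map_add]; exact l2norm_add_le _ _

lemma sob_sub_le (k : ℕ) (f g : Sch d) : sob k (f - g) ≤ sob k f + sob k g := by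
  simp only [sob, map_sub]; exact l2norm_sub_le _ _

lemma sob_smul (k : ℕ) (c : ℂ) (f : Sch d) : sob k (c • f) = ‖c‖ * sob k f := by
  simp only [sob, map_smul]; exact l2norm_smul _ _

lemma sob_zero_fun (k : ℕ) : sob k (0 : Sch d) = 0 := by
  simp only [sob, map_zero]; exact l2norm_zero

lemma sob_zero (f : Sch d) : sob 0 f = l2norm f := by
  refine le_antisymm ?_ ?_
  · rw [sob, ← one_mul (l2norm f)]
    refine l2norm_le_of_fourier_le _ _ zero_le_one fun ξ => ?_
    rw [fourier_mult_apply (besselSymb_temperate 0)]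
    simp [besselSymb]
  · rw [sob, ← one_mul (l2norm (mult _ f))]
    refine l2norm_le_of_fourier_le _ _ zero_le_one fun ξ => ?_
    rw [fourier_mult_apply (besselSymb_temperate 0)]
    simp [besselSymb]

lemma sob_mono {j k : ℕ} (h : j ≤ k) (f : Sch d) : sob j f ≤ sob k f := by
  have := l2norm_mult_le (d := d) (besselSymb_temperate j) (besselSymb_temperate k) zero_le_one
    (fun ξ => by
      rw [norm_besselSymb, norm_besselSymb, one_mul]
      exact pow_le_pow_right₀ (by linarith [symb_nonneg ξ]) h) f
  rwa [one_mul] at this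

lemma l2norm_le_sob (k : ℕ) (f : Sch d) : l2norm f ≤ sob k f := by
  rw [← sob_zero]; exact sob_mono (Nat.zero_le k) f

lemma sob_mult_le {g : RSpace d → ℂ} (hg : g.HasTemperateGrowth) {C : ℝ} (hC : 0 ≤ C) (m : ℕ)
    (h : ∀ ξ, ‖g ξ‖ ≤ C * (1 + symb ξ) ^ m) (k : ℕ) (f : Sch d) :
    sob k (mult g f) ≤ C * sob (k + m) f := by
  refine l2norm_le_of_fourier_le _ _ hC fun ξ => ?_
  rw [fourier_mult_apply (besselSymb_temperate k), fourier_mult_apply hg,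
    fourier_mult_apply (besselSymb_temperate (k + m)), norm_mul, norm_mul, norm_mul,
    norm_besselSymb, norm_besselSymb]
  have h1 := h ξ
  have h2 := symb_nonneg ξ
  calc (1 + symb ξ) ^ k * (‖g ξ‖ * ‖𝓕 f ξ‖)
      ≤ (1 + symb ξ) ^ k * ((C * (1 + symb ξ) ^ m) * ‖𝓕 f ξ‖) := by gcongr
    _ = C * ((1 + symb ξ) ^ (k + m) * ‖𝓕 f ξ‖) := by ring

lemma sob_schrod_le (k : ℕ) (h : ℝ) (f : Sch d) : sob k (schrod h f) ≤ sob k f := by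
  have := sob_mult_le (schrSymb_temperate h) zero_le_one 0
    (fun ξ : RSpace d => by simp [norm_schrSymb]) k f
  simpa [schrod] using this

lemma l2norm_schrod_le (h : ℝ) (f : Sch d) : l2norm (schrod h f) ≤ l2norm f := by
  simpa [sob_zero] using sob_schrod_le 0 h f

lemma schrod_schrod (h k : ℝ) (f : Sch d) : schrod h (schrod k f) = schrod (h + k) f := by
  unfold schrod
  rw [mult_mult (schrSymb_temperate h) (schrSymb_temperate k)]
  have : (fun ξ : RSpace d => schrSymb h ξ * schrSymb k ξ) = schrSymb (h + k) := by
    ext ξ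
    simp only [schrSymb]
    rw [← Complex.exp_add]
    push_cast
    ring_nf
  rw [this]

lemma fourier_laplacian_apply (f : Sch d) (ξ : RSpace d) :
    𝓕 (Laplacian.laplacian f) ξ = -(symb ξ : ℂ) * 𝓕 f ξ := by
  have h0 : (fun ξ : RSpace d => ‖ξ‖ ^ 2).HasTemperateGrowth := by fun_prop
  have h1 : Laplacian.laplacian f = mult (fun ξ => -(symb ξ : ℂ)) f := by
    rw [SchwartzMap.laplacian_eq_fourierMultiplierCLM]
    have h2 : (fun ξ : RSpace d => -(symb ξ : ℂ)) =
        (-((2 * Real.pi : ℝ) : ℂ) ^ 2) • (fun ξ : RSpace d => ((‖ξ‖ ^ 2 : ℝ) : ℂ)) := by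
      ext ξ
      simp [symb]
    have h7 : (fun ξ : RSpace d => ((‖ξ‖ ^ 2 : ℝ) : ℂ)).HasTemperateGrowth :=
      Function.Complex.hasTemperateGrowth_ofReal.comp h0
    rw [mult, h2, SchwartzMap.fourierMultiplierCLM_smul h7]
    have h3 := SchwartzMap.fourierMultiplierCLM_ofReal (F := ℂ) ℂ h0 f
    ext x
    have h4 := congrArg (fun u : Sch d => u x) h3
    simp only at h4
    simp only [smul_apply]
    erw [← h4]
    simp
  have h6 : (fun ξ : RSpace d => -(symb ξ : ℂ)).HasTemperateGrowth := symb_temperate.neg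
  rw [h1, fourier_mult_apply h6]

lemma norm_cexp_sub_one_le (x : ℝ) : ‖Complex.exp (-(Complex.I * x)) - 1‖ ≤ |x| := by
  have := Real.norm_exp_I_mul_ofReal_sub_one_le (x := -x)
  simpa using this

/-- For `|x| ≤ 1` this is Taylor's estimate; for `|x| > 1` the crude bound `2|x|` is already below
`2x²`, whence the factor `2`. -/
lemma norm_cexp_sub_one_sub_le (x : ℝ) :
    ‖Complex.exp (-(Complex.I * x)) - 1 + Complex.I * x‖ ≤ 2 * x ^ 2 := by
  rcases le_or_gt |x| 1 with hx | hx
  · have h := Complex.norm_exp_sub_one_sub_id_le (x := -(Complex.I * x)) (by simpa using hx)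
    have h2 : ‖-(Complex.I * (x : ℂ))‖ ^ 2 = x ^ 2 := by simp
    rw [h2] at h
    have h3 : ‖Complex.exp (-(Complex.I * x)) - 1 + Complex.I * x‖ ≤ x ^ 2 := by
      simpa [sub_neg_eq_add] using h
    linarith [sq_nonneg x]
  · have h1 := norm_cexp_sub_one_le x
    have h2 : ‖Complex.I * (x : ℂ)‖ = |x| := by simp
    have h5 := norm_add_le (Complex.exp (-(Complex.I * x)) - 1) (Complex.I * x)
    rw [h2] at h5
    nlinarith [sq_abs x]

/-- `‖exp(ihΔ) f - f‖ ≤ |h| ‖f‖` with a loss of two derivatives. -/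
lemma sob_schrod_sub_le (k : ℕ) (h : ℝ) (f : Sch d) :
    sob k (schrod h f - f) ≤ |h| * sob (k + 1) f := by
  refine l2norm_le_of_fourier_le _ _ (abs_nonneg h) fun ξ => ?_
  have h0 := symb_nonneg ξ
  rw [fourier_mult_apply (besselSymb_temperate k), fourier_mult_apply (besselSymb_temperate (k + 1)),
    sch_fourier_sub, sub_apply, schrod, fourier_mult_apply (schrSymb_temperate h),
    norm_mul, norm_mul, norm_besselSymb, norm_besselSymb]
  have h1 : schrSymb h ξ * 𝓕 f ξ - 𝓕 f ξ = (schrSymb h ξ - 1) * 𝓕 f ξ := by ring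
  have h2 : ‖schrSymb h ξ - 1‖ ≤ |h| * (1 + symb ξ) := by
    have := norm_cexp_sub_one_le (h * symb ξ)
    rw [abs_mul, abs_of_nonneg h0] at this
    rw [schrSymb]
    have h3 : -(Complex.I * (h : ℂ)) * (symb ξ : ℝ) = -(Complex.I * ((h * symb ξ : ℝ) : ℂ)) := by
      push_cast; ring
    rw [h3]
    nlinarith [abs_nonneg h]
  rw [h1, norm_mul]
  calc (1 + symb ξ) ^ k * (‖schrSymb h ξ - 1‖ * ‖𝓕 f ξ‖)
      ≤ (1 + symb ξ) ^ k * ((|h| * (1 + symb ξ)) * ‖𝓕 f ξ‖) := by gcongr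
    _ = |h| * ((1 + symb ξ) ^ (k + 1) * ‖𝓕 f ξ‖) := by ring

/-- Second order expansion of the Schrödinger group. -/
lemma l2norm_schrod_sub_sub_le (h : ℝ) (f : Sch d) :
    l2norm (schrod h f - f - (Complex.I * h) • Laplacian.laplacian f) ≤ 2 * h ^ 2 * sob 2 f := by
  refine l2norm_le_of_fourier_le _ _ (by positivity) fun ξ => ?_
  have h0 := symb_nonneg ξ
  rw [fourier_mult_apply (besselSymb_temperate 2),
    sch_fourier_sub, sub_apply, sch_fourier_sub, sub_apply, schrod,
    fourier_mult_apply (schrSymb_temperate h), FourierTransform.fourier_smul, smul_apply,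
    fourier_laplacian_apply, norm_mul, norm_besselSymb]
  have h1 : schrSymb h ξ * 𝓕 f ξ - 𝓕 f ξ - (Complex.I * h) • (-(symb ξ : ℂ) * 𝓕 f ξ) =
      (schrSymb h ξ - 1 + Complex.I * ((h * symb ξ : ℝ) : ℂ)) * 𝓕 f ξ := by
    rw [smul_eq_mul]; push_cast; ring
  have h2 : ‖schrSymb h ξ - 1 + Complex.I * ((h * symb ξ : ℝ) : ℂ)‖
      ≤ 2 * h ^ 2 * (1 + symb ξ) ^ 2 := by
    have := norm_cexp_sub_one_sub_le (h * symb ξ)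
    rw [schrSymb]
    have h3 : -(Complex.I * (h : ℂ)) * (symb ξ : ℝ) = -(Complex.I * ((h * symb ξ : ℝ) : ℂ)) := by
      push_cast; ring
    rw [h3]
    refine this.trans ?_
    rw [mul_pow]
    nlinarith [sq_nonneg h, mul_nonneg (sq_nonneg h) h0]
  rw [h1, norm_mul, ← mul_assoc]
  gcongr

lemma sob_laplacian_le (k : ℕ) (f : Sch d) : sob k (Laplacian.laplacian f) ≤ sob (k + 1) f := by
  rw [← one_mul (sob (k + 1) f)]
  refine l2norm_le_of_fourier_le _ _ zero_le_one fun ξ => ?_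
  have h0 := symb_nonneg ξ
  rw [fourier_mult_apply (besselSymb_temperate k), fourier_mult_apply (besselSymb_temperate (k + 1)),
    fourier_laplacian_apply, norm_mul, norm_mul, norm_mul, norm_besselSymb, norm_besselSymb,
    norm_neg, Complex.norm_real, Real.norm_of_nonneg h0, pow_succ, one_mul, mul_assoc]
  gcongr
  linarith

/-- Interpolation: `‖(1 - Δ)^k f‖² ≤ ‖f‖ ‖(1 - Δ)^(2k) f‖`. -/
lemma sob_sq_le (k : ℕ) (f : Sch d) : sob k f ^ 2 ≤ l2norm f * sob (2 * k) f := by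
  -- By Plancherel both pairings are the integral of `(1 + symb)^(2k) |𝓕 f|²`. Moving the whole
  -- weight onto one factor and applying Cauchy–Schwarz gives the interpolation.
  have h1 : ((sob k f ^ 2 : ℝ) : ℂ) =
      inner ℂ ((f).toLp 2 volume) ((mult (besselSymb (2 * k)) f).toLp 2 volume) := by
    have h2 : ((sob k f ^ 2 : ℝ) : ℂ) = inner ℂ ((mult (besselSymb k) f).toLp 2 volume)
        ((mult (besselSymb k) f).toLp 2 volume) := by
      rw [inner_self_eq_norm_sq_to_K]; simp [sob, l2norm]
    rw [h2, ← SchwartzMap.inner_fourier_toL2_eq, ← SchwartzMap.inner_fourier_toL2_eq f,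
      SchwartzMap.inner_toL2_toL2_eq _ _ volume, SchwartzMap.inner_toL2_toL2_eq _ _ volume]
    congr 1
    ext ξ
    rw [fourier_mult_apply (besselSymb_temperate k),
      fourier_mult_apply (besselSymb_temperate (2 * k))]
    simp only [RCLike.inner_apply, map_mul, besselSymb, map_pow, Complex.conj_ofReal]
    ring
  have h3 := norm_inner_le_norm (𝕜 := ℂ) (f.toLp 2 volume)
    ((mult (besselSymb (2 * k)) f).toLp 2 volume)
  rw [← h1, Complex.norm_real, Real.norm_of_nonneg (sq_nonneg _)] at h3
  exact h3

end Multipliers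

/-! ### Derivatives, Sobolev norms and the Sobolev embedding -/

section Sobolev

open FourierTransform LineDeriv

variable {d : ℕ}

/-- The standard basis vectors of `ℝ^d`. -/
noncomputable def stdVec (i : Fin d) : RSpace d := EuclideanSpace.single i (1 : ℝ)

lemma norm_stdVec (i : Fin d) : ‖stdVec i‖ = 1 := by simp [stdVec]

lemma eq_sum_stdVec (x : RSpace d) : x = ∑ i, x i • stdVec i := by
  ext j
  simp [stdVec, Finset.sum_apply, Pi.single_apply]

lemma abs_coord_le (x : RSpace d) (i : Fin d) : |x i| ≤ ‖x‖ := by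
  simpa using EuclideanSpace.norm_eq x ▸ Real.abs_le_sqrt (by
    have := Finset.single_le_sum (f := fun j => ‖x j‖ ^ 2) (fun j _ => by positivity)
      (Finset.mem_univ i)
    simpa using this)

/-- Each argument is expanded in the standard basis. This reduces the operator norm of an iterated
derivative to finitely many partial derivatives, which are again Schwartz functions with explicit
Fourier symbols. -/
lemma norm_multilinear_le_sum {F : Type*} [NormedAddCommGroup F] [NormedSpace ℝ F] {n : ℕ}
    (T : ContinuousMultilinearMap ℝ (fun _ : Fin n => RSpace d) F) :
    ‖T‖ ≤ ∑ l : Fin n → Fin d, ‖T (fun i => stdVec (l i))‖ := by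
  refine ContinuousMultilinearMap.opNorm_le_bound (Finset.sum_nonneg fun _ _ => norm_nonneg _) ?_
  intro m
  have h1 : T m = ∑ l : Fin n → Fin d, (∏ i, m i (l i)) • T (fun i => stdVec (l i)) := by
    have h2 : m = fun i => ∑ j, m i j • stdVec j := by
      ext1 i; exact eq_sum_stdVec (m i)
    conv_lhs => rw [h2]
    have := T.toMultilinearMap.map_sum (fun (i : Fin n) (j : Fin d) => m i j • stdVec j)
    simp only [ContinuousMultilinearMap.coe_coe] at this
    rw [this]
    refine Finset.sum_congr rfl fun l _ => ?_
    exact T.toMultilinearMap.map_smul_univ (fun i => m i (l i)) (fun i => stdVec (l i))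
  rw [h1, Finset.sum_mul]
  refine (norm_sum_le _ _).trans (Finset.sum_le_sum fun l _ => ?_)
  rw [norm_smul, mul_comm, norm_prod]
  gcongr with i
  exact abs_coord_le _ _

/-- The iterated partial derivative `∂_{l 0} ⋯ ∂_{l (n-1)} f`. -/
noncomputable def pderiv {n : ℕ} (l : Fin n → Fin d) (f : Sch d) : Sch d :=
  ∂^{fun i => stdVec (l i)} f

lemma pderiv_apply {n : ℕ} (l : Fin n → Fin d) (f : Sch d) (x : RSpace d) :
    pderiv l f x = iteratedFDeriv ℝ n f x (fun i => stdVec (l i)) :=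
  SchwartzMap.iteratedLineDerivOp_eq_iteratedFDeriv

lemma norm_pderiv_le {n : ℕ} (l : Fin n → Fin d) (f : Sch d) (x : RSpace d) :
    ‖pderiv l f x‖ ≤ ‖iteratedFDeriv ℝ n f x‖ := by
  rw [pderiv_apply]
  refine (ContinuousMultilinearMap.le_opNorm _ _).trans ?_
  simp [norm_stdVec]

lemma norm_iteratedFDeriv_le_sum_pderiv (n : ℕ) (f : Sch d) (x : RSpace d) :
    ‖iteratedFDeriv ℝ n f x‖ ≤ ∑ l : Fin n → Fin d, ‖pderiv l f x‖ := by
  simp only [pderiv_apply]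
  exact norm_multilinear_le_sum _

lemma fourier_lineDeriv_apply (m : RSpace d) (f : Sch d) (ξ : RSpace d) :
    𝓕 (∂_{m} f) ξ = (2 * Real.pi * Complex.I) * (inner ℝ ξ m : ℝ) * 𝓕 f ξ := by
  rw [SchwartzMap.fourier_lineDerivOp_eq]
  have h : (fun ξ : RSpace d => inner ℝ ξ m).HasTemperateGrowth := by fun_prop
  rw [smul_apply, SchwartzMap.smulLeftCLM_apply_apply h]
  simp [mul_assoc]

lemma fourier_pderiv_apply {n : ℕ} (l : Fin n → Fin d) (f : Sch d) (ξ : RSpace d) :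
    𝓕 (pderiv l f) ξ = (∏ i, (2 * Real.pi * Complex.I) * ((ξ (l i) : ℝ) : ℂ)) * 𝓕 f ξ := by
  induction n with
  | zero => simp [pderiv]
  | succ n ih =>
    have h1 : pderiv l f = ∂_{stdVec (l 0)} (pderiv (fun i => l i.succ) f) := rfl
    rw [h1, fourier_lineDeriv_apply, ih, Fin.prod_univ_succ]
    simp [stdVec, EuclideanSpace.inner_single_right, mul_assoc]

lemma two_pi_mul_pow_le (ξ : RSpace d) {n k : ℕ} (h : n ≤ 2 * k) :
    (2 * Real.pi * ‖ξ‖) ^ n ≤ (1 + symb ξ) ^ k := by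
  set r := 2 * Real.pi * ‖ξ‖ with hr
  have hr0 : 0 ≤ r := by positivity
  have hs : symb ξ = r ^ 2 := by rw [symb, hr]; ring
  rw [hs]
  rcases le_or_gt r 1 with h1 | h1
  · exact (pow_le_one₀ hr0 h1).trans (one_le_pow₀ (by nlinarith))
  · calc r ^ n ≤ r ^ (2 * k) := pow_le_pow_right₀ h1.le h
      _ = (r ^ 2) ^ k := by rw [pow_mul]
      _ ≤ _ := by gcongr; linarith

lemma sob_pderiv_le {n m : ℕ} (hm : n ≤ 2 * m) (l : Fin n → Fin d) (k : ℕ) (f : Sch d) :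
    sob k (pderiv l f) ≤ sob (k + m) f := by
  rw [← one_mul (sob (k + m) f)]
  refine l2norm_le_of_fourier_le _ _ zero_le_one fun ξ => ?_
  have h0 := symb_nonneg ξ
  rw [fourier_mult_apply (besselSymb_temperate k), fourier_mult_apply (besselSymb_temperate (k + m)),
    fourier_pderiv_apply, norm_mul, norm_mul, norm_mul, norm_besselSymb, norm_besselSymb, one_mul]
  have h1 : ‖∏ i, (2 * Real.pi * Complex.I) * ((ξ (l i) : ℝ) : ℂ)‖ ≤ (1 + symb ξ) ^ m := by
    rw [norm_prod]
    calc ∏ i, ‖(2 * Real.pi * Complex.I) * ((ξ (l i) : ℝ) : ℂ)‖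
        ≤ ∏ i : Fin n, (2 * Real.pi * ‖ξ‖) := by
          refine Finset.prod_le_prod (fun _ _ => norm_nonneg _) fun i _ => ?_
          have := abs_coord_le ξ (l i)
          have h2 : ‖(2 * Real.pi * Complex.I) * ((ξ (l i) : ℝ) : ℂ)‖ = 2 * Real.pi * |ξ (l i)| := by
            simp [abs_of_pos Real.pi_pos]
          rw [h2]
          gcongr
      _ = (2 * Real.pi * ‖ξ‖) ^ n := by simp
      _ ≤ _ := two_pi_mul_pow_le ξ hm
  calc (1 + symb ξ) ^ k * (‖∏ i, (2 * Real.pi * Complex.I) * ((ξ (l i) : ℝ) : ℂ)‖ * ‖𝓕 f ξ‖)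
      ≤ (1 + symb ξ) ^ k * ((1 + symb ξ) ^ m * ‖𝓕 f ξ‖) := by gcongr
    _ = (1 + symb ξ) ^ (k + m) * ‖𝓕 f ξ‖ := by ring

lemma l2norm_pderiv_le {n m : ℕ} (hm : n ≤ 2 * m) (l : Fin n → Fin d) (f : Sch d) :
    l2norm (pderiv l f) ≤ sob m f := by
  have := sob_pderiv_le hm l 0 f
  rwa [sob_zero, zero_add] at this

/-- The Sobolev norm is controlled by `f` and its pure derivatives of top order. -/
lemma exists_sob_le (d k : ℕ) : ∃ C : ℝ, 0 ≤ C ∧ ∀ f : Sch d,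
    sob k f ≤ C * (l2norm f + ∑ i : Fin d, l2norm (pderiv (fun _ : Fin (2 * k) => i) f)) := by
  refine ⟨((d : ℝ) + 1) ^ k, by positivity, fun f => ?_⟩
  have h1 := l2norm_le_of_le_sum (Finset.univ : Finset (Option (Fin d)))
    (𝓕 (mult (besselSymb k) f)) (fun o => match o with
      | none => 𝓕 f
      | some i => 𝓕 (pderiv (fun _ : Fin (2 * k) => i) f)) (C := ((d : ℝ) + 1) ^ k) (by positivity)
    (fun ξ => by
      rw [fourier_mult_apply (besselSymb_temperate k), Fintype.sum_option]
      simp only [fourier_pderiv_apply, norm_mul, norm_besselSymb]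
      rw [← Finset.sum_mul, ← one_add_mul, ← mul_assoc]
      gcongr
      simp only [Finset.prod_const, Finset.card_univ, Fintype.card_fin, norm_pow]
      set a : Option (Fin d) → ℝ := fun o => match o with
        | none => 1
        | some i => (2 * Real.pi * |ξ i|) ^ 2 with ha
      have ha0 : ∀ o, 0 ≤ a o := by rintro (_ | i) <;> simp only [ha] <;> positivity
      have h2 : 1 + symb ξ = ∑ o, a o := by
        rw [Fintype.sum_option]
        simp only [ha, symb, mul_pow, sq_abs, EuclideanSpace.norm_sq_eq, Finset.mul_sum,
          Real.norm_eq_abs]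
      have h3 : 1 + ∑ i : Fin d, ‖2 * Real.pi * Complex.I * ((ξ i : ℝ) : ℂ)‖ ^ (2 * k)
          = ∑ o, a o ^ k := by
        rw [Fintype.sum_option]
        simp only [ha, one_pow, ← pow_mul]
        congr 1
        refine Finset.sum_congr rfl fun i _ => ?_
        congr 1
        simp [abs_of_pos Real.pi_pos]
      rw [h2, h3]
      -- A sum of `d + 1` nonnegative terms is at most `d + 1` times the largest one, and the `k`-th
      -- power of the largest is one term of the sum of powers. This is the origin of `(d + 1)^k`.
      obtain ⟨o, -, ho⟩ := Finset.exists_max_image Finset.univ a ⟨none, Finset.mem_univ _⟩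
      calc (∑ o, a o) ^ k ≤ (((d : ℝ) + 1) * a o) ^ k := by
            gcongr
            · exact Finset.sum_nonneg fun o _ => ha0 o
            · have := Finset.sum_le_card_nsmul Finset.univ a (a o) (fun x hx => ho x hx)
              simpa using this
        _ = ((d : ℝ) + 1) ^ k * a o ^ k := mul_pow _ _ _
        _ ≤ _ := by
            gcongr
            exact Finset.single_le_sum (f := fun o => a o ^ k) (fun o _ => pow_nonneg (ha0 o) k)
              (Finset.mem_univ o))
  rw [l2norm_fourier, Fintype.sum_option] at h1
  simpa only [l2norm_fourier, sob] using h1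

lemma norm_apply_le_integral_fourier (f : Sch d) (x : RSpace d) :
    ‖f x‖ ≤ ‖(𝓕 f).toLp 1 volume‖ := by
  have h1 : f x = 𝓕 (𝓕 f) (-x) := by
    have h2 : 𝓕⁻ (𝓕 f : Sch d) = f := fourierInv_fourier_eq f
    conv_lhs => rw [← h2, SchwartzMap.fourierInv_apply_eq]
    simp
  rw [h1]
  exact SchwartzMap.norm_fourier_apply_le_toLp_one _ _

/-- Sobolev embedding. -/
lemma exists_norm_le_sob (d : ℕ) : ∃ C : ℝ, 0 ≤ C ∧ ∀ (f : Sch d) (x : RSpace d),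
    ‖f x‖ ≤ C * sob (d + 1) f := by
  -- `𝓕 f` is the product of `φ` and the transform of `(1 - Δ)^(d+1) f`. Since `φ` is square
  -- integrable, Cauchy–Schwarz bounds the `L¹` norm of `𝓕 f`, hence the supremum of `f`.
  set φ : RSpace d → ℝ := fun ξ => ((1 + symb ξ) ^ (d + 1))⁻¹ with hφ
  have hpos : ∀ ξ : RSpace d, 0 < (1 + symb ξ) ^ (d + 1) := fun ξ => by
    have := symb_nonneg ξ; positivity
  have hcont : Continuous φ := by
    refine Continuous.inv₀ ?_ fun ξ => (hpos ξ).ne'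
    unfold symb; fun_prop
  have hmem : MemLp φ 2 volume := by
    rw [memLp_two_iff_integrable_sq hcont.aestronglyMeasurable]
    have h1 : Integrable (fun x : RSpace d => (1 + ‖x‖ ^ 2) ^ (-(2 * ((d : ℝ) + 1)) / 2)) volume :=
      integrable_rpow_neg_one_add_norm_sq (by simp; linarith [Nat.cast_nonneg (α := ℝ) d])
    refine h1.mono' (hcont.pow 2).aestronglyMeasurable (Eventually.of_forall fun ξ => ?_)
    have h2 : (1 + ‖ξ‖ ^ 2) ≤ 1 + symb ξ := by
      have : 1 ≤ (2 * Real.pi) ^ 2 := by nlinarith [Real.pi_gt_three]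
      unfold symb
      nlinarith [sq_nonneg ‖ξ‖]
    have h3 : (-(2 * ((d : ℝ) + 1)) / 2) = -((d + 1 : ℕ) : ℝ) := by push_cast; ring
    rw [h3, Real.rpow_neg (by positivity), Real.rpow_natCast, Real.norm_of_nonneg (by positivity)]
    have h4 : (1 + ‖ξ‖ ^ 2) ^ (d + 1) ≤ (1 + symb ξ) ^ (d + 1) := by gcongr
    have h5 : (1 : ℝ) ≤ (1 + symb ξ) ^ (d + 1) := one_le_pow₀ (by linarith [symb_nonneg ξ])
    have h6 : φ ξ ≤ 1 := by simp only [hφ]; exact inv_le_one_of_one_le₀ h5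
    have h7 : 0 ≤ φ ξ := (inv_pos.mpr (hpos ξ)).le
    -- The square is wasted: `φ` itself is already dominated by the integrable weight `(1 +
    -- |ξ|²)^(-(d+1))`.
    calc φ ξ ^ 2 ≤ φ ξ := by nlinarith
      _ ≤ _ := by simp only [hφ]; gcongr
  refine ⟨(eLpNorm φ 2 volume).toReal, ENNReal.toReal_nonneg, fun f x => ?_⟩
  refine (norm_apply_le_integral_fourier f x).trans ?_
  set G : Sch d := 𝓕 (mult (besselSymb (d + 1)) f) with hG
  have h1 : ((𝓕 f : Sch d) : RSpace d → ℂ) = fun ξ => φ ξ • G ξ := by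
    ext ξ
    rw [hG, fourier_mult_apply (besselSymb_temperate _)]
    have := hpos ξ
    simp only [hφ, besselSymb, Complex.real_smul]
    push_cast
    have h8 : ((1 : ℂ) + (symb ξ : ℂ)) ^ (d + 1) ≠ 0 := by exact_mod_cast this.ne'
    field_simp
  have h2 : sob (d + 1) f = (eLpNorm G 2 volume).toReal := by
    rw [sob, ← l2norm_fourier, l2norm_eq]
  rw [SchwartzMap.norm_toLp, h2, ← ENNReal.toReal_mul]
  refine ENNReal.toReal_mono (ENNReal.mul_ne_top hmem.eLpNorm_ne_top
    (G.memLp 2 volume).eLpNorm_ne_top) ?_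
  have h3 : eLpNorm (𝓕 f : Sch d) 1 volume = eLpNorm (φ • (G : RSpace d → ℂ)) 1 volume := by
    congr 1
  rw [h3]
  exact eLpNorm_smul_le_mul_eLpNorm G.continuous.aestronglyMeasurable hcont.aestronglyMeasurable

/-- Sobolev embedding for derivatives. -/
lemma exists_norm_iteratedFDeriv_le_sob (d n : ℕ) : ∃ C : ℝ, 0 ≤ C ∧
    ∀ (f : Sch d) (x : RSpace d), ‖iteratedFDeriv ℝ n f x‖ ≤ C * sob (d + 1 + (n + 1) / 2) f := by
  obtain ⟨C, hC, h⟩ := exists_norm_le_sob d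
  refine ⟨(Fintype.card (Fin n → Fin d)) * C, by positivity, fun f x => ?_⟩
  refine (norm_iteratedFDeriv_le_sum_pderiv n f x).trans ?_
  have := Finset.sum_le_card_nsmul (Finset.univ : Finset (Fin n → Fin d))
    (fun l => ‖pderiv l f x‖) (C * sob (d + 1 + (n + 1) / 2) f) (fun l _ =>
      (h _ x).trans (mul_le_mul_of_nonneg_left (sob_pderiv_le (by lia) l _ f) hC))
  simpa [mul_assoc] using this

lemma exists_eLpNorm_iteratedFDeriv_le_sob (d n : ℕ) : ∃ C : ℝ, 0 ≤ C ∧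
    ∀ f : Sch d, eLpNorm (iteratedFDeriv ℝ n f) 2 volume ≤ ENNReal.ofReal (C * sob n f) := by
  refine ⟨(Fintype.card (Fin n → Fin d)), by positivity, fun f => ?_⟩
  have h1 : eLpNorm (iteratedFDeriv ℝ n f) 2 volume ≤
      eLpNorm (∑ l : Fin n → Fin d, fun x => ‖pderiv l f x‖) 2 volume := by
    refine eLpNorm_mono_real fun x => ?_
    simpa using norm_iteratedFDeriv_le_sum_pderiv n f x
  refine h1.trans ((eLpNorm_sum_le (fun l _ =>
    (pderiv l f).continuous.norm.aestronglyMeasurable) (by norm_num)).trans ?_)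
  simp only [eLpNorm_norm]
  have := Finset.sum_le_card_nsmul (Finset.univ : Finset (Fin n → Fin d))
    (fun l => eLpNorm (pderiv l f) 2 volume) (ENNReal.ofReal (sob n f)) (fun l _ => by
      rw [← ofReal_l2norm]
      exact ENNReal.ofReal_le_ofReal (l2norm_pderiv_le (by lia) l f))
  rw [ENNReal.ofReal_mul (by positivity)]
  simpa using this

end Sobolev

/-! ### Composition of Schwartz functions with nonlinear maps -/

section Composition

lemma sum_partSize {n : ℕ} (c : OrderedFinpartition n) : ∑ m, c.partSize m = n := by
  have := Fintype.card_congr c.equivSigma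
  simpa using this

/-- A tame form of the Faà di Bruno estimate: at most one factor carries more than half of the
derivatives. -/
lemma norm_iteratedFDeriv_comp_le_tame {E F G : Type*} [NormedAddCommGroup E] [NormedSpace ℝ E]
    [NormedAddCommGroup F] [NormedSpace ℝ F] [NormedAddCommGroup G] [NormedSpace ℝ G]
    {N : F → G} {f : E → F} (hN : ContDiff ℝ ∞ N) (hf : ContDiff ℝ ∞ f) (x : E) {n : ℕ}
    (hn : 1 ≤ n) {B W : ℝ} (hB : ∀ i ≤ n, ‖iteratedFDeriv ℝ i N (f x)‖ ≤ B) (hW1 : 1 ≤ W)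
    (hW : ∀ i, 1 ≤ i → 2 * i ≤ n → ‖iteratedFDeriv ℝ i f x‖ ≤ W) :
    ‖iteratedFDeriv ℝ n (N ∘ f) x‖ ≤ Fintype.card (OrderedFinpartition n) * B * W ^ n *
      ∑ i ∈ Finset.range (n + 1), ‖iteratedFDeriv ℝ i f x‖ := by
  have h1 := iteratedFDeriv_comp (𝕜 := ℝ) (n := ∞) (i := n) (x := x) hN.contDiffAt hf.contDiffAt
    (by exact_mod_cast le_top)
  rw [h1]
  have hB0 : 0 ≤ B := (norm_nonneg _).trans (hB 0 (Nat.zero_le _))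
  set S := ∑ i ∈ Finset.range (n + 1), ‖iteratedFDeriv ℝ i f x‖ with hS
  have key : ∀ c : OrderedFinpartition n,
      ‖(ftaylorSeries ℝ N (f x)).compAlongOrderedFinpartition (ftaylorSeries ℝ f x) c‖
        ≤ B * W ^ n * S := by
    intro c
    refine (c.norm_compAlongOrderedFinpartition_le _ _).trans ?_
    have hlen : 0 < c.length := c.length_pos (by lia)
    -- `m₀` is a largest block. Any other block together with it has size at most `n`, so the other
    -- block has size at most `n / 2` and its factor is bounded by `W`. Only the factor of `m₀` is
    -- charged to `S`.
    obtain ⟨m₀, -, hm₀⟩ := Finset.exists_max_image Finset.univ c.partSize ⟨⟨0, hlen⟩, Finset.mem_univ _⟩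
    have h2 : ∏ m, ‖ftaylorSeries ℝ f x (c.partSize m)‖ ≤ S * W ^ n := by
      rw [← Finset.mul_prod_erase Finset.univ _ (Finset.mem_univ m₀)]
      have h3 : ∏ m ∈ Finset.univ.erase m₀, ‖ftaylorSeries ℝ f x (c.partSize m)‖
          ≤ ∏ m ∈ Finset.univ.erase m₀, W := by
        refine Finset.prod_le_prod (fun _ _ => norm_nonneg _) fun m hm => ?_
        refine hW _ (c.partSize_pos m) ?_
        have hne : m ≠ m₀ := (Finset.mem_erase.mp hm).1
        have h4 : c.partSize m + c.partSize m₀ ≤ n := by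
          have h7 := Finset.add_sum_erase Finset.univ c.partSize (Finset.mem_univ m₀)
          rw [sum_partSize c] at h7
          have h8 := Finset.single_le_sum (f := c.partSize) (fun _ _ => Nat.zero_le _) hm
          lia
        have := hm₀ m (Finset.mem_univ m)
        lia
      have h5 : ∏ m ∈ Finset.univ.erase m₀, W ≤ W ^ n := by
        rw [Finset.prod_const]
        refine pow_le_pow_right₀ hW1 ?_
        rw [Finset.card_erase_of_mem (Finset.mem_univ _), Finset.card_univ, Fintype.card_fin]
        have := c.length_le
        lia
      have h6 : ‖ftaylorSeries ℝ f x (c.partSize m₀)‖ ≤ S := by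
        rw [hS]
        exact Finset.single_le_sum (f := fun i => ‖iteratedFDeriv ℝ i f x‖)
          (fun _ _ => norm_nonneg _)
          (Finset.mem_range.mpr (Nat.lt_succ_of_le (c.partSize_le m₀)))
      have hS0 : 0 ≤ S := (norm_nonneg _).trans h6
      exact mul_le_mul h6 (h3.trans h5) (Finset.prod_nonneg fun _ _ => norm_nonneg _) hS0
    calc _ ≤ B * (S * W ^ n) := by
          refine mul_le_mul (hB _ c.length_le) h2 (Finset.prod_nonneg fun _ _ => norm_nonneg _) hB0
      _ = _ := by ring
  calc _ ≤ ∑ c : OrderedFinpartition n,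
        ‖(ftaylorSeries ℝ N (f x)).compAlongOrderedFinpartition (ftaylorSeries ℝ f x) c‖ :=
        norm_sum_le _ _
    _ ≤ ∑ c : OrderedFinpartition n, B * W ^ n * S := Finset.sum_le_sum fun c _ => key c
    _ = _ := by simp [Finset.sum_const, mul_assoc]

/-- Smooth maps of `ℂ` vanishing at `0`, all of whose derivatives are bounded. -/
structure IsNonlinearity (N : ℂ → ℂ) : Prop where
  smooth : ContDiff ℝ ∞ N
  zero : N 0 = 0
  bounded : ∀ n : ℕ, ∃ B : ℝ, ∀ z, ‖iteratedFDeriv ℝ n N z‖ ≤ B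

lemma IsNonlinearity.exists_bound {N : ℂ → ℂ} (hN : IsNonlinearity N) (n : ℕ) :
    ∃ B : ℝ, 0 ≤ B ∧ ∀ i ≤ n, ∀ z, ‖iteratedFDeriv ℝ i N z‖ ≤ B := by
  choose B hB using hN.bounded
  have hB0 : ∀ i, 0 ≤ B i := fun i => (norm_nonneg _).trans (hB i 0)
  refine ⟨∑ i ∈ Finset.range (n + 1), B i, Finset.sum_nonneg fun i _ => hB0 i, fun i hi z => ?_⟩
  exact (hB i z).trans (Finset.single_le_sum (f := B) (fun i _ => hB0 i)
    (Finset.mem_range.mpr (Nat.lt_succ_of_le hi)))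

lemma IsNonlinearity.exists_lipschitz {N : ℂ → ℂ} (hN : IsNonlinearity N) :
    ∃ L : ℝ, 0 ≤ L ∧ ∀ z w, ‖N z - N w‖ ≤ L * ‖z - w‖ := by
  obtain ⟨L, hL⟩ := hN.bounded 1
  refine ⟨L, (norm_nonneg _).trans (hL 0), fun z w => ?_⟩
  refine Convex.norm_image_sub_le_of_norm_fderiv_le (𝕜 := ℝ) (s := univ)
    (fun x _ => (hN.smooth.differentiable (by simp)) x) (fun x _ => ?_) convex_univ
    (mem_univ _) (mem_univ _)
  rw [← norm_iteratedFDeriv_one]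
  exact hL x

variable {d : ℕ}

/-- The Schwartz function `N ∘ f`. -/
noncomputable def nonlin {N : ℂ → ℂ} (hN : IsNonlinearity N) (f : Sch d) : Sch d where
  toFun := N ∘ f
  smooth' := hN.smooth.comp (f.smooth ⊤)
  decay' := by
    intro k n
    -- At order zero the decay comes from `N 0 = 0` and the Lipschitz bound. At positive order the
    -- tame estimate is linear in the derivatives of `f` once their suprema are absorbed in `W`, and
    -- that linear factor carries the decay.
    rcases Nat.eq_zero_or_pos n with rfl | hn
    · obtain ⟨L, hL0, hL⟩ := hN.exists_lipschitz
      obtain ⟨C, -, hC⟩ := f.decay k 0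
      refine ⟨L * C, fun x => ?_⟩
      have h1 := hL (f x) 0
      have h2 := hC x
      rw [hN.zero, sub_zero, sub_zero] at h1
      rw [norm_iteratedFDeriv_zero] at h2 ⊢
      calc ‖x‖ ^ k * ‖N (f x)‖ ≤ ‖x‖ ^ k * (L * ‖f x‖) := by gcongr
        _ = L * (‖x‖ ^ k * ‖f x‖) := by ring
        _ ≤ _ := by gcongr
    · obtain ⟨B, hB0, hB⟩ := hN.exists_bound n
      choose C hCpos hC using f.decay k
      choose D hDpos hD using f.decay 0
      have hD' : ∀ i x, ‖iteratedFDeriv ℝ i f x‖ ≤ D i := fun i x => by simpa using hD i x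
      set W := 1 + ∑ i ∈ Finset.range (n + 1), D i with hW
      have hsum : 0 ≤ ∑ i ∈ Finset.range (n + 1), D i := Finset.sum_nonneg fun i _ => (hDpos i).le
      refine ⟨Fintype.card (OrderedFinpartition n) * B * W ^ n * ∑ i ∈ Finset.range (n + 1), C i,
        fun x => ?_⟩
      have h1 := norm_iteratedFDeriv_comp_le_tame hN.smooth (f.smooth ⊤) x hn
        (fun i hi => hB i hi (f x)) (W := W) (by linarith) (fun i _ hi => (hD' i x).trans (by
          have := Finset.single_le_sum (f := D) (fun i _ => (hDpos i).le)
            (Finset.mem_range.mpr (show i < n + 1 by lia))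
          linarith))
      have hW0 : 0 ≤ W := by linarith
      calc ‖x‖ ^ k * ‖iteratedFDeriv ℝ n (N ∘ f) x‖
          ≤ ‖x‖ ^ k * (Fintype.card (OrderedFinpartition n) * B * W ^ n *
            ∑ i ∈ Finset.range (n + 1), ‖iteratedFDeriv ℝ i f x‖) := by gcongr
        _ = Fintype.card (OrderedFinpartition n) * B * W ^ n *
            ∑ i ∈ Finset.range (n + 1), ‖x‖ ^ k * ‖iteratedFDeriv ℝ i f x‖ := by
              rw [← Finset.mul_sum]; ring
        _ ≤ _ := by gcongr with i hi; exact hC i x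

lemma nonlin_apply {N : ℂ → ℂ} (hN : IsNonlinearity N) (f : Sch d) (x : RSpace d) :
    nonlin hN f x = N (f x) := rfl

lemma exists_l2norm_nonlin_sub_le {N : ℂ → ℂ} (hN : IsNonlinearity N) :
    ∃ L : ℝ, 0 ≤ L ∧ ∀ f g : Sch d,
      l2norm (nonlin hN f - nonlin hN g) ≤ L * l2norm (f - g) := by
  obtain ⟨L, hL0, hL⟩ := hN.exists_lipschitz
  refine ⟨L, hL0, fun f g => l2norm_le_of_le _ _ hL0 fun x => ?_⟩
  simpa [nonlin_apply] using hL (f x) (g x)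

lemma nonlin_zero {N : ℂ → ℂ} (hN : IsNonlinearity N) : nonlin hN (0 : Sch d) = 0 := by
  ext x; simp [nonlin_apply, hN.zero]

/-- The tame estimate for composition in Sobolev norms. -/
lemma exists_sob_nonlin_le {N : ℂ → ℂ} (hN : IsNonlinearity N) {k m : ℕ}
    (hkm : d + 1 + (k + 1) / 2 ≤ m) (M : ℝ) :
    ∃ C : ℝ, 0 ≤ C ∧ ∀ f : Sch d, sob m f ≤ M → sob k (nonlin hN f) ≤ C * sob k f := by
  obtain ⟨L, hL0, hL⟩ := exists_l2norm_nonlin_sub_le (d := d) hN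
  have hbase : ∀ f : Sch d, l2norm (nonlin hN f) ≤ L * sob k f := fun f => by
    have := hL f 0
    rw [nonlin_zero, sub_zero, sub_zero] at this
    exact this.trans (by gcongr; exact l2norm_le_sob k f)
  obtain ⟨C₁, hC₁, hsob⟩ := exists_sob_le d k
  obtain ⟨B, hB0, hB⟩ := hN.exists_bound (2 * k)
  choose S hS0 hS using exists_norm_iteratedFDeriv_le_sob d
  -- In a derivative of order `2k`, all factors but one have order at most `k`. The Sobolev
  -- embedding bounds those in supremum norm by `sob m f`; this is the role of the condition on `m`.
  set W := 1 + ∑ i ∈ Finset.range (k + 1), S i * |M| with hW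
  have hsum : 0 ≤ ∑ i ∈ Finset.range (k + 1), S i * |M| :=
    Finset.sum_nonneg fun i _ => mul_nonneg (hS0 i) (abs_nonneg M)
  have hW0 : 0 ≤ W := by linarith
  set K := (Fintype.card (OrderedFinpartition (2 * k)) : ℝ) * B * W ^ (2 * k) with hK
  have hK0 : 0 ≤ K := by positivity
  set R : ℝ := ∑ i ∈ Finset.range (2 * k + 1), (Fintype.card (Fin i → Fin d) : ℝ) with hR
  rcases Nat.eq_zero_or_pos k with rfl | hk
  · refine ⟨L, hL0, fun f _ => ?_⟩
    rw [sob_zero]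
    exact hbase f
  refine ⟨C₁ * (L + d * (K * R)), by positivity, fun f hf => ?_⟩
  have hpt : ∀ x, ‖iteratedFDeriv ℝ (2 * k) (N ∘ f) x‖ ≤
      K * ∑ i ∈ Finset.range (2 * k + 1), ‖iteratedFDeriv ℝ i f x‖ := fun x => by
    refine norm_iteratedFDeriv_comp_le_tame hN.smooth (f.smooth ⊤) x (by lia)
        (fun i hi => hB i hi (f x)) (W := W) (by linarith) (fun i _ hi => ?_)
    have h1 : ‖iteratedFDeriv ℝ i f x‖ ≤ S i * |M| := by
      refine (hS i f x).trans ?_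
      have h2 := hS0 i
      gcongr
      exact (sob_mono (by lia) f).trans (hf.trans (le_abs_self M))
    have := Finset.single_le_sum (f := fun i => S i * |M|)
      (fun i _ => mul_nonneg (hS0 i) (abs_nonneg M))
      (Finset.mem_range.mpr (show i < k + 1 by lia))
    linarith
  have hp : ∀ i : Fin d, l2norm (pderiv (fun _ : Fin (2 * k) => i) (nonlin hN f)) ≤
      K * R * sob k f := by
    intro i
    have h1 := l2norm_le_of_le_sum ((Finset.range (2 * k + 1)).sigma fun j =>
      (Finset.univ : Finset (Fin j → Fin d)))
      (pderiv (fun _ : Fin (2 * k) => i) (nonlin hN f)) (fun p => pderiv p.2 f) hK0 (fun x => by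
        refine (norm_pderiv_le _ _ x).trans ((hpt x).trans ?_)
        rw [Finset.sum_sigma]
        gcongr with j hj
        exact norm_iteratedFDeriv_le_sum_pderiv j f x)
    refine h1.trans ?_
    rw [mul_assoc K R]
    refine mul_le_mul_of_nonneg_left ?_ hK0
    rw [Finset.sum_sigma, hR, Finset.sum_mul]
    refine Finset.sum_le_sum fun j hj => ?_
    have := Finset.sum_le_card_nsmul (Finset.univ : Finset (Fin j → Fin d))
      (fun l => l2norm (pderiv l f)) (sob k f) (fun l _ =>
        l2norm_pderiv_le (by have := Finset.mem_range.mp hj; lia) l f)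
    simpa using this
  calc sob k (nonlin hN f) ≤ C₁ * (l2norm (nonlin hN f) +
        ∑ i : Fin d, l2norm (pderiv (fun _ : Fin (2 * k) => i) (nonlin hN f))) := hsob _
    _ ≤ C₁ * (L * sob k f + ∑ i : Fin d, K * R * sob k f) := by
        gcongr with i
        · exact hbase f
        · exact hp i
    _ = _ := by simp; ring

end Composition

/-! ### A splitting scheme for the nonlinear Schrödinger equation -/

section Scheme

variable {d : ℕ} {N : ℂ → ℂ} (hN : IsNonlinearity N)

/-- One step of the exponential Euler scheme. -/
noncomputable def eulerStep (h : ℝ) (f : Sch d) : Sch d :=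
  schrod h (f - (Complex.I * h) • nonlin hN f)

/-- The dyadic time step. -/
noncomputable def dt (n : ℕ) : ℝ := (1 / 2) ^ n

lemma dt_pos (n : ℕ) : 0 < dt n := by unfold dt; positivity

lemma two_mul_dt_succ (n : ℕ) : 2 * dt (n + 1) = dt n := by unfold dt; ring

/-- The approximate solution after `m` steps of length `2⁻ⁿ`. -/
noncomputable def eulerIter (f : Sch d) (n m : ℕ) : Sch d := (eulerStep hN (dt n))^[m] f

lemma eulerIter_zero (f : Sch d) (n : ℕ) : eulerIter hN f n 0 = f := rfl

lemma eulerIter_succ (f : Sch d) (n m : ℕ) :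
    eulerIter hN f n (m + 1) = eulerStep hN (dt n) (eulerIter hN f n m) :=
  Function.iterate_succ_apply' _ _ _

/-- The right hand side `iΔf - iN(f)` of the evolution equation. -/
noncomputable def schrRHS (f : Sch d) : Sch d :=
  Complex.I • Laplacian.laplacian f - Complex.I • nonlin hN f

lemma norm_I_mul (h : ℝ) : ‖Complex.I * (h : ℂ)‖ = |h| := by simp

lemma sob_eulerStep_le {h : ℝ} (hh : 0 ≤ h) (k : ℕ) (f : Sch d) :
    sob k (eulerStep hN h f) ≤ sob k f + h * sob k (nonlin hN f) := by
  refine (sob_schrod_le k h _).trans ((sob_sub_le k _ _).trans ?_)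
  rw [sob_smul, norm_I_mul, abs_of_nonneg hh]

/-- The uniform bounds satisfied by the approximate solutions up to time `T`. -/
def EulerBounded (f : Sch d) (T : ℝ) : Prop :=
  ∀ k : ℕ, ∃ C : ℝ, 0 ≤ C ∧ ∀ n m : ℕ, m * dt n ≤ T → sob k (eulerIter hN f n m) ≤ C

/-- Discrete Gronwall: the propagator does not increase the norm, so a step multiplies it by at most
`1 + C dt ≤ exp (C dt)`. The low norm bound is required only at earlier steps, so it may itself be
obtained by strong induction. -/
lemma sob_eulerIter_le {k m₀ : ℕ} {C M T : ℝ} (f : Sch d)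
    (htame : ∀ g : Sch d, sob m₀ g ≤ M → sob k (nonlin hN g) ≤ C * sob k g) (n : ℕ) :
    ∀ m : ℕ, m * dt n ≤ T → (∀ j < m, sob m₀ (eulerIter hN f n j) ≤ M) →
      sob k (eulerIter hN f n m) ≤ Real.exp (C * (m * dt n)) * sob k f := by
  intro m
  induction m with
  | zero => intro _ _; simp [eulerIter_zero]
  | succ m ih =>
    intro hT hM
    have hdt := dt_pos n
    have h1 := ih (by push_cast at hT; nlinarith) (fun j hj => hM j (by lia))
    rw [eulerIter_succ]
    refine (sob_eulerStep_le hN hdt.le k _).trans ?_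
    have h2 := htame _ (hM m (by lia))
    have h3 : 1 + C * dt n ≤ Real.exp (C * dt n) := by
      linarith [Real.add_one_le_exp (C * dt n)]
    have h4 := sob_nonneg k (eulerIter hN f n m)
    calc _ ≤ sob k (eulerIter hN f n m) + dt n * (C * sob k (eulerIter hN f n m)) := by gcongr
      _ = (1 + C * dt n) * sob k (eulerIter hN f n m) := by ring
      _ ≤ Real.exp (C * dt n) * (Real.exp (C * (m * dt n)) * sob k f) := by gcongr
      _ = Real.exp (C * ((m + 1 : ℕ) * dt n)) * sob k f := by
          rw [← mul_assoc, ← Real.exp_add]; push_cast; ring_nf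

/-- Only one norm, of order `k₀`, restricts the time. Given a bound at order `k₀ + j`, the tame
estimate at order `k₀ + j + 1` is linear, so that norm grows at most exponentially and no time is
lost. -/
lemma exists_eulerBounded (f : Sch d) : ∃ T : ℝ, 0 < T ∧ T ≤ 1 ∧ EulerBounded hN f T := by
  -- With this order, `d + 1 + (k₀ + 1) / 2 ≤ k₀` closes the estimate on itself, and order `k₀ + j`
  -- also controls the nonlinearity at order `k₀ + j + 1`.
  set k₀ := 2 * d + 3 with hk₀
  set a := sob k₀ f + 1 with ha
  have ha0 : 0 < a := by linarith [sob_nonneg k₀ f]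
  obtain ⟨C, hC, htame⟩ := exists_sob_nonlin_le (d := d) hN (k := k₀) (m := k₀) (by lia) (2 * a)
  -- Then `exp (C T) ≤ 2`, so the a priori bound `2 * a` reproduces itself along the iteration.
  set T := min 1 (Real.log 2 / (C + 1)) with hT
  have hlog : 0 < Real.log 2 := Real.log_pos (by norm_num)
  have hT0 : 0 < T := lt_min one_pos (by positivity)
  have hCT : C * T ≤ Real.log 2 := by
    have h1 : T ≤ Real.log 2 / (C + 1) := min_le_right _ _
    rw [le_div_iff₀ (by linarith)] at h1
    nlinarith
  have hbase : ∀ n m : ℕ, m * dt n ≤ T → sob k₀ (eulerIter hN f n m) ≤ 2 * a := by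
    intro n m
    induction m using Nat.strong_induction_on with
    | _ m ih =>
      intro hm
      have h1 := sob_eulerIter_le hN f htame n m hm (fun j hj => ih j hj (by
        refine le_trans ?_ hm
        have := dt_pos n
        gcongr))
      refine h1.trans ?_
      have h2 : Real.exp (C * (m * dt n)) ≤ 2 := by
        rw [← Real.exp_log (show (0 : ℝ) < 2 by norm_num)]
        refine Real.exp_le_exp.mpr (le_trans ?_ hCT)
        gcongr
      have := sob_nonneg k₀ f
      gcongr
      linarith
  refine ⟨T, hT0, min_le_left _ _, ?_⟩
  have hstep : ∀ j : ℕ, ∃ C : ℝ, 0 ≤ C ∧ ∀ n m : ℕ, m * dt n ≤ T →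
      sob (k₀ + j) (eulerIter hN f n m) ≤ C := by
    intro j
    induction j with
    | zero => exact ⟨2 * a, by positivity, hbase⟩
    | succ j ih =>
      obtain ⟨M, hM0, hM⟩ := ih
      obtain ⟨C', hC', htame'⟩ := exists_sob_nonlin_le (d := d) hN (k := k₀ + (j + 1))
        (m := k₀ + j) (by lia) M
      refine ⟨Real.exp (C' * T) * sob (k₀ + (j + 1)) f,
        mul_nonneg (Real.exp_pos _).le (sob_nonneg _ _), fun n m hm => ?_⟩
      refine (sob_eulerIter_le hN f htame' n m hm (fun i hi => hM n i (by
        refine le_trans ?_ hm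
        have := dt_pos n
        gcongr))).trans ?_
      have := sob_nonneg (k₀ + (j + 1)) f
      gcongr
  intro k
  obtain ⟨C, hC0, hC⟩ := hstep k
  exact ⟨C, hC0, fun n m hm => (sob_mono (by lia) _).trans (hC n m hm)⟩

variable {hN} {f : Sch d} {T : ℝ}

lemma EulerBounded.nonlin_bounded (hB : EulerBounded hN f T) (k : ℕ) : ∃ C : ℝ, 0 ≤ C ∧
    ∀ n m : ℕ, m * dt n ≤ T → sob k (nonlin hN (eulerIter hN f n m)) ≤ C := by
  obtain ⟨M, -, hM⟩ := hB (d + 1 + (k + 1) / 2)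
  obtain ⟨A, hA0, hA⟩ := hB k
  obtain ⟨C, hC, htame⟩ := exists_sob_nonlin_le (d := d) hN (k := k) le_rfl M
  refine ⟨C * A, by positivity, fun n m hm => (htame _ (hM n m hm)).trans ?_⟩
  gcongr
  exact hA n m hm

lemma sob_eulerStep_sub_le {h : ℝ} (hh : 0 ≤ h) (k : ℕ) (g : Sch d) :
    sob k (eulerStep hN h g - g) ≤ h * (sob (k + 1) g + sob k (nonlin hN g)) := by
  have h1 : eulerStep hN h g - g =
      (schrod h g - g) - (Complex.I * h) • schrod h (nonlin hN g) := by
    rw [eulerStep, map_sub, map_smul]; abel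
  rw [h1]
  refine (sob_sub_le k _ _).trans ?_
  rw [sob_smul, norm_I_mul, abs_of_nonneg hh, mul_add]
  have h2 := sob_schrod_sub_le k h g
  rw [abs_of_nonneg hh] at h2
  have h3 := sob_schrod_le k h (nonlin hN g)
  gcongr

/-- Local consistency. The error is the second order remainder of the group on `g`, plus `h` times
the displacement of `nonlin hN g` by the group; each is quadratic in `h` at the cost of derivatives.
-/
lemma l2norm_eulerStep_sub_sub_le {h : ℝ} (hh : 0 ≤ h) (g : Sch d) :
    l2norm (eulerStep hN h g - g - (h : ℂ) • schrRHS hN g) ≤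
      h ^ 2 * (2 * sob 2 g + sob 1 (nonlin hN g)) := by
  have h1 : eulerStep hN h g - g - (h : ℂ) • schrRHS hN g =
      (schrod h g - g - (Complex.I * h) • Laplacian.laplacian g) -
        (Complex.I * h) • (schrod h (nonlin hN g) - nonlin hN g) := by
    rw [eulerStep, map_sub, map_smul, schrRHS, smul_sub, smul_sub, smul_smul, smul_smul,
      mul_comm (h : ℂ)]
    abel
  rw [h1]
  refine (l2norm_sub_le _ _).trans ?_
  rw [l2norm_smul, norm_I_mul, abs_of_nonneg hh]
  have h2 := l2norm_schrod_sub_sub_le h g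
  have h3 := sob_schrod_sub_le 0 h (nonlin hN g)
  rw [abs_of_nonneg hh, sob_zero, zero_add] at h3
  calc _ ≤ 2 * h ^ 2 * sob 2 g + h * (h * sob 1 (nonlin hN g)) := by gcongr
    _ = _ := by ring

lemma EulerBounded.exists_sob_sub_le (hB : EulerBounded hN f T) (k : ℕ) : ∃ C : ℝ, 0 ≤ C ∧
    ∀ n m j : ℕ, (m + j : ℕ) * dt n ≤ T →
      sob k (eulerIter hN f n (m + j) - eulerIter hN f n m) ≤ C * (j * dt n) := by
  obtain ⟨A, hA0, hA⟩ := hB (k + 1)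
  obtain ⟨A', hA'0, hA'⟩ := hB.nonlin_bounded k
  refine ⟨A + A', by positivity, fun n m j => ?_⟩
  have hdt := dt_pos n
  induction j with
  | zero => intro _; simp [sob_zero_fun]
  | succ j ih =>
    intro h
    have h' : ((m + j : ℕ) : ℝ) * dt n ≤ T := by push_cast at h ⊢; nlinarith
    have h1 : eulerIter hN f n (m + (j + 1)) - eulerIter hN f n m =
        (eulerStep hN (dt n) (eulerIter hN f n (m + j)) - eulerIter hN f n (m + j)) +
        (eulerIter hN f n (m + j) - eulerIter hN f n m) := by
      rw [← add_assoc, eulerIter_succ]; abel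
    rw [h1]
    refine (sob_add_le k _ _).trans ?_
    have h2 := sob_eulerStep_sub_le (hN := hN) hdt.le k (eulerIter hN f n (m + j))
    calc _ ≤ dt n * (A + A') + (A + A') * (j * dt n) := by
          refine add_le_add (h2.trans ?_) (ih h')
          gcongr
          · exact hA _ _ h'
          · exact hA' _ _ h'
      _ = _ := by push_cast; ring

lemma exists_l2norm_schrRHS_sub_le : ∃ C : ℝ, 0 ≤ C ∧ ∀ g₁ g₂ : Sch d,
    l2norm (schrRHS hN g₁ - schrRHS hN g₂) ≤ C * sob 1 (g₁ - g₂) := by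
  obtain ⟨L, hL0, hL⟩ := exists_l2norm_nonlin_sub_le (d := d) hN
  refine ⟨1 + L, by positivity, fun g₁ g₂ => ?_⟩
  have h0 : Laplacian.laplacian (g₁ - g₂) =
      (Laplacian.laplacian g₁ - Laplacian.laplacian g₂ : Sch d) := by
    simp only [← SchwartzMap.laplacianCLM_eq ℂ, map_sub]
  have h1 : schrRHS hN g₁ - schrRHS hN g₂ = Complex.I • Laplacian.laplacian (g₁ - g₂) -
      Complex.I • (nonlin hN g₁ - nonlin hN g₂) := by
    rw [h0, schrRHS, schrRHS, smul_sub, smul_sub]; abel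
  rw [h1]
  refine (l2norm_sub_le _ _).trans ?_
  rw [l2norm_smul, l2norm_smul, Complex.norm_I, one_mul, one_mul, add_mul, one_mul]
  refine add_le_add ?_ ((hL g₁ g₂).trans ?_)
  · have := sob_laplacian_le 0 (g₁ - g₂)
    rwa [sob_zero] at this
  · gcongr
    exact l2norm_le_sob 1 _

/-- Consistency errors are summed over `j` steps, and the right hand side frozen at the initial step
drifts from the current one by at most a multiple of `j dt`. The sum is quadratic in the elapsed
time; the extra `dt n` in the second factor absorbs the `j` one-step errors. -/
lemma EulerBounded.exists_l2norm_sub_sub_le (hB : EulerBounded hN f T) : ∃ C : ℝ, 0 ≤ C ∧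
    ∀ n m j : ℕ, (m + j : ℕ) * dt n ≤ T →
      l2norm (eulerIter hN f n (m + j) - eulerIter hN f n m -
        ((j * dt n : ℝ) : ℂ) • schrRHS hN (eulerIter hN f n m)) ≤
        C * ((j * dt n) * (j * dt n + dt n)) := by
  obtain ⟨A, hA0, hA⟩ := hB 2
  obtain ⟨A', hA'0, hA'⟩ := hB.nonlin_bounded 1
  obtain ⟨D, hD0, hD⟩ := hB.exists_sob_sub_le 1
  obtain ⟨L, hL0, hL⟩ := exists_l2norm_schrRHS_sub_le (d := d) (hN := hN)
  refine ⟨(2 * A + A') + L * D, by positivity, fun n m j => ?_⟩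
  have hdt := dt_pos n
  induction j with
  | zero => intro _; simp [l2norm_zero]
  | succ j ih =>
    intro h
    have h' : ((m + j : ℕ) : ℝ) * dt n ≤ T := by push_cast at h ⊢; nlinarith
    have h1 : eulerIter hN f n (m + (j + 1)) - eulerIter hN f n m -
        (((j + 1 : ℕ) * dt n : ℝ) : ℂ) • schrRHS hN (eulerIter hN f n m) =
        (eulerStep hN (dt n) (eulerIter hN f n (m + j)) - eulerIter hN f n (m + j) -
          (dt n : ℂ) • schrRHS hN (eulerIter hN f n (m + j))) +
        (dt n : ℂ) • (schrRHS hN (eulerIter hN f n (m + j)) - schrRHS hN (eulerIter hN f n m)) +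
        (eulerIter hN f n (m + j) - eulerIter hN f n m -
          ((j * dt n : ℝ) : ℂ) • schrRHS hN (eulerIter hN f n m)) := by
      rw [← add_assoc, eulerIter_succ]; push_cast; rw [add_mul, add_smul, one_mul, smul_sub]; abel
    rw [h1]
    refine (l2norm_add_le _ _).trans ?_
    have h2 := l2norm_eulerStep_sub_sub_le (hN := hN) hdt.le (eulerIter hN f n (m + j))
    have h3 := hL (eulerIter hN f n (m + j)) (eulerIter hN f n m)
    have h4 := hD n m j h'
    have h5 := hA _ _ h'
    have h6 := hA' _ _ h'
    have h7 : l2norm ((dt n : ℂ) • (schrRHS hN (eulerIter hN f n (m + j)) -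
        schrRHS hN (eulerIter hN f n m))) ≤ dt n * (L * (D * (j * dt n))) := by
      rw [l2norm_smul, Complex.norm_real, Real.norm_of_nonneg hdt.le]
      gcongr
      exact h3.trans (by gcongr)
    have h8 : l2norm (eulerStep hN (dt n) (eulerIter hN f n (m + j)) - eulerIter hN f n (m + j) -
          (dt n : ℂ) • schrRHS hN (eulerIter hN f n (m + j))) ≤ dt n ^ 2 * (2 * A + A') :=
      h2.trans (by gcongr)
    have h9 := ih h'
    have h10 := l2norm_add_le (eulerStep hN (dt n) (eulerIter hN f n (m + j)) -
      eulerIter hN f n (m + j) - (dt n : ℂ) • schrRHS hN (eulerIter hN f n (m + j)))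
      ((dt n : ℂ) • (schrRHS hN (eulerIter hN f n (m + j)) - schrRHS hN (eulerIter hN f n m)))
    set K := (2 * A + A') + L * D with hK
    have h11 : (2 * A + A') ≤ K := by rw [hK]; nlinarith
    have h12 : L * D ≤ K := by rw [hK]; linarith
    have hj : (0 : ℝ) ≤ j := Nat.cast_nonneg j
    calc _ ≤ dt n ^ 2 * (2 * A + A') + dt n * (L * (D * (j * dt n))) +
          K * ((j * dt n) * (j * dt n + dt n)) := by linarith
      _ = dt n ^ 2 * ((2 * A + A') + (L * D) * j + K * (j * (j + 1))) := by ring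
      _ ≤ dt n ^ 2 * (K + K * j + K * (j * (j + 1))) := by gcongr
      _ ≤ dt n ^ 2 * (K * ((j + 1) * (j + 2))) := by
          have hK0 : 0 ≤ K := by positivity
          gcongr
          nlinarith [mul_nonneg hK0 hj]
      _ = _ := by push_cast; ring

lemma l2norm_eulerStep_sub_eulerStep_le {L : ℝ}
    (hL : ∀ f g : Sch d, l2norm (nonlin hN f - nonlin hN g) ≤ L * l2norm (f - g))
    {h : ℝ} (hh : 0 ≤ h) (g₁ g₂ : Sch d) :
    l2norm (eulerStep hN h g₁ - eulerStep hN h g₂) ≤ (1 + L * h) * l2norm (g₁ - g₂) := by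
  have h1 : eulerStep hN h g₁ - eulerStep hN h g₂ = schrod h ((g₁ - g₂) -
      (Complex.I * h) • (nonlin hN g₁ - nonlin hN g₂)) := by
    rw [eulerStep, eulerStep, ← map_sub, smul_sub]; congr 1; abel
  rw [h1]
  refine (l2norm_schrod_le _ _).trans ((l2norm_sub_le _ _).trans ?_)
  rw [l2norm_smul, norm_I_mul, abs_of_nonneg hh]
  nlinarith [mul_le_mul_of_nonneg_left (hL g₁ g₂) hh]

/-- By the group law the linear parts of two half steps and of one full step agree exactly. What
remains is `k` times a difference of nonlinear terms, caused by the propagation over `k` and by the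
evaluation at `w` instead of `g`; this difference is itself of order `k`. -/
lemma l2norm_eulerStep_half_le {L : ℝ} (hL0 : 0 ≤ L)
    (hL : ∀ f g : Sch d, l2norm (nonlin hN f - nonlin hN g) ≤ L * l2norm (f - g))
    {k : ℝ} (hk : 0 ≤ k) (g : Sch d) :
    l2norm (eulerStep hN k (eulerStep hN k g) - eulerStep hN (2 * k) g) ≤
      k ^ 2 * (sob 1 (nonlin hN g) + L * (sob 1 g + l2norm (nonlin hN g))) := by
  set w := eulerStep hN k g with hw
  have h0 : schrod k w = schrod (2 * k) g - (Complex.I * k) • schrod (2 * k) (nonlin hN g) := by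
    rw [hw, eulerStep, schrod_schrod, map_sub, map_smul, two_mul]
  have h1 : eulerStep hN k w - eulerStep hN (2 * k) g = (Complex.I * k) • (schrod k
      ((schrod k (nonlin hN g) - nonlin hN g) - (nonlin hN w - nonlin hN g))) := by
    rw [eulerStep, map_sub, h0, eulerStep, map_sub, map_sub, map_sub, map_sub, map_smul, map_smul,
      schrod_schrod, ← two_mul, smul_sub, smul_sub, smul_sub]
    have h2 : (Complex.I * ((2 * k : ℝ) : ℂ)) • schrod (2 * k) (nonlin hN g) =
        (Complex.I * k) • schrod (2 * k) (nonlin hN g) +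
        (Complex.I * k) • schrod (2 * k) (nonlin hN g) := by
      rw [← add_smul]; congr 1; push_cast; ring
    rw [h2]
    abel
  rw [h1, l2norm_smul, norm_I_mul, abs_of_nonneg hk]
  have h3 := (l2norm_schrod_le k ((schrod k (nonlin hN g) - nonlin hN g) -
    (nonlin hN w - nonlin hN g))).trans (l2norm_sub_le _ _)
  have h4 := sob_schrod_sub_le 0 k (nonlin hN g)
  rw [abs_of_nonneg hk, sob_zero, zero_add] at h4
  have h5 := sob_eulerStep_sub_le (hN := hN) hk 0 g
  rw [← hw, sob_zero, sob_zero, zero_add] at h5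
  have h6 := hL w g
  calc _ ≤ k * (k * sob 1 (nonlin hN g) + L * (k * (sob 1 g + l2norm (nonlin hN g)))) := by
        gcongr
        refine h3.trans (add_le_add h4 (h6.trans (by gcongr)))
    _ = _ := by ring

/-- Each of the `m` steps adds an error of order `dt²`, and stability amplifies it by at most `exp
(L |T|)`. As `m dt ≤ T`, the total is of order `dt n = 2⁻ⁿ`, so successive refinements are
geometrically close. -/
lemma EulerBounded.exists_l2norm_refine_le (hB : EulerBounded hN f T) : ∃ C : ℝ, 0 ≤ C ∧
    ∀ n m : ℕ, m * dt n ≤ T →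
      l2norm (eulerIter hN f (n + 1) (2 * m) - eulerIter hN f n m) ≤ C * dt n := by
  obtain ⟨A, hA0, hA⟩ := hB 1
  obtain ⟨A', hA'0, hA'⟩ := hB.nonlin_bounded 1
  obtain ⟨L, hL0, hL⟩ := exists_l2norm_nonlin_sub_le (d := d) hN
  set K := A' + L * (A + A') with hK
  have hK0 : 0 ≤ K := by positivity
  have key : ∀ n m : ℕ, m * dt n ≤ T →
      l2norm (eulerIter hN f (n + 1) (2 * m) - eulerIter hN f n m) ≤
        K * dt n ^ 2 * m * Real.exp (L * (m * dt n)) := by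
    intro n m
    have hdt := dt_pos n
    induction m with
    | zero => intro _; simp [eulerIter_zero, l2norm_zero]
    | succ m ih =>
      intro h
      have h' : (m : ℝ) * dt n ≤ T := by push_cast at h; nlinarith
      have h'' : ((2 * m : ℕ) : ℝ) * dt (n + 1) ≤ T := by
        push_cast; rw [← two_mul_dt_succ] at h'; linarith
      set g := eulerIter hN f (n + 1) (2 * m) with hg
      have h1 : eulerIter hN f (n + 1) (2 * (m + 1)) - eulerIter hN f n (m + 1) =
          (eulerStep hN (dt (n + 1)) (eulerStep hN (dt (n + 1)) g) -
            eulerStep hN (2 * dt (n + 1)) g) +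
          (eulerStep hN (dt n) g - eulerStep hN (dt n) (eulerIter hN f n m)) := by
        rw [show 2 * (m + 1) = 2 * m + 1 + 1 by ring, eulerIter_succ, eulerIter_succ,
          eulerIter_succ, two_mul_dt_succ]
        abel
      rw [h1]
      refine (l2norm_add_le _ _).trans ?_
      have h2 := l2norm_eulerStep_half_le hL0 hL (dt_pos (n + 1)).le g
      have h3 := l2norm_eulerStep_sub_eulerStep_le hL hdt.le g (eulerIter hN f n m)
      have h4 : dt (n + 1) ^ 2 * (sob 1 (nonlin hN g) +
          L * (sob 1 g + l2norm (nonlin hN g))) ≤ dt n ^ 2 * K := by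
        have h5 := hA _ _ h''
        have h6 := hA' _ _ h''
        have h7 := l2norm_le_sob 1 (nonlin hN g)
        have h8 := l2norm_nonneg (nonlin hN g)
        have h9 := sob_nonneg 1 g
        have h10 := two_mul_dt_succ n
        have h11 := dt_pos (n + 1)
        rw [hK]
        gcongr
        · exact add_nonneg (h8.trans h7) (mul_nonneg hL0 (add_nonneg h9 h8))
        · linarith
        · exact h7.trans h6
      have h5 : 1 + L * dt n ≤ Real.exp (L * dt n) := by
        linarith [Real.add_one_le_exp (L * dt n)]
      have h6 : 1 ≤ Real.exp (L * ((m + 1 : ℕ) * dt n)) := Real.one_le_exp (by positivity)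
      have h7 : Real.exp (L * dt n) * Real.exp (L * (m * dt n)) =
          Real.exp (L * ((m + 1 : ℕ) * dt n)) := by
        rw [← Real.exp_add]; push_cast; ring_nf
      have h8 := l2norm_nonneg (g - eulerIter hN f n m)
      calc _ ≤ dt n ^ 2 * K * 1 +
            Real.exp (L * dt n) * (K * dt n ^ 2 * m * Real.exp (L * (m * dt n))) := by
            rw [mul_one]
            refine add_le_add (h2.trans h4) (h3.trans ?_)
            gcongr
            exact ih h'
        _ ≤ dt n ^ 2 * K * Real.exp (L * ((m + 1 : ℕ) * dt n)) +
            K * dt n ^ 2 * m * (Real.exp (L * dt n) * Real.exp (L * (m * dt n))) := by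
            have : 0 ≤ dt n ^ 2 * K := by positivity
            nlinarith
        _ = _ := by rw [h7]; push_cast; ring
  refine ⟨K * |T| * Real.exp (L * |T|), by positivity, fun n m h => (key n m h).trans ?_⟩
  have hdt := dt_pos n
  have hT : (m : ℝ) * dt n ≤ |T| := h.trans (le_abs_self T)
  calc K * dt n ^ 2 * m * Real.exp (L * (m * dt n))
      = K * (m * dt n) * Real.exp (L * (m * dt n)) * dt n := by ring
    _ ≤ _ := by gcongr

end Scheme

/-! ### Smooth limits of sequences of Schwartz functions -/

section Limits

variable {d : ℕ}

lemma sch_contDiff (f : Sch d) {n : ℕ∞} : ContDiff ℝ n f := f.smooth n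

lemma sch_iteratedFDeriv_sub (f g : Sch d) (j : ℕ) (x : RSpace d) :
    iteratedFDeriv ℝ j (f - g : Sch d) x = iteratedFDeriv ℝ j f x - iteratedFDeriv ℝ j g x :=
  iteratedFDeriv_sub_apply (sch_contDiff f (n := j)).contDiffAt
    (sch_contDiff g (n := j)).contDiffAt

lemma sch_iteratedFDeriv_smul (c : ℂ) (f : Sch d) (j : ℕ) (x : RSpace d) :
    iteratedFDeriv ℝ j (c • f : Sch d) x = c • iteratedFDeriv ℝ j f x :=
  iteratedFDeriv_const_smul_apply (sch_contDiff f (n := j)).contDiffAt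

/-- Interpolated Sobolev embedding. -/
lemma exists_norm_iteratedFDeriv_sq_le (d j : ℕ) : ∃ (K : ℕ) (S : ℝ), 0 ≤ S ∧
    ∀ (f : Sch d) (x : RSpace d), ‖iteratedFDeriv ℝ j f x‖ ^ 2 ≤ S * (l2norm f * sob K f) := by
  obtain ⟨S, hS0, hS⟩ := exists_norm_iteratedFDeriv_le_sob d j
  refine ⟨2 * (d + 1 + (j + 1) / 2), S ^ 2, by positivity, fun f x => ?_⟩
  calc ‖iteratedFDeriv ℝ j f x‖ ^ 2 ≤ (S * sob (d + 1 + (j + 1) / 2) f) ^ 2 := by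
        gcongr; exact hS f x
    _ = S ^ 2 * sob (d + 1 + (j + 1) / 2) f ^ 2 := mul_pow _ _ _
    _ ≤ _ := by gcongr; exact sob_sq_le _ f

/-- Sequences of Schwartz functions bounded in all Sobolev spaces and geometrically Cauchy
in `L²`. -/
def FastCauchy (u : ℕ → Sch d) : Prop :=
  (∀ k, ∃ C : ℝ, 0 ≤ C ∧ ∀ n, sob k (u n) ≤ C) ∧
    ∃ C r : ℝ, 0 ≤ C ∧ 0 ≤ r ∧ r < 1 ∧ ∀ n, l2norm (u (n + 1) - u n) ≤ C * r ^ n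

/-- By `sob_sq_le`, the geometric `L²` decay multiplied by a bound of order `2k` gives decay of
order `k` with ratio `√r`. -/
lemma FastCauchy.exists_sob_le {u : ℕ → Sch d} (hu : FastCauchy u) (k : ℕ) :
    ∃ C r : ℝ, 0 ≤ C ∧ 0 ≤ r ∧ r < 1 ∧ ∀ n, sob k (u (n + 1) - u n) ≤ C * r ^ n := by
  obtain ⟨C, r, hC, hr0, hr1, h⟩ := hu.2
  obtain ⟨A, hA0, hA⟩ := hu.1 (2 * k)
  refine ⟨√(C * (2 * A)), √r, Real.sqrt_nonneg _, Real.sqrt_nonneg _, ?_, fun n => ?_⟩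
  · rw [Real.sqrt_lt' one_pos]; simpa using hr1
  · refine abs_le_of_sq_le_sq' ?_ (by positivity) |>.2
    refine (sob_sq_le k _).trans ?_
    have h1 := (sob_sub_le (2 * k) (u (n + 1)) (u n)).trans (add_le_add (hA _) (hA _))
    have h2 : (√(C * (2 * A)) * √r ^ n) ^ 2 = (C * r ^ n) * (A + A) := by
      rw [mul_pow, Real.sq_sqrt (by positivity), ← pow_mul, mul_comm n 2, pow_mul,
        Real.sq_sqrt hr0]
      ring
    rw [h2]
    exact mul_le_mul (h n) h1 (sob_nonneg _ _) (by positivity)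

/-- The limit is the sum of the telescoping series. Its derivatives of each order are dominated by a
geometric series through the Sobolev embedding, so the sum is smooth and may be differentiated
termwise. -/
lemma FastCauchy.exists_limit {u : ℕ → Sch d} (hu : FastCauchy u) :
    ∃ F : RSpace d → ℂ, ContDiff ℝ ∞ F ∧
      ∀ j x, Tendsto (fun n => iteratedFDeriv ℝ j (u n) x) atTop (𝓝 (iteratedFDeriv ℝ j F x)) := by
  have key : ∀ j : ℕ, ∃ v : ℕ → ℝ, Summable v ∧
      ∀ n x, ‖iteratedFDeriv ℝ j (u (n + 1) - u n : Sch d) x‖ ≤ v n := by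
    intro j
    obtain ⟨S, hS0, hS⟩ := exists_norm_iteratedFDeriv_le_sob d j
    obtain ⟨C, r, hC, hr0, hr1, h⟩ := hu.exists_sob_le (d + 1 + (j + 1) / 2)
    exact ⟨fun n => S * (C * r ^ n),
      ((summable_geometric_of_lt_one hr0 hr1).mul_left C).mul_left S,
      fun n x => (hS _ x).trans (mul_le_mul_of_nonneg_left (h n) hS0)⟩
  choose v hv hvb using key
  have hsm : ∀ i, ContDiff ℝ ((⊤ : ℕ∞) : WithTop ℕ∞) (u (i + 1) - u i : Sch d) :=
    fun i => sch_contDiff _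
  have hcd : ContDiff ℝ ∞ (fun x => ∑' i, (u (i + 1) - u i : Sch d) x) :=
    contDiff_tsum hsm (fun k _ => hv k) (fun k i x _ => hvb k i x)
  refine ⟨u 0 + fun x => ∑' i, (u (i + 1) - u i : Sch d) x, (sch_contDiff (u 0)).add hcd,
    fun j x => ?_⟩
  rw [iteratedFDeriv_add_apply (sch_contDiff (u 0) (n := j)).contDiffAt
    (hcd.of_le (by exact_mod_cast le_top)).contDiffAt,
    iteratedFDeriv_tsum_apply hsm (fun k _ => hv k) (fun k i x _ => hvb k i x)
      (by exact_mod_cast le_top)]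
  have h1 : Summable (fun i => iteratedFDeriv ℝ j (u (i + 1) - u i : Sch d) x) :=
    Summable.of_norm_bounded (hv j) (fun i => hvb j i x)
  have h2 := (h1.hasSum.tendsto_sum_nat).const_add (iteratedFDeriv ℝ j (u 0) x)
  refine h2.congr fun n => ?_
  simp only [sch_iteratedFDeriv_sub]
  rw [Finset.sum_range_sub (fun i => iteratedFDeriv ℝ j (u i) x)]
  abel

lemma tendsto_apply_of_iteratedFDeriv {u : ℕ → Sch d} {F : RSpace d → ℂ} {x : RSpace d}
    (h : Tendsto (fun n => iteratedFDeriv ℝ 0 (u n) x) atTop (𝓝 (iteratedFDeriv ℝ 0 F x))) :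
    Tendsto (fun n => u n x) atTop (𝓝 (F x)) := by
  have h1 := ((ContinuousMultilinearMap.apply ℝ (fun _ : Fin 0 => RSpace d) ℂ
    (0 : Fin 0 → RSpace d)).continuous.tendsto _).comp h
  simpa [Function.comp_def] using h1

end Limits

/-! ### Passage to the limit in the splitting scheme -/

section LimitOfScheme

variable {d : ℕ} {N : ℂ → ℂ} {hN : IsNonlinearity N} {f : Sch d} {T : ℝ}

variable (hN f) in
/-- The approximate solution at time `t`. -/
noncomputable def approxSol (n : ℕ) (t : ℝ) : Sch d := eulerIter hN f n ⌊t / dt n⌋₊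

lemma floor_mul_dt_le {t : ℝ} (ht : 0 ≤ t) (n : ℕ) : ⌊t / dt n⌋₊ * dt n ≤ t := by
  have := Nat.floor_le (div_nonneg ht (dt_pos n).le)
  rwa [le_div_iff₀ (dt_pos n)] at this

lemma lt_floor_mul_dt (t : ℝ) (n : ℕ) : t < ⌊t / dt n⌋₊ * dt n + dt n := by
  have := Nat.lt_floor_add_one (t / dt n)
  rw [div_lt_iff₀ (dt_pos n)] at this
  linarith

lemma EulerBounded.approxSol_sob (hB : EulerBounded hN f T) (k : ℕ) : ∃ C : ℝ, 0 ≤ C ∧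
    ∀ n, ∀ t ∈ Icc 0 T, sob k (approxSol hN f n t) ≤ C := by
  obtain ⟨C, hC0, hC⟩ := hB k
  exact ⟨C, hC0, fun n t ht => hC _ _ ((floor_mul_dt_le ht.1 n).trans ht.2)⟩

lemma EulerBounded.approxSol_nonlin (hB : EulerBounded hN f T) (k : ℕ) : ∃ C : ℝ, 0 ≤ C ∧
    ∀ n, ∀ t ∈ Icc 0 T, sob k (nonlin hN (approxSol hN f n t)) ≤ C := by
  obtain ⟨C, hC0, hC⟩ := hB.nonlin_bounded k
  exact ⟨C, hC0, fun n t ht => hC _ _ ((floor_mul_dt_le ht.1 n).trans ht.2)⟩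

lemma EulerBounded.approxSol_rhs (hB : EulerBounded hN f T) (k : ℕ) : ∃ C : ℝ, 0 ≤ C ∧
    ∀ n, ∀ t ∈ Icc 0 T, sob k (schrRHS hN (approxSol hN f n t)) ≤ C := by
  obtain ⟨A, hA0, hA⟩ := hB.approxSol_sob (k + 1)
  obtain ⟨A', hA'0, hA'⟩ := hB.approxSol_nonlin k
  refine ⟨A + A', by positivity, fun n t ht => (sob_sub_le k _ _).trans ?_⟩
  rw [sob_smul, sob_smul, Complex.norm_I, one_mul, one_mul]
  exact add_le_add ((sob_laplacian_le k _).trans (hA n t ht)) (hA' n t ht)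

lemma exists_floor_eq {s t : ℝ} (hst : s ≤ t) (n : ℕ) :
    ∃ j : ℕ, ⌊t / dt n⌋₊ = ⌊s / dt n⌋₊ + j := by
  have : ⌊s / dt n⌋₊ ≤ ⌊t / dt n⌋₊ := Nat.floor_mono (by have := dt_pos n; gcongr)
  exact ⟨_, (Nat.add_sub_cancel' this).symm⟩

lemma abs_step_sub_le {s t : ℝ} (hs : 0 ≤ s) (hst : s ≤ t) {n j : ℕ}
    (h : ⌊t / dt n⌋₊ = ⌊s / dt n⌋₊ + j) : |(j * dt n : ℝ) - (t - s)| ≤ dt n := by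
  have h1 := floor_mul_dt_le hs n
  have h2 := floor_mul_dt_le (hs.trans hst) n
  have h3 := lt_floor_mul_dt s n
  have h4 := lt_floor_mul_dt t n
  rw [h] at h2 h4
  push_cast at h2 h4
  rw [abs_le]
  constructor <;> linarith

lemma EulerBounded.approxSol_sub (hB : EulerBounded hN f T) (k : ℕ) : ∃ C : ℝ, 0 ≤ C ∧
    ∀ n, ∀ s ∈ Icc 0 T, ∀ t ∈ Icc 0 T,
      sob k (approxSol hN f n t - approxSol hN f n s) ≤ C * (|t - s| + dt n) := by
  obtain ⟨C, hC0, hC⟩ := hB.exists_sob_sub_le k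
  have key : ∀ n, ∀ s ∈ Icc 0 T, ∀ t ∈ Icc 0 T, s ≤ t →
      sob k (approxSol hN f n t - approxSol hN f n s) ≤ C * (|t - s| + dt n) := by
    intro n s hs t ht hst
    obtain ⟨j, hj⟩ := exists_floor_eq hst n
    have h1 := abs_step_sub_le hs.1 hst hj
    rw [approxSol, approxSol, hj]
    have h2 := floor_mul_dt_le ht.1 n
    rw [hj] at h2
    refine (hC n _ j (h2.trans ht.2)).trans ?_
    gcongr
    rw [abs_of_nonneg (by linarith)]
    linarith [le_abs_self ((j * dt n : ℝ) - (t - s))]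
  refine ⟨C, hC0, fun n s hs t ht => ?_⟩
  rcases le_total s t with h | h
  · exact key n s hs t ht h
  · have h1 := key n t ht s hs h
    have h2 : approxSol hN f n t - approxSol hN f n s =
        (-1 : ℂ) • (approxSol hN f n s - approxSol hN f n t) := by
      rw [neg_one_smul]; abel
    rw [h2, sob_smul, abs_sub_comm]
    simpa using h1

/-- Rounding both times to the grid changes the elapsed time by at most one step
(`abs_step_sub_le`). The terms in `dt n` record this and disappear in the limit, leaving `C (t -
s)²`. -/
lemma EulerBounded.approxSol_taylor (hB : EulerBounded hN f T) : ∃ C : ℝ, 0 ≤ C ∧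
    ∀ n, ∀ s ∈ Icc 0 T, ∀ t ∈ Icc 0 T, s ≤ t →
      l2norm (approxSol hN f n t - approxSol hN f n s -
        ((t - s : ℝ) : ℂ) • schrRHS hN (approxSol hN f n s)) ≤
        C * ((t - s + dt n) * (t - s + 2 * dt n) + dt n) := by
  obtain ⟨C, hC0, hC⟩ := hB.exists_l2norm_sub_sub_le
  obtain ⟨A, hA0, hA⟩ := hB.approxSol_rhs 0
  refine ⟨C + A, by positivity, fun n s hs t ht hst => ?_⟩
  obtain ⟨j, hj⟩ := exists_floor_eq hst n
  have h1 := abs_step_sub_le hs.1 hst hj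
  have hdt := dt_pos n
  have h2 := floor_mul_dt_le ht.1 n
  rw [hj] at h2
  have h3 := hC n _ j (h2.trans ht.2)
  have h4 := hA n s hs
  rw [sob_zero] at h4
  have h5 : approxSol hN f n t - approxSol hN f n s -
        ((t - s : ℝ) : ℂ) • schrRHS hN (approxSol hN f n s) =
      (eulerIter hN f n (⌊s / dt n⌋₊ + j) - eulerIter hN f n ⌊s / dt n⌋₊ -
        ((j * dt n : ℝ) : ℂ) • schrRHS hN (eulerIter hN f n ⌊s / dt n⌋₊)) +
      ((j * dt n - (t - s) : ℝ) : ℂ) • schrRHS hN (approxSol hN f n s) := by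
    rw [approxSol, hj, approxSol, Complex.ofReal_sub (j * dt n), sub_smul]; abel
  rw [h5]
  refine (l2norm_add_le _ _).trans ?_
  rw [l2norm_smul, Complex.norm_real, Real.norm_eq_abs]
  have h6 : (j * dt n : ℝ) ≤ t - s + dt n := by
    linarith [le_abs_self ((j * dt n : ℝ) - (t - s))]
  have h7 : 0 ≤ t - s := by linarith
  have h8 := l2norm_nonneg (schrRHS hN (approxSol hN f n s))
  calc _ ≤ C * ((j * dt n) * (j * dt n + dt n)) + dt n * A := by gcongr
    _ ≤ C * ((t - s + dt n) * (t - s + 2 * dt n)) + dt n * A := by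
        have : (j * dt n : ℝ) + dt n ≤ t - s + 2 * dt n := by linarith
        gcongr
    _ ≤ _ := by nlinarith [mul_nonneg hC0 hdt.le, mul_nonneg hA0 (mul_nonneg (add_nonneg h7 hdt.le)
                  (show 0 ≤ t - s + 2 * dt n by linarith))]

lemma EulerBounded.fastCauchy (hB : EulerBounded hN f T) {t : ℝ} (ht : t ∈ Icc 0 T) :
    FastCauchy (fun n => approxSol hN f n t) := by
  refine ⟨fun k => ?_, ?_⟩
  · obtain ⟨C, hC0, hC⟩ := hB.approxSol_sob k
    exact ⟨C, hC0, fun n => hC n t ht⟩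
  · obtain ⟨C, hC0, hC⟩ := hB.exists_l2norm_refine_le
    obtain ⟨C', hC'0, hC'⟩ := hB.exists_sob_sub_le 0
    refine ⟨C + C', 1 / 2, by positivity, by norm_num, by norm_num, fun n => ?_⟩
    set m := ⌊t / dt n⌋₊ with hm
    have hdt := dt_pos n
    have hdt' := dt_pos (n + 1)
    have h2 := two_mul_dt_succ n
    -- The integer part of `2y` is `2⌊y⌋` or `2⌊y⌋ + 1`, so the finer grid takes at most one step
    -- beyond `2 * m`.
    have h3 : t / dt (n + 1) = 2 * (t / dt n) := by rw [← h2]; field_simp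
    have h4 : 2 * m ≤ ⌊t / dt (n + 1)⌋₊ := by
      rw [Nat.le_floor_iff (by have := ht.1; positivity), h3]
      push_cast
      linarith [Nat.floor_le (div_nonneg ht.1 hdt.le)]
    have h5 : ⌊t / dt (n + 1)⌋₊ < 2 * m + 2 := by
      rw [Nat.floor_lt (by have := ht.1; positivity), h3]
      push_cast
      linarith [Nat.lt_floor_add_one (t / dt n)]
    obtain ⟨j, hj⟩ := Nat.exists_eq_add_of_le h4
    have hj1 : j ≤ 1 := by lia
    have h6 : approxSol hN f (n + 1) t - approxSol hN f n t =
        (eulerIter hN f (n + 1) (2 * m + j) - eulerIter hN f (n + 1) (2 * m)) +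
        (eulerIter hN f (n + 1) (2 * m) - eulerIter hN f n m) := by
      rw [approxSol, approxSol, hj]; abel
    simp only
    rw [h6]
    refine (l2norm_add_le _ _).trans ?_
    have h7 := floor_mul_dt_le ht.1 (n + 1)
    rw [hj] at h7
    have h8 := hC' (n + 1) (2 * m) j (h7.trans ht.2)
    rw [sob_zero] at h8
    have h9 := hC n m ((floor_mul_dt_le ht.1 n).trans ht.2)
    have h10 : (j : ℝ) ≤ 1 := by exact_mod_cast hj1
    have h11 : C' * (j * dt (n + 1)) ≤ C' * dt n := by
      gcongr
      nlinarith
    have h12 : dt n = (1 / 2) ^ n := rfl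
    rw [← h12]
    linarith

lemma EulerBounded.fastCauchy_rhs (hB : EulerBounded hN f T) {t : ℝ} (ht : t ∈ Icc 0 T) :
    FastCauchy (fun n => schrRHS hN (approxSol hN f n t)) := by
  obtain ⟨C, r, hC, hr0, hr1, h⟩ := (hB.fastCauchy ht).exists_sob_le 1
  obtain ⟨L, hL0, hL⟩ := exists_l2norm_schrRHS_sub_le (d := d) (hN := hN)
  refine ⟨fun k => ?_, L * C, r, by positivity, hr0, hr1, fun n => (hL _ _).trans ?_⟩
  · obtain ⟨C, hC0, hC⟩ := hB.approxSol_rhs k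
    exact ⟨C, hC0, fun n => hC n t ht⟩
  · rw [mul_assoc]; gcongr; exact h n

lemma tendsto_dt : Tendsto dt atTop (𝓝 0) :=
  tendsto_pow_atTop_nhds_zero_of_lt_one (by norm_num) (by norm_num)

lemma tendsto_laplacian {u : ℕ → Sch d} {F : RSpace d → ℂ}
    (h : ∀ j x, Tendsto (fun n => iteratedFDeriv ℝ j (u n) x) atTop (𝓝 (iteratedFDeriv ℝ j F x)))
    (x : RSpace d) :
    Tendsto (fun n => (Laplacian.laplacian (u n) : Sch d) x) atTop
      (𝓝 (Laplacian.laplacian F x)) := by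
  simp only [SchwartzMap.laplacian_apply]
  simp only [InnerProductSpace.laplacian_eq_iteratedFDeriv_orthonormalBasis _
    (EuclideanSpace.basisFun (Fin d) ℝ)]
  refine tendsto_finsetSum _ fun i _ => ?_
  exact ((ContinuousMultilinearMap.apply ℝ (fun _ : Fin 2 => RSpace d) ℂ _).continuous.tendsto
    _).comp (h 2 x)

/-- The limit of the scheme: a family of smooth functions, Lipschitz in time in all Sobolev and
`C^j` norms, with a first order Taylor expansion in time given by the equation. -/
theorem exists_limit_solution (hN : IsNonlinearity N) (f : Sch d) :
    ∃ T : ℝ, 0 < T ∧ T ≤ 1 ∧ ∃ W : ℝ → RSpace d → ℂ, ∃ G : ℝ → RSpace d → ℂ,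
      (∀ x, W 0 x = f x) ∧
      (∀ t ∈ Icc 0 T, ContDiff ℝ ∞ (W t)) ∧ (∀ t ∈ Icc 0 T, ContDiff ℝ ∞ (G t)) ∧
      (∀ t ∈ Icc 0 T, ∀ x, G t x =
        Complex.I * Laplacian.laplacian (W t) x - Complex.I * N (W t x)) ∧
      (∀ j, ∃ C : ℝ, 0 ≤ C ∧ ∀ s ∈ Icc 0 T, ∀ t ∈ Icc 0 T, ∀ x,
        ‖iteratedFDeriv ℝ j (W t) x - iteratedFDeriv ℝ j (W s) x‖ ≤ C * |t - s|) ∧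
      (∀ j, ∃ C : ℝ, 0 ≤ C ∧ ∀ s ∈ Icc 0 T, ∀ t ∈ Icc 0 T,
        eLpNorm (fun x => iteratedFDeriv ℝ j (W t) x - iteratedFDeriv ℝ j (W s) x) 2 volume ≤
          ENNReal.ofReal (C * |t - s|)) ∧
      (∀ j, ∃ C : ℝ, 0 ≤ C ∧ ∀ s ∈ Icc 0 T, ∀ t ∈ Icc 0 T, ∀ x,
        ‖iteratedFDeriv ℝ j (W t) x - iteratedFDeriv ℝ j (W s) x -
          (t - s) • iteratedFDeriv ℝ j (G s) x‖ ≤ C * (|t - s| * √|t - s|)) := by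
  obtain ⟨T, hT0, hT1, hB⟩ := exists_eulerBounded hN f
  refine ⟨T, hT0, hT1, ?_⟩
  -- Outside `[0, T]` the limit takes the default value `0`, so that a function of all times can be
  -- chosen.
  have hW : ∀ t, ∃ F : RSpace d → ℂ, t ∈ Icc 0 T → ContDiff ℝ ∞ F ∧ ∀ j x,
      Tendsto (fun n => iteratedFDeriv ℝ j (approxSol hN f n t) x) atTop
        (𝓝 (iteratedFDeriv ℝ j F x)) := by
    intro t
    by_cases ht : t ∈ Icc 0 T
    · obtain ⟨F, hF⟩ := (hB.fastCauchy ht).exists_limit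
      exact ⟨F, fun _ => hF⟩
    · exact ⟨0, fun h => absurd h ht⟩
  have hG : ∀ t, ∃ F : RSpace d → ℂ, t ∈ Icc 0 T → ContDiff ℝ ∞ F ∧ ∀ j x,
      Tendsto (fun n => iteratedFDeriv ℝ j (schrRHS hN (approxSol hN f n t)) x) atTop
        (𝓝 (iteratedFDeriv ℝ j F x)) := by
    intro t
    by_cases ht : t ∈ Icc 0 T
    · obtain ⟨F, hF⟩ := (hB.fastCauchy_rhs ht).exists_limit
      exact ⟨F, fun _ => hF⟩
    · exact ⟨0, fun h => absurd h ht⟩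
  choose W hW using hW
  choose G hG using hG
  have hWd : ∀ s ∈ Icc 0 T, ∀ t ∈ Icc 0 T, ∀ j x, Tendsto
      (fun n => iteratedFDeriv ℝ j (approxSol hN f n t - approxSol hN f n s : Sch d) x) atTop
        (𝓝 (iteratedFDeriv ℝ j (W t) x - iteratedFDeriv ℝ j (W s) x)) := by
    intro s hs t ht j x
    simp only [sch_iteratedFDeriv_sub]
    exact ((hW t ht).2 j x).sub ((hW s hs).2 j x)
  have hLip : ∀ j, ∃ C : ℝ, 0 ≤ C ∧ ∀ s ∈ Icc 0 T, ∀ t ∈ Icc 0 T, ∀ x,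
        ‖iteratedFDeriv ℝ j (W t) x - iteratedFDeriv ℝ j (W s) x‖ ≤ C * |t - s| := by
    intro j
    obtain ⟨S, hS0, hS⟩ := exists_norm_iteratedFDeriv_le_sob d j
    obtain ⟨C, hC0, hC⟩ := hB.approxSol_sub (d + 1 + (j + 1) / 2)
    refine ⟨S * C, by positivity, fun s hs t ht x => ?_⟩
    have h2 : Tendsto (fun n => S * (C * (|t - s| + dt n))) atTop (𝓝 (S * (C * (|t - s| + 0)))) :=
      ((tendsto_dt.const_add _).const_mul _).const_mul _
    have h3 := le_of_tendsto_of_tendsto' (hWd s hs t ht j x).norm h2 (fun n =>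
      (hS _ x).trans (mul_le_mul_of_nonneg_left (hC n s hs t ht) hS0))
    rwa [add_zero, ← mul_assoc] at h3
  -- The right hand side is Lipschitz in time in `L²` and bounded at order `K`; interpolation leaves
  -- Hölder exponent `1/2`.
  have hGd : ∀ j, ∃ C : ℝ, 0 ≤ C ∧ ∀ s ∈ Icc 0 T, ∀ t ∈ Icc 0 T, ∀ x,
        ‖iteratedFDeriv ℝ j (G t) x - iteratedFDeriv ℝ j (G s) x‖ ≤ C * √|t - s| := by
    intro j
    obtain ⟨K, S, hS0, hS⟩ := exists_norm_iteratedFDeriv_sq_le d j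
    obtain ⟨A, hA0, hA⟩ := hB.approxSol_rhs K
    obtain ⟨L, hL0, hL⟩ := exists_l2norm_schrRHS_sub_le (d := d) (hN := hN)
    obtain ⟨C, hC0, hC⟩ := hB.approxSol_sub 1
    refine ⟨√(S * (L * C * (2 * A))), Real.sqrt_nonneg _, fun s hs t ht x => ?_⟩
    have h1 : Tendsto (fun n => iteratedFDeriv ℝ j (schrRHS hN (approxSol hN f n t) -
        schrRHS hN (approxSol hN f n s) : Sch d) x) atTop
        (𝓝 (iteratedFDeriv ℝ j (G t) x - iteratedFDeriv ℝ j (G s) x)) := by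
      simp only [sch_iteratedFDeriv_sub]
      exact ((hG t ht).2 j x).sub ((hG s hs).2 j x)
    have h2 : Tendsto (fun n => S * ((L * (C * (|t - s| + dt n))) * (2 * A))) atTop
        (𝓝 (S * ((L * (C * (|t - s| + 0))) * (2 * A)))) :=
      ((((tendsto_dt.const_add _).const_mul _).const_mul _).mul_const _).const_mul _
    have h3 := le_of_tendsto_of_tendsto' (h1.norm.pow 2) h2 (fun n => by
      refine (hS _ x).trans (mul_le_mul_of_nonneg_left ?_ hS0)
      have hdt := dt_pos n
      refine mul_le_mul ((hL _ _).trans ?_) ?_ (sob_nonneg _ _) (by positivity)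
      · gcongr; exact hC n s hs t ht
      · refine (sob_sub_le K _ _).trans ?_
        linarith [hA n t ht, hA n s hs])
    refine abs_le_of_sq_le_sq' ?_ (by positivity) |>.2
    rw [mul_pow, Real.sq_sqrt (by positivity), Real.sq_sqrt (abs_nonneg _)]
    refine h3.trans (le_of_eq ?_)
    ring
  -- The remainder is `O((t - s)²)` in `L²` and `O(t - s)` at order `K`. Interpolation gives `(t -
  -- s)^(3/2)`, which is still `o(t - s)`.
  have hTay : ∀ j, ∃ C : ℝ, 0 ≤ C ∧ ∀ s ∈ Icc 0 T, ∀ t ∈ Icc 0 T, s ≤ t → ∀ x,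
        ‖iteratedFDeriv ℝ j (W t) x - iteratedFDeriv ℝ j (W s) x -
          (t - s) • iteratedFDeriv ℝ j (G s) x‖ ≤ C * (|t - s| * √|t - s|) := by
    intro j
    obtain ⟨K, S, hS0, hS⟩ := exists_norm_iteratedFDeriv_sq_le d j
    obtain ⟨A, hA0, hA⟩ := hB.approxSol_rhs K
    obtain ⟨C, hC0, hC⟩ := hB.approxSol_taylor
    obtain ⟨D, hD0, hD⟩ := hB.approxSol_sub K
    refine ⟨√(S * (C * (D + A))), Real.sqrt_nonneg _, fun s hs t ht hst x => ?_⟩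
    have hst' : 0 ≤ t - s := by linarith
    rw [abs_of_nonneg hst']
    have h1 : Tendsto (fun n => iteratedFDeriv ℝ j (approxSol hN f n t - approxSol hN f n s -
        ((t - s : ℝ) : ℂ) • schrRHS hN (approxSol hN f n s) : Sch d) x) atTop
        (𝓝 (iteratedFDeriv ℝ j (W t) x - iteratedFDeriv ℝ j (W s) x -
          (t - s) • iteratedFDeriv ℝ j (G s) x)) := by
      simp only [sch_iteratedFDeriv_sub, sch_iteratedFDeriv_smul]
      exact (((hW t ht).2 j x).sub ((hW s hs).2 j x)).sub (((hG s hs).2 j x).const_smul (t - s))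
    have h2 : Tendsto (fun n => S * ((C * ((t - s + dt n) * (t - s + 2 * dt n) + dt n)) *
        (D * (t - s + dt n) + (t - s) * A))) atTop
        (𝓝 (S * ((C * ((t - s + 0) * (t - s + 2 * 0) + 0)) *
        (D * (t - s + 0) + (t - s) * A)))) := by
      have e := tendsto_dt
      exact ((((((e.const_add _).mul ((e.const_mul _).const_add _)).add e).const_mul _).mul
        (((e.const_add _).const_mul _).add_const _))).const_mul _
    have h3 := le_of_tendsto_of_tendsto' (h1.norm.pow 2) h2 (fun n => by
      refine (hS _ x).trans (mul_le_mul_of_nonneg_left ?_ hS0)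
      have hdt := dt_pos n
      refine mul_le_mul (hC n s hs t ht hst) ?_ (sob_nonneg _ _) (by positivity)
      refine (sob_sub_le K _ _).trans (add_le_add ?_ ?_)
      · have := hD n s hs t ht
        rwa [abs_of_nonneg hst'] at this
      · rw [sob_smul, Complex.norm_real, Real.norm_of_nonneg hst']
        gcongr
        exact hA n s hs)
    refine abs_le_of_sq_le_sq' ?_ (by positivity) |>.2
    rw [mul_pow, mul_pow, Real.sq_sqrt (by positivity), Real.sq_sqrt hst']
    refine h3.trans (le_of_eq ?_)
    ring
  refine ⟨W, G, ?_, fun t ht => (hW t ht).1, fun t ht => (hG t ht).1, ?_, hLip, ?_, ?_⟩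
  · intro x
    have h0 : (0 : ℝ) ∈ Icc 0 T := ⟨le_rfl, hT0.le⟩
    have h1 := tendsto_apply_of_iteratedFDeriv ((hW 0 h0).2 0 x)
    refine tendsto_nhds_unique h1 (tendsto_const_nhds.congr fun n => ?_)
    simp [approxSol, eulerIter_zero]
  · intro t ht x
    have h1 := tendsto_apply_of_iteratedFDeriv ((hW t ht).2 0 x)
    have h2 := tendsto_apply_of_iteratedFDeriv ((hG t ht).2 0 x)
    have h3 := tendsto_laplacian (hW t ht).2 x
    have h4 : Tendsto (fun n => nonlin hN (approxSol hN f n t) x) atTop (𝓝 (N (W t x))) :=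
      (hN.smooth.continuous.tendsto _).comp h1
    exact tendsto_nhds_unique h2 ((h3.const_mul Complex.I).sub (h4.const_mul Complex.I))
  · intro j
    obtain ⟨S, hS0, hS⟩ := exists_eLpNorm_iteratedFDeriv_le_sob d j
    obtain ⟨C, hC0, hC⟩ := hB.approxSol_sub j
    refine ⟨S * C, by positivity, fun s hs t ht => ?_⟩
    -- By Fatou's lemma, pointwise convergence of the derivatives is enough to carry the `L²` bound
    -- to the limit.
    have h1 := Lp.eLpNorm_lim_le_liminf_eLpNorm (p := 2) (μ := (volume : Measure (RSpace d)))
      (f := fun n => iteratedFDeriv ℝ j (approxSol hN f n t - approxSol hN f n s : Sch d))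
      (fun n => ((sch_contDiff _ (n := ⊤)).continuous_iteratedFDeriv
        (by exact_mod_cast le_top)).aestronglyMeasurable) _
      (Eventually.of_forall fun x => hWd s hs t ht j x)
    refine h1.trans ?_
    have h2 : Tendsto (fun n => ENNReal.ofReal (S * (C * (|t - s| + dt n)))) atTop
        (𝓝 (ENNReal.ofReal (S * (C * (|t - s| + 0))))) :=
      ENNReal.tendsto_ofReal (((tendsto_dt.const_add _).const_mul _).const_mul _)
    rw [add_zero, ← mul_assoc] at h2
    rw [← h2.liminf_eq]
    refine liminf_le_liminf (Eventually.of_forall fun n => ?_)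
    refine (hS _).trans (ENNReal.ofReal_le_ofReal ?_)
    gcongr
    exact hC n s hs t ht
  · intro j
    obtain ⟨C, hC0, hC⟩ := hTay j
    obtain ⟨C', hC'0, hC'⟩ := hGd j
    refine ⟨C + C', by positivity, fun s hs t ht x => ?_⟩
    rcases le_total s t with hst | hst
    · refine (hC s hs t ht hst x).trans ?_
      gcongr
      linarith
    -- For `t < s` the forward expansion is available at base point `t`. Moving it to `s` costs `|t
    -- - s|` times the Hölder modulus of `G`, again of order `3/2`.
    · have h1 := hC t ht s hs hst x
      have h2 := hC' s hs t ht x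
      have h3 : iteratedFDeriv ℝ j (W t) x - iteratedFDeriv ℝ j (W s) x -
          (t - s) • iteratedFDeriv ℝ j (G s) x =
          (t - s) • (iteratedFDeriv ℝ j (G t) x - iteratedFDeriv ℝ j (G s) x) -
          (iteratedFDeriv ℝ j (W s) x - iteratedFDeriv ℝ j (W t) x -
            (s - t) • iteratedFDeriv ℝ j (G t) x) := by
        simp only [smul_sub, sub_smul]; abel
      rw [h3]
      refine (norm_sub_le _ _).trans ?_
      rw [norm_smul, Real.norm_eq_abs]
      rw [abs_sub_comm s t] at h1
      nlinarith [mul_le_mul_of_nonneg_left h2 (abs_nonneg (t - s))]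

end LimitOfScheme

/-! ### Joint smoothness in time and space -/

section JointSmoothness

variable {d : ℕ} {V V' : Type} [NormedAddCommGroup V] [NormedSpace ℝ V]
  [NormedAddCommGroup V'] [NormedSpace ℝ V']

/-- Families of smooth functions all of whose space derivatives are jointly `C^n`. -/
def JointlyCn (T : ℝ) (n : ℕ) (v : ℝ → RSpace d → V) : Prop :=
  (∀ t ∈ Icc 0 T, ContDiff ℝ ∞ (v t)) ∧
    ∀ j : ℕ, ContDiffOn ℝ n (fun p : ℝ × RSpace d => iteratedFDeriv ℝ j (v p.1) p.2)
      (Icc 0 T ×ˢ univ)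

lemma nat_lt_smooth (n : ℕ) : (n : WithTop ℕ∞) < ∞ := by
  exact_mod_cast ENat.natCast_lt_top n

lemma nat_le_smooth (n : ℕ) : (n : WithTop ℕ∞) ≤ ∞ := (nat_lt_smooth n).le

variable {T : ℝ} {n : ℕ} {v : ℝ → RSpace d → V}

lemma JointlyCn.congr {w : ℝ → RSpace d → V} (hv : JointlyCn T n v)
    (h : ∀ t ∈ Icc 0 T, ∀ x, w t x = v t x) : JointlyCn T n w := by
  have h' : ∀ t ∈ Icc 0 T, w t = v t := fun t ht => funext (h t ht)
  refine ⟨fun t ht => h' t ht ▸ hv.1 t ht, fun j => (hv.2 j).congr fun p hp => ?_⟩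
  rw [h' p.1 hp.1]

lemma JointlyCn.clm_comp (hv : JointlyCn T n v) (L : V →L[ℝ] V') :
    JointlyCn T n (fun t x => L (v t x)) := by
  refine ⟨fun t ht => L.contDiff.comp (hv.1 t ht), fun j => ?_⟩
  have h1 : ContDiff ℝ n (fun q : ContinuousMultilinearMap ℝ (fun _ : Fin j => RSpace d) V =>
      L.compContinuousMultilinearMap q) :=
    (ContinuousLinearMap.compContinuousMultilinearMapL ℝ (fun _ : Fin j => RSpace d) V V'
      L).contDiff
  refine (h1.comp_contDiffOn (hv.2 j)).congr fun p hp => ?_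
  exact L.iteratedFDeriv_comp_left (hv.1 p.1 hp.1).contDiffAt (nat_le_smooth j)

lemma JointlyCn.add {w : ℝ → RSpace d → V} (hv : JointlyCn T n v) (hw : JointlyCn T n w) :
    JointlyCn T n (fun t x => v t x + w t x) := by
  refine ⟨fun t ht => (hv.1 t ht).add (hw.1 t ht), fun j => ?_⟩
  refine ((hv.2 j).add (hw.2 j)).congr fun p hp => ?_
  exact iteratedFDeriv_add_apply ((hv.1 p.1 hp.1).of_le (nat_le_smooth j)).contDiffAt
    ((hw.1 p.1 hp.1).of_le (nat_le_smooth j)).contDiffAt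

lemma JointlyCn.fderiv (hv : JointlyCn T n v) :
    JointlyCn T n (fun t x => fderiv ℝ (v t) x) := by
  refine ⟨fun t ht => (hv.1 t ht).fderiv_right (by simp), fun j => ?_⟩
  have h1 : ContDiff ℝ n (continuousMultilinearCurryRightEquiv' ℝ j (RSpace d) V) :=
    LinearIsometryEquiv.contDiff _
  refine (h1.comp_contDiffOn (hv.2 (j + 1))).congr fun p hp => ?_
  simp [iteratedFDeriv_succ_eq_comp_right]

lemma JointlyCn.prodMk {w : ℝ → RSpace d → V'} (hv : JointlyCn T n v) (hw : JointlyCn T n w) :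
    JointlyCn T n (fun t x => (v t x, w t x)) := by
  have := (hv.clm_comp (ContinuousLinearMap.inl ℝ V V')).add
    (hw.clm_comp (ContinuousLinearMap.inr ℝ V V'))
  simpa using this

lemma JointlyCn.apply (hv : JointlyCn T n v) :
    ContDiffOn ℝ n (fun p : ℝ × RSpace d => v p.1 p.2) (Icc 0 T ×ˢ univ) := by
  have h1 : ContDiff ℝ n (continuousMultilinearCurryFin0 ℝ (RSpace d) V) :=
    LinearIsometryEquiv.contDiff _
  refine (h1.comp_contDiffOn (hv.2 0)).congr fun p hp => ?_
  simp

/-- The derivative of `F ∘ v` as a function of `(v, Dv)`. -/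
noncomputable def chainMap (d : ℕ) (F : V → V') (q : V × (RSpace d →L[ℝ] V)) : RSpace d →L[ℝ] V' :=
  (fderiv ℝ F q.1).comp q.2

lemma contDiff_chainMap {F : V → V'} (hF : ContDiff ℝ ∞ F) : ContDiff ℝ ∞ (chainMap d F) := by
  have h1 : ContDiff ℝ ∞ (fderiv ℝ F) := hF.fderiv_right (by simp)
  exact (h1.comp contDiff_fst).clm_comp contDiff_snd

lemma fderiv_comp_eq_chainMap {F : V → V'} (hF : ContDiff ℝ ∞ F) {u : RSpace d → V}
    (hu : ContDiff ℝ ∞ u) :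
    fderiv ℝ (fun x => F (u x)) = fun x => chainMap d F (u x, fderiv ℝ u x) := by
  ext1 x
  exact fderiv_comp x (hF.differentiable (by simp) _) (hu.differentiable (by simp) _)

/-- Induction on the order of the space derivative: the derivative of `F ∘ v` is the smooth map
`chainMap d F` applied to the family `(v, Dv)`, which is again jointly `C^n`. The spaces `V` and
`V'` therefore have to vary in the induction. -/
lemma JointlyCn.comp {F : V → V'} (hF : ContDiff ℝ ∞ F) (hv : JointlyCn T n v) :
    JointlyCn T n (fun t x => F (v t x)) := by
  refine ⟨fun t ht => hF.comp (hv.1 t ht), fun j => ?_⟩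
  induction j generalizing V V' with
  | zero =>
    have h1 : ContDiff ℝ n (continuousMultilinearCurryFin0 ℝ (RSpace d) V').symm :=
      LinearIsometryEquiv.contDiff _
    exact (h1.comp_contDiffOn ((hF.of_le (nat_le_smooth n)).comp_contDiffOn hv.apply)).congr
      fun p hp => by ext; simp
  | succ j ih =>
    have h1 := ih (contDiff_chainMap (d := d) hF) (hv.prodMk hv.fderiv)
    have h2 : ContDiff ℝ n (continuousMultilinearCurryRightEquiv' ℝ j (RSpace d) V').symm :=
      LinearIsometryEquiv.contDiff _
    refine (h2.comp_contDiffOn h1).congr fun p hp => ?_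
    rw [iteratedFDeriv_succ_eq_comp_right]
    simp only [Function.comp_apply]
    rw [fderiv_comp_eq_chainMap hF (hv.1 p.1 hp.1)]

lemma uniqueDiffOn_slab (hT : 0 < T) :
    UniqueDiffOn ℝ (Icc 0 T ×ˢ (univ : Set (RSpace d))) :=
  (uniqueDiffOn_Icc hT).prod uniqueDiffOn_univ

/-- A function with a uniform Taylor expansion in time and differentiable in space is jointly
differentiable. -/
lemma hasFDerivWithinAt_of_taylor {s : ℝ} {x : RSpace d} {g : RSpace d → V} {A : RSpace d →L[ℝ] V}
    {C : ℝ} (hv : HasFDerivAt (v s) A x) (hg : ContinuousAt g x)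
    (h : ∀ t ∈ Icc 0 T, ∀ y, ‖v t y - v s y - (t - s) • g y‖ ≤ C * (|t - s| * √|t - s|)) :
    HasFDerivWithinAt (fun p : ℝ × RSpace d => v p.1 p.2)
      ((ContinuousLinearMap.toSpanSingleton ℝ (g x)).coprod A) (Icc 0 T ×ˢ univ) (s, x) := by
  rw [hasFDerivWithinAt_iff_isLittleO, Asymptotics.isLittleO_iff]
  intro ε hε
  rw [hasFDerivAt_iff_isLittleO, Asymptotics.isLittleO_iff] at hv
  have h1 := hv (show 0 < ε / 3 by positivity)
  have h2 : ∀ᶠ y in 𝓝 x, ‖g y - g x‖ ≤ ε / 3 := by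
    have := (Metric.continuousAt_iff'.mp hg) (ε / 3) (by positivity)
    filter_upwards [this] with y hy
    rw [← dist_eq_norm]; exact hy.le
  have h3 : ∀ᶠ t in 𝓝 s, C * √|t - s| ≤ ε / 3 := by
    have hc : ContinuousAt (fun t => C * √|t - s|) s := by fun_prop
    have : Tendsto (fun t => C * √|t - s|) (𝓝 s) (𝓝 0) := by
      have := hc.tendsto
      simpa using this
    exact (this.eventually (gt_mem_nhds (show 0 < ε / 3 by positivity))).mono fun t ht => ht.le
  have h4 : ∀ᶠ p : ℝ × RSpace d in 𝓝[Icc 0 T ×ˢ univ] (s, x), p ∈ Icc 0 T ×ˢ univ :=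
    eventually_mem_nhdsWithin
  have h5 : ∀ᶠ p : ℝ × RSpace d in 𝓝[Icc 0 T ×ˢ univ] (s, x),
      ‖v s p.2 - v s x - A (p.2 - x)‖ ≤ ε / 3 * ‖p.2 - x‖ ∧ ‖g p.2 - g x‖ ≤ ε / 3 :=
    nhdsWithin_le_nhds ((continuous_snd.tendsto (s, x)).eventually (h1.and h2))
  have h6 : ∀ᶠ p : ℝ × RSpace d in 𝓝[Icc 0 T ×ˢ univ] (s, x), C * √|p.1 - s| ≤ ε / 3 :=
    nhdsWithin_le_nhds ((continuous_fst.tendsto (s, x)).eventually h3)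
  filter_upwards [h4, h5, h6] with p hp hp5 hp6
  -- The three groups are the time remainder at the point `p.2`, the variation of the time
  -- derivative in space, and the space remainder at time `s`. Each receives `ε / 3`.
  have e : v p.1 p.2 - v s x - ((ContinuousLinearMap.toSpanSingleton ℝ (g x)).coprod A) (p - (s, x))
      = (v p.1 p.2 - v s p.2 - (p.1 - s) • g p.2) + (p.1 - s) • (g p.2 - g x) +
        (v s p.2 - v s x - A (p.2 - x)) := by
    simp only [ContinuousLinearMap.coprod_apply, ContinuousLinearMap.toSpanSingleton_apply,
      Prod.fst_sub, Prod.snd_sub, smul_sub]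
    abel
  rw [e]
  have n1 : |p.1 - s| ≤ ‖p - (s, x)‖ := norm_fst_le (p - (s, x))
  have n2 : ‖p.2 - x‖ ≤ ‖p - (s, x)‖ := norm_snd_le (p - (s, x))
  have b1 := h p.1 hp.1 p.2
  have b2 : C * (|p.1 - s| * √|p.1 - s|) ≤ ε / 3 * ‖p - (s, x)‖ := by
    calc C * (|p.1 - s| * √|p.1 - s|) = |p.1 - s| * (C * √|p.1 - s|) := by ring
      _ ≤ |p.1 - s| * (ε / 3) := by gcongr
      _ ≤ ‖p - (s, x)‖ * (ε / 3) := by gcongr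
      _ = _ := by ring
  have b3 : ‖(p.1 - s) • (g p.2 - g x)‖ ≤ ε / 3 * ‖p - (s, x)‖ := by
    rw [norm_smul, mul_comm, Real.norm_eq_abs]
    gcongr
    exact hp5.2
  have b4 : ε / 3 * ‖p.2 - x‖ ≤ ε / 3 * ‖p - (s, x)‖ := by gcongr
  refine (norm_add₃_le).trans ?_
  linarith [hp5.1]

lemma contDiffOn_toSpanSingleton {X : Type*} [NormedAddCommGroup X] [NormedSpace ℝ X] {f : X → V}
    {s : Set X} {m : WithTop ℕ∞} (hf : ContDiffOn ℝ m f s) :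
    ContDiffOn ℝ m (fun p => ContinuousLinearMap.toSpanSingleton ℝ (f p)) s :=
  (ContinuousLinearMap.toSpanSingletonLIE ℝ V).contDiff.comp_contDiffOn hf

/-- A solution of an evolution equation `∂ₜW = G`, where `G` is a smooth function of finitely many
space derivatives of `W`, is jointly smooth. -/
lemma contDiffOn_of_taylor (hT : 0 < T) {W G : ℝ → RSpace d → V}
    (hW : ∀ t ∈ Icc 0 T, ContDiff ℝ ∞ (W t)) (hG : ∀ t ∈ Icc 0 T, ContDiff ℝ ∞ (G t))
    (hWG : ∀ n, JointlyCn T n W → JointlyCn T n G)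
    (hlip : ∀ j, ∃ C : ℝ, 0 ≤ C ∧ ∀ s ∈ Icc 0 T, ∀ t ∈ Icc 0 T, ∀ x,
        ‖iteratedFDeriv ℝ j (W t) x - iteratedFDeriv ℝ j (W s) x‖ ≤ C * |t - s|)
    (htay : ∀ j, ∃ C : ℝ, 0 ≤ C ∧ ∀ s ∈ Icc 0 T, ∀ t ∈ Icc 0 T, ∀ x,
        ‖iteratedFDeriv ℝ j (W t) x - iteratedFDeriv ℝ j (W s) x -
          (t - s) • iteratedFDeriv ℝ j (G s) x‖ ≤ C * (|t - s| * √|t - s|)) (n : ℕ) :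
    JointlyCn T n W := by
  induction n with
  | zero =>
    refine ⟨hW, fun j => ?_⟩
    simp only [Nat.cast_zero, contDiffOn_zero]
    obtain ⟨C, hC0, hC⟩ := hlip j
    rintro ⟨s, x⟩ ⟨hs, -⟩
    have hc : ContinuousAt (fun p : ℝ × RSpace d => iteratedFDeriv ℝ j (W s) p.2) (s, x) :=
      (((hW s hs).continuous_iteratedFDeriv (nat_le_smooth j)).comp continuous_snd).continuousAt
    have h1 : Tendsto (fun p : ℝ × RSpace d => iteratedFDeriv ℝ j (W p.1) p.2 -
        iteratedFDeriv ℝ j (W s) p.2) (𝓝[Icc 0 T ×ˢ univ] (s, x)) (𝓝 0) := by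
      refine squeeze_zero_norm' (a := fun p : ℝ × RSpace d => C * |p.1 - s|) ?_ ?_
      · filter_upwards [eventually_mem_nhdsWithin] with p hp
        exact hC s hs p.1 hp.1 p.2
      · have : ContinuousAt (fun p : ℝ × RSpace d => C * |p.1 - s|) (s, x) := by fun_prop
        have h := this.tendsto
        simp only [sub_self, abs_zero, mul_zero] at h
        exact h.mono_left nhdsWithin_le_nhds
    have h2 := h1.add (hc.continuousWithinAt (s := Icc 0 T ×ˢ univ)).tendsto
    simpa [ContinuousWithinAt] using h2
  | succ n ih =>
    -- The total derivative of a space derivative of `W` is made of space derivatives of `G` and of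
    -- `W`. All of them are jointly `C^n`, since `JointlyCn` includes every order in space; hence
    -- one time derivative is gained without loss.
    have hGn := hWG n ih
    refine ⟨hW, fun j => ?_⟩
    obtain ⟨C, hC0, hC⟩ := htay j
    set φ : ℝ × RSpace d → (ℝ × RSpace d →L[ℝ] ContinuousMultilinearMap ℝ (fun _ : Fin j =>
        RSpace d) V) := fun p =>
      (ContinuousLinearMap.toSpanSingleton ℝ (iteratedFDeriv ℝ j (G p.1) p.2)).coprod
        (fderiv ℝ (iteratedFDeriv ℝ j (W p.1)) p.2) with hφ
    have hder : ∀ p ∈ Icc 0 T ×ˢ (univ : Set (RSpace d)), HasFDerivWithinAt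
        (fun p : ℝ × RSpace d => iteratedFDeriv ℝ j (W p.1) p.2) (φ p) (Icc 0 T ×ˢ univ) p := by
      rintro ⟨s, x⟩ ⟨hs, -⟩
      refine hasFDerivWithinAt_of_taylor (v := fun t x => iteratedFDeriv ℝ j (W t) x)
        (g := fun y => iteratedFDeriv ℝ j (G s) y) (C := C) ?_ ?_ (fun t ht y => hC s hs t ht y)
      · exact (((hW s hs).differentiable_iteratedFDeriv (nat_lt_smooth j)) x).hasFDerivAt
      · exact ((hG s hs).continuous_iteratedFDeriv (nat_le_smooth j)).continuousAt
    have hφn : ContDiffOn ℝ n φ (Icc 0 T ×ˢ univ) := by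
      have h1 : ContDiffOn ℝ n (fun p : ℝ × RSpace d => ContinuousLinearMap.toSpanSingleton ℝ
          (iteratedFDeriv ℝ j (G p.1) p.2)) (Icc 0 T ×ˢ univ) :=
        contDiffOn_toSpanSingleton (hGn.2 j)
      have h2 : ContDiffOn ℝ n (fun p : ℝ × RSpace d =>
          fderiv ℝ (iteratedFDeriv ℝ j (W p.1)) p.2) (Icc 0 T ×ˢ univ) := by
        have h3 : ContDiff ℝ n (continuousMultilinearCurryLeftEquiv ℝ
          (fun _ : Fin (j + 1) => RSpace d) V) := LinearIsometryEquiv.contDiff _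
        refine (h3.comp_contDiffOn (ih.2 (j + 1))).congr fun p hp => ?_
        simp [iteratedFDeriv_succ_eq_comp_left]
      have h4 : φ = fun p => (ContinuousLinearMap.toSpanSingleton ℝ
          (iteratedFDeriv ℝ j (G p.1) p.2)).comp (ContinuousLinearMap.fst ℝ ℝ (RSpace d)) +
          (fderiv ℝ (iteratedFDeriv ℝ j (W p.1)) p.2).comp
            (ContinuousLinearMap.snd ℝ ℝ (RSpace d)) := by
        ext p <;> simp [hφ]
      rw [h4]
      exact (h1.clm_comp contDiffOn_const).add (h2.clm_comp contDiffOn_const)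
    push_cast
    rw [contDiffOn_succ_iff_fderivWithin (uniqueDiffOn_slab hT)]
    refine ⟨fun p hp => (hder p hp).differentiableWithinAt, by simp, ?_⟩
    refine hφn.congr fun p hp => ?_
    exact (hder p hp).fderivWithin (uniqueDiffOn_slab hT p hp)

lemma laplacian_eq_sum_fderiv (f : RSpace d → V) (x : RSpace d) :
    Laplacian.laplacian f x = ∑ i, _root_.fderiv ℝ (_root_.fderiv ℝ f) x (stdVec i) (stdVec i) := by
  rw [InnerProductSpace.laplacian_eq_iteratedFDeriv_orthonormalBasis _
    (EuclideanSpace.basisFun (Fin d) ℝ)]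
  simp [iteratedFDeriv_two_apply, stdVec]

/-- The trace of a bilinear map on `ℝ^d`. -/
noncomputable def bilinTrace (d : ℕ) (V : Type) [NormedAddCommGroup V] [NormedSpace ℝ V] :
    (RSpace d →L[ℝ] RSpace d →L[ℝ] V) →L[ℝ] V :=
  ∑ i, (ContinuousLinearMap.apply ℝ V (stdVec i)).comp
    (ContinuousLinearMap.apply ℝ (RSpace d →L[ℝ] V) (stdVec i))

lemma laplacian_eq_bilinTrace (f : RSpace d → V) (x : RSpace d) :
    Laplacian.laplacian f x = bilinTrace d V (_root_.fderiv ℝ (_root_.fderiv ℝ f) x) := by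
  rw [laplacian_eq_sum_fderiv]
  simp [bilinTrace]

lemma JointlyCn.laplacian (hv : JointlyCn T n v) :
    JointlyCn T n (fun t x => Laplacian.laplacian (v t) x) :=
  (hv.fderiv.fderiv.clm_comp (bilinTrace d V)).congr fun t _ x => laplacian_eq_bilinTrace (v t) x

/-- Local well-posedness for the nonlinear Schrödinger equation `∂ₜw = iΔw - iN(w)`. -/
theorem exists_smooth_solution {N : ℂ → ℂ} (hN : IsNonlinearity N) (f : Sch d) :
    ∃ T : ℝ, 0 < T ∧ T ≤ 1 ∧ ∃ W : ℝ → RSpace d → ℂ,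
      (∀ x, W 0 x = f x) ∧ (∀ n, JointlyCn T n W) ∧
      (∀ t ∈ Icc 0 T, ∀ x, HasDerivWithinAt (fun s => W s x)
        (Complex.I * Laplacian.laplacian (W t) x - Complex.I * N (W t x)) (Icc 0 T) t) ∧
      (∀ j, ∃ C : ℝ, 0 ≤ C ∧ ∀ s ∈ Icc 0 T, ∀ t ∈ Icc 0 T, ∀ x,
        ‖iteratedFDeriv ℝ j (W t) x - iteratedFDeriv ℝ j (W s) x‖ ≤ C * |t - s|) ∧
      (∀ j, ∃ C : ℝ, 0 ≤ C ∧ ∀ s ∈ Icc 0 T, ∀ t ∈ Icc 0 T, 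
        eLpNorm (fun x => iteratedFDeriv ℝ j (W t) x - iteratedFDeriv ℝ j (W s) x) 2 volume ≤
          ENNReal.ofReal (C * |t - s|)) := by
  obtain ⟨T, hT, hT1, W, G, h0, hW, hG, hGW, hlip, hl2, htay⟩ := exists_limit_solution hN f
  refine ⟨T, hT, hT1, W, h0, ?_, ?_, hlip, hl2⟩
  · refine contDiffOn_of_taylor hT hW hG (fun n hn => ?_) hlip htay
    have h1 := hn.laplacian.clm_comp ((ContinuousLinearMap.mul ℝ ℂ) Complex.I)
    have h2 := (hn.comp hN.smooth).clm_comp (-(ContinuousLinearMap.mul ℝ ℂ) Complex.I)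
    refine (h1.add h2).congr fun t ht x => ?_
    rw [hGW t ht x]
    simp [sub_eq_add_neg]
  · intro t ht x
    rw [← hGW t ht x]
    obtain ⟨C, -, hC⟩ := htay 0
    have hd := hasFDerivWithinAt_of_taylor (T := T) (v := W) (g := G t) (C := C)
      (((hW t ht).differentiable (by simp)) x).hasFDerivAt (hG t ht).continuous.continuousAt
      (fun s hs y => ?_)
    · have hc : HasFDerivWithinAt (fun s : ℝ => (s, x)) (ContinuousLinearMap.inl ℝ ℝ (RSpace d))
          (Icc 0 T) t := (hasFDerivAt_prodMk_left t x).hasFDerivWithinAt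
      have := HasFDerivWithinAt.comp t (t := Icc 0 T ×ˢ univ) hd hc (fun s hs => mk_mem_prod hs (mem_univ _))
      have := this.hasDerivWithinAt
      simpa [Function.comp_def] using this
    · have h := hC t ht s hs y
      have e : iteratedFDeriv ℝ 0 (W s) y - iteratedFDeriv ℝ 0 (W t) y -
          (s - t) • iteratedFDeriv ℝ 0 (G t) y =
          (continuousMultilinearCurryFin0 ℝ (RSpace d) ℂ).symm (W s y - W t y - (s - t) • G t y) := by
        ext; simp
      rw [e, LinearIsometryEquiv.norm_map] at h
      exact h

end JointSmoothness

/-! ### The profile equation -/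

section Profile

/-- The nonlinearity of the equation satisfied by `w`, where `ψ = e^{-ig(1)t/2} (1 + w)`. -/
noncomputable def profileNonlin (g : ℝ → ℝ) (z : ℂ) : ℂ :=
  ((g (‖1 + z‖ ^ 2) - g 1 : ℝ) : ℂ) * (1 + z) / 2

variable {g : ℝ → ℝ}

lemma contDiff_comp_normSq {E : Type*} [NormedAddCommGroup E] [NormedSpace ℝ E]
    (hg : ContDiffOn ℝ ∞ g (Ici 0)) {v : E → ℂ} (hv : ContDiff ℝ ∞ v) :
    ContDiff ℝ ∞ (fun x => g (‖v x‖ ^ 2)) :=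
  hg.comp_contDiff ((contDiff_norm_sq ℝ).comp hv) fun x => sq_nonneg ‖v x‖

lemma contDiff_profileNonlin (hg : ContDiffOn ℝ ∞ g (Ici 0)) : ContDiff ℝ ∞ (profileNonlin g) := by
  have h1 : ContDiff ℝ ∞ (fun z : ℂ => 1 + z) := contDiff_const.add contDiff_id
  have h2 : ContDiff ℝ ∞ (fun z : ℂ => g (‖1 + z‖ ^ 2) - g 1) :=
    (contDiff_comp_normSq hg h1).sub contDiff_const
  exact ((Complex.ofRealCLM.contDiff.comp h2).mul h1).div_const 2

lemma profileNonlin_zero : profileNonlin g 0 = 0 := by simp [profileNonlin]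

/-- The value `z = -1` is the vacuum; there the initial motion is given by the Laplacian alone. -/
lemma profileNonlin_neg_one : profileNonlin g (-1) = 0 := by simp [profileNonlin]

/-- Smooth functions vanishing at `0` coincide on balls with nonlinearities with bounded
derivatives. -/
lemma exists_isNonlinearity_eqOn {N : ℂ → ℂ} (hN : ContDiff ℝ ∞ N) (h0 : N 0 = 0) {R : ℝ}
    (hR : 0 < R) : ∃ M, IsNonlinearity M ∧ ∀ z, ‖z‖ ≤ R → M z = N z := by
  let b : ContDiffBump (0 : ℂ) := ⟨R, R + 1, hR, by linarith⟩
  have hs : ContDiff ℝ ∞ (fun z => b z • N z) := b.contDiff.smul hN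
  have hc : HasCompactSupport (fun z => b z • N z) := b.hasCompactSupport.smul_right
  refine ⟨fun z => b z • N z, ⟨hs, by simp [h0], fun n => ?_⟩, fun z hz => ?_⟩
  · exact (hs.continuous_iteratedFDeriv (nat_le_smooth n)).bounded_above_of_compact_support
      (hc.iteratedFDeriv n)
  · have : b z = 1 := b.one_of_mem_closedBall (by simpa [b] using hz)
    simp [this]

variable {d : ℕ} {ψ₀ : RSpace d → ℝ}

lemma JointlyCn.mono {V : Type} [NormedAddCommGroup V] [NormedSpace ℝ V] {T T' : ℝ} {n : ℕ}
    {v : ℝ → RSpace d → V} (hv : JointlyCn T n v) (h : T' ≤ T) : JointlyCn T' n v :=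
  ⟨fun t ht => hv.1 t ⟨ht.1, ht.2.trans h⟩, fun j => (hv.2 j).mono
    (prod_mono (Icc_subset_Icc_right h) le_rfl)⟩

/-- `w` is a smooth solution on `[0, T]` of the equation satisfied by `e^{ig(1)t/2} ψ - 1`, with
initial value `ψ₀ - 1`. -/
structure IsProfile (g : ℝ → ℝ) (ψ₀ : RSpace d → ℝ) (T : ℝ) (W : ℝ → RSpace d → ℂ) : Prop where
  time_pos : 0 < T
  init : ∀ x, 1 + W 0 x = (ψ₀ x : ℂ)
  schwartz : ∃ f : Sch d, ∀ x, W 0 x = f x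
  jointly : ∀ n, JointlyCn T n W
  hasDeriv : ∀ t ∈ Icc 0 T, ∀ x, HasDerivWithinAt (fun s => W s x)
    (Complex.I * Laplacian.laplacian (W t) x - Complex.I * profileNonlin g (W t x)) (Icc 0 T) t
  lip : ∀ j, ∃ C : ℝ, 0 ≤ C ∧ ∀ s ∈ Icc 0 T, ∀ t ∈ Icc 0 T, ∀ x,
    ‖iteratedFDeriv ℝ j (W t) x - iteratedFDeriv ℝ j (W s) x‖ ≤ C * |t - s|
  l2lip : ∀ j, ∃ C : ℝ, 0 ≤ C ∧ ∀ s ∈ Icc 0 T, ∀ t ∈ Icc 0 T,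
    eLpNorm (fun x => iteratedFDeriv ℝ j (W t) x - iteratedFDeriv ℝ j (W s) x) 2 volume ≤
      ENNReal.ofReal (C * |t - s|)

lemma IsProfile.mono {T T' : ℝ} {W : ℝ → RSpace d → ℂ} (h : IsProfile g ψ₀ T W) (h0 : 0 < T')
    (hT : T' ≤ T) : IsProfile g ψ₀ T' W := by
  have hs : Icc 0 T' ⊆ Icc 0 T := Icc_subset_Icc_right hT
  refine ⟨h0, h.init, h.schwartz, fun n => (h.jointly n).mono hT,
    fun t ht x => (h.hasDeriv t (hs ht) x).mono hs, fun j => ?_, fun j => ?_⟩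
  · obtain ⟨C, hC0, hC⟩ := h.lip j
    exact ⟨C, hC0, fun s hs' t ht x => hC s (hs hs') t (hs ht) x⟩
  · obtain ⟨C, hC0, hC⟩ := h.l2lip j
    exact ⟨C, hC0, fun s hs' t ht => hC s (hs hs') t (hs ht)⟩

lemma norm_sub_le_of_lip {V : Type} [NormedAddCommGroup V] [NormedSpace ℝ V] {u v : RSpace d → V}
    {x : RSpace d} {C : ℝ}
    (h : ‖iteratedFDeriv ℝ 0 u x - iteratedFDeriv ℝ 0 v x‖ ≤ C) : ‖u x - v x‖ ≤ C := by
  have e : iteratedFDeriv ℝ 0 u x - iteratedFDeriv ℝ 0 v x =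
      (continuousMultilinearCurryFin0 ℝ (RSpace d) V).symm (u x - v x) := by
    ext; simp
  rwa [e, LinearIsometryEquiv.norm_map] at h

lemma norm_fderiv_sub_le_of_lip {V : Type} [NormedAddCommGroup V] [NormedSpace ℝ V]
    {u v : RSpace d → V} {x : RSpace d} {C : ℝ}
    (h : ‖iteratedFDeriv ℝ 1 u x - iteratedFDeriv ℝ 1 v x‖ ≤ C) :
    ‖fderiv ℝ u x - fderiv ℝ v x‖ ≤ C := by
  have e : iteratedFDeriv ℝ 1 u x - iteratedFDeriv ℝ 1 v x =
      (continuousMultilinearCurryFin1 ℝ (RSpace d) V).symm (fderiv ℝ u x - fderiv ℝ v x) := by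
    ext; simp
  rwa [e, LinearIsometryEquiv.norm_map] at h

/-- The nonlinearity is truncated outside the ball of radius `M + 1`, where `M` bounds the initial
profile. The solution is Lipschitz in time with constant `C`, so it stays in that ball up to time `1
/ (C + 1)` and there solves the original equation. -/
theorem exists_isProfile (hg : ContDiffOn ℝ ∞ g (Ici 0)) (hψ : IsVacuumDatum ψ₀) :
    ∃ T W, IsProfile g ψ₀ T W := by
  obtain ⟨f, hf⟩ := hψ.schwartz
  let F : Sch d := -(SchwartzMap.postcompCLM Complex.ofRealCLM f)
  have hF : ∀ x, F x = ((ψ₀ x - 1 : ℝ) : ℂ) := fun x => by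
    have : F x = -((f x : ℝ) : ℂ) := rfl
    rw [this, hf x]
    push_cast; ring
  obtain ⟨M, hM⟩ : ∃ M, ∀ x, ‖F x‖ ≤ M := by
    obtain ⟨M, hM⟩ := F.decay 0 0
    exact ⟨M, fun x => by simpa using hM.2 x⟩
  have hM0 : 0 ≤ M := (norm_nonneg _).trans (hM 0)
  obtain ⟨N, hN, hNe⟩ := exists_isNonlinearity_eqOn (contDiff_profileNonlin hg)
    (profileNonlin_zero (g := g)) (show 0 < M + 1 by linarith)
  obtain ⟨T, hT, -, W, h0, hJ, hd, hl, hl2⟩ := exists_smooth_solution hN F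
  obtain ⟨C, hC0, hC⟩ := hl 0
  set T' := min T (1 / (C + 1)) with hT'
  have hT'0 : 0 < T' := lt_min hT (by positivity)
  have hT'T : T' ≤ T := min_le_left _ _
  have hs : Icc 0 T' ⊆ Icc 0 T := Icc_subset_Icc_right hT'T
  have hb : ∀ t ∈ Icc 0 T', ∀ x, ‖W t x‖ ≤ M + 1 := by
    intro t ht x
    have h1 := norm_sub_le_of_lip (hC 0 ⟨le_rfl, hT.le⟩ t (hs ht) x)
    rw [sub_zero, abs_of_nonneg ht.1] at h1
    have h2 : C * t ≤ 1 := by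
      have : t ≤ 1 / (C + 1) := ht.2.trans (min_le_right _ _)
      rw [le_div_iff₀ (by positivity)] at this
      nlinarith [ht.1]
    have h3 := hM x
    rw [← h0 x] at h3
    have h4 := norm_le_norm_add_norm_sub' (W t x) (W 0 x)
    linarith
  refine ⟨T', W, hT'0, fun x => ?_, ⟨F, h0⟩, fun n => (hJ n).mono hT'T, fun t ht x => ?_,
    fun j => ?_, fun j => ?_⟩
  · rw [h0, hF]; push_cast; ring
  · have h1 := (hd t (hs ht) x).mono hs
    rwa [hNe _ (hb t ht x)] at h1
  · obtain ⟨C, hC0, hC⟩ := hl j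
    exact ⟨C, hC0, fun s hs' t ht x => hC s (hs hs') t (hs ht) x⟩
  · obtain ⟨C, hC0, hC⟩ := hl2 j
    exact ⟨C, hC0, fun s hs' t ht => hC s (hs hs') t (hs ht)⟩

/-! ### Instantaneous filling of the vacuum -/

lemma IsVacuumDatum.contDiff (hψ : IsVacuumDatum ψ₀) : ContDiff ℝ ∞ ψ₀ := by
  obtain ⟨f, hf⟩ := hψ.schwartz
  have : ψ₀ = fun x => 1 - f x := funext fun x => by rw [hf]; ring
  rw [this]
  exact contDiff_const.sub (f.smooth ⊤)

lemma IsVacuumDatum.fderiv_zero (hψ : IsVacuumDatum ψ₀) : fderiv ℝ ψ₀ 0 = 0 := by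
  refine IsLocalMin.fderiv_eq_zero (Eventually.of_forall fun x => ?_)
  rw [hψ.zero]
  by_cases hx : x = 0
  · rw [hx, hψ.zero]
  · exact (hψ.pos x hx).le

/-- Near infinity `ψ₀` is close to `1`; on the remaining compact set it attains a positive minimum.
-/
lemma IsVacuumDatum.exists_lower_bound (hψ : IsVacuumDatum ψ₀) {r : ℝ} (hr : 0 < r) :
    ∃ c, 0 < c ∧ ∀ x, r ≤ ‖x‖ → c ≤ ψ₀ x := by
  obtain ⟨f, hf⟩ := hψ.schwartz
  have h1 : Tendsto f (cocompact (RSpace d)) (𝓝 0) := f.tendsto_cocompact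
  have h2 : ∀ᶠ x in cocompact (RSpace d), f x < 1 / 2 := h1.eventually (gt_mem_nhds (by norm_num))
  rw [Filter.eventually_iff, mem_cocompact] at h2
  obtain ⟨K, hK, hKs⟩ := h2
  have hout : ∀ x ∉ K, 1 / 2 ≤ ψ₀ x := fun x hx => by
    have : f x < 1 / 2 := hKs hx
    rw [hf x] at this
    linarith
  have hK' : IsCompact (K ∩ {x | r ≤ ‖x‖}) := hK.inter_right (isClosed_le continuous_const
    continuous_norm)
  rcases (K ∩ {x | r ≤ ‖x‖}).eq_empty_or_nonempty with he | hne
  · refine ⟨1 / 2, by norm_num, fun x hx => hout x fun hxK => ?_⟩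
    have : x ∈ K ∩ {x | r ≤ ‖x‖} := ⟨hxK, hx⟩
    simp [he] at this
  · obtain ⟨y, hy, hmin⟩ := hK'.exists_isMinOn hne hψ.contDiff.continuous.continuousOn
    have hy0 : y ≠ 0 := by
      rintro rfl
      have := hy.2
      simp only [mem_ofPred_eq, norm_zero] at this
      linarith
    refine ⟨min (1 / 2) (ψ₀ y), lt_min (by norm_num) (hψ.pos y hy0), fun x hx => ?_⟩
    by_cases hxK : x ∈ K
    · exact (min_le_right _ _).trans (hmin ⟨hxK, hx⟩)
    · exact (min_le_left _ _).trans (hout x hxK)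

variable {T : ℝ} {W : ℝ → RSpace d → ℂ}

/-- The time derivative of a profile. -/
noncomputable def profileDeriv (g : ℝ → ℝ) (W : ℝ → RSpace d → ℂ) (t : ℝ) (x : RSpace d) : ℂ :=
  Complex.I * Laplacian.laplacian (W t) x - Complex.I * profileNonlin g (W t x)

lemma IsProfile.jointly_deriv (hg : ContDiffOn ℝ ∞ g (Ici 0)) (h : IsProfile g ψ₀ T W) (n : ℕ) :
    JointlyCn T n (profileDeriv g W) := by
  have h1 := (h.jointly n).laplacian.clm_comp ((ContinuousLinearMap.mul ℝ ℂ) Complex.I)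
  have h2 := ((h.jointly n).comp (contDiff_profileNonlin hg)).clm_comp
    (-(ContinuousLinearMap.mul ℝ ℂ) Complex.I)
  refine (h1.add h2).congr fun t ht x => ?_
  simp [profileDeriv, sub_eq_add_neg]

/-- The nonlinearity vanishes at the vacuum and the initial value is real, so the initial speed is
purely imaginary, transversal to the real values of `ψ₀`. -/
lemma IsProfile.profileDeriv_zero (hψ : IsVacuumDatum ψ₀) (h : IsProfile g ψ₀ T W) :
    profileDeriv g W 0 0 = Complex.I * (Laplacian.laplacian ψ₀ 0 : ℝ) := by
  have h1 : W 0 0 = -1 := by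
    have := h.init 0
    rw [hψ.zero, Complex.ofReal_zero] at this
    linear_combination this
  have h2 : W 0 = fun x => Complex.ofRealCLM (ψ₀ x) + (-1) := funext fun x => by
    have := h.init x
    simp only [Complex.ofRealCLM_apply]
    linear_combination this
  have h3 : fderiv ℝ (W 0) = fun x => Complex.ofRealCLM.comp (fderiv ℝ ψ₀ x) := by
    ext1 x
    rw [h2, fderiv_add_const]
    exact (Complex.ofRealCLM.hasFDerivAt.comp x
      (hψ.contDiff.differentiable (by simp) x).hasFDerivAt).fderiv
  have h4 : Laplacian.laplacian (W 0) 0 = (Laplacian.laplacian ψ₀ 0 : ℝ) := by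
    have hd : Differentiable ℝ (fderiv ℝ ψ₀) :=
      (hψ.contDiff.fderiv_right (m := ∞) (by simp)).differentiable (by simp)
    rw [laplacian_eq_sum_fderiv, laplacian_eq_sum_fderiv, h3]
    push_cast
    refine Finset.sum_congr rfl fun i _ => ?_
    have := ((ContinuousLinearMap.compL ℝ (RSpace d) ℝ ℂ Complex.ofRealCLM).hasFDerivAt.comp
      (0 : RSpace d) (hd 0).hasFDerivAt).fderiv
    have e : (fun x => Complex.ofRealCLM.comp (fderiv ℝ ψ₀ x)) =
      (ContinuousLinearMap.compL ℝ (RSpace d) ℝ ℂ Complex.ofRealCLM) ∘ (fderiv ℝ ψ₀) := rfl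
    rw [e, this]
    simp
  rw [profileDeriv, h1, h4, profileNonlin_neg_one]
  simp

/-- Near the initial vacuum the wave function moves with a non zero imaginary speed. -/
lemma IsProfile.exists_approx (hg : ContDiffOn ℝ ∞ g (Ici 0)) (hψ : IsVacuumDatum ψ₀)
    (h : IsProfile g ψ₀ T W) {ε : ℝ} (hε : 0 < ε) : ∃ r, 0 < r ∧ ∃ T', 0 < T' ∧ T' ≤ T ∧
      ∀ t ∈ Icc 0 T', ∀ x, ‖x‖ ≤ r →
        ‖profileDeriv g W t x - Complex.I * (Laplacian.laplacian ψ₀ 0 : ℝ)‖ ≤ ε ∧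
        ‖1 + W t x - ψ₀ x - Complex.I * (Laplacian.laplacian ψ₀ 0 : ℝ) * t‖ ≤ ε * t := by
  have hc := (h.jointly_deriv hg 0).apply.continuousOn (0, 0)
    ⟨⟨le_rfl, h.time_pos.le⟩, mem_univ _⟩
  rw [Metric.continuousWithinAt_iff] at hc
  obtain ⟨δ, hδ, hc⟩ := hc ε hε
  have hT' : min T (δ / 2) ≤ T := min_le_left _ _
  have hder : ∀ t ∈ Icc 0 (min T (δ / 2)), ∀ x : RSpace d, ‖x‖ ≤ δ / 2 →
        ‖profileDeriv g W t x - Complex.I * (Laplacian.laplacian ψ₀ 0 : ℝ)‖ ≤ ε := by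
    intro t ht x hx
    have := hc (x := (t, x)) ⟨⟨ht.1, ht.2.trans hT'⟩, mem_univ _⟩ (by
      rw [dist_eq_norm, Prod.norm_def]
      refine max_lt ?_ ?_
      · simp only [Prod.fst_sub, sub_zero, Real.norm_eq_abs, abs_of_nonneg ht.1]
        linarith [ht.2.trans (min_le_right _ _)]
      · simp only [Prod.snd_sub, sub_zero]
        linarith)
    rw [dist_eq_norm] at this
    simp only [h.profileDeriv_zero hψ] at this
    exact this.le
  refine ⟨δ / 2, by positivity, min T (δ / 2), lt_min h.time_pos (by positivity), hT',
    fun t ht x hx => ⟨hder t ht x hx, ?_⟩⟩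
  set κ : ℂ := Complex.I * (Laplacian.laplacian ψ₀ 0 : ℝ) with hκ
  have hd : ∀ s ∈ Icc 0 (min T (δ / 2)), HasDerivWithinAt (fun s : ℝ => W s x - κ * s)
      (profileDeriv g W s x - κ) (Icc 0 (min T (δ / 2))) s := by
    intro s hs
    have h1 := (h.hasDeriv s ⟨hs.1, hs.2.trans hT'⟩ x).mono (Icc_subset_Icc_right hT')
    have h2 : HasDerivWithinAt (fun s : ℝ => κ * (s : ℂ)) κ (Icc 0 (min T (δ / 2))) s := by
      have := ((Complex.ofRealCLM.hasDerivAt (x := s)).const_mul κ).hasDerivWithinAt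
        (s := Icc 0 (min T (δ / 2)))
      simpa using this
    exact h1.sub h2
  -- Mean value inequality for `W s x - κ s`, whose time derivative has norm at most `ε`.
  have := (convex_Icc 0 (min T (δ / 2))).norm_image_sub_le_of_norm_hasDerivWithin_le hd
    (fun s hs => hder s hs x hx) ⟨le_rfl, ht.1.trans ht.2⟩ ht
  simp only [Complex.ofReal_zero, mul_zero, sub_zero, Real.norm_eq_abs, abs_of_nonneg ht.1] at this
  rw [← h.init x]
  rw [show 1 + W t x - (1 + W 0 x) - κ * t = W t x - κ * t - W 0 x by ring]
  exact this

/-- The vacuum disappears instantaneously. -/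
lemma IsProfile.exists_pos (hg : ContDiffOn ℝ ∞ g (Ici 0)) (hψ : IsVacuumDatum ψ₀)
    (h : IsProfile g ψ₀ T W) : ∃ T', 0 < T' ∧ T' ≤ T ∧ ∀ τ, 0 < τ → ∃ c : ℝ, 0 < c ∧
      ∀ t ∈ Icc τ T', ∀ x, c ≤ ‖1 + W t x‖ := by
  set κ : ℝ := Laplacian.laplacian ψ₀ 0 with hκ
  have hκ0 : 0 < |κ| := abs_pos.mpr hψ.laplacian_ne
  obtain ⟨r, hr, T₁, hT₁, hT₁T, H⟩ := h.exists_approx hg hψ (show 0 < |κ| / 2 by positivity)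
  obtain ⟨c, hc, hlow⟩ := hψ.exists_lower_bound hr
  obtain ⟨C, hC0, hC⟩ := h.lip 0
  refine ⟨min T₁ (c / (2 * (C + 1))), lt_min hT₁ (by positivity), (min_le_left _ _).trans hT₁T,
    fun τ hτ => ⟨min (c / 2) (|κ| / 2 * τ), by positivity, fun t ht x => ?_⟩⟩
  have ht0 : 0 ≤ t := hτ.le.trans ht.1
  have ht1 : t ≤ T₁ := ht.2.trans (min_le_left _ _)
  -- Near the origin `ψ₀` does not contribute to the imaginary part, which is therefore `κt` up to
  -- `|κ|t/2`. Farther away the initial modulus is at least `c` and has changed by at most `c / 2`.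
  rcases le_total ‖x‖ r with hx | hx
  · refine (min_le_right _ _).trans ?_
    have h1 := (H t ⟨ht0, ht1⟩ x hx).2
    have h2 := (Complex.abs_im_le_norm _).trans h1
    have h3 : (1 + W t x - ψ₀ x - Complex.I * (κ : ℝ) * t).im = (1 + W t x).im - κ * t := by
      simp
    rw [h3] at h2
    have h4 : |κ * t| ≤ |(1 + W t x).im| + |(1 + W t x).im - κ * t| := by
      have := abs_sub (1 + W t x).im ((1 + W t x).im - κ * t)
      rwa [sub_sub_cancel] at this
    rw [abs_mul, abs_of_nonneg ht0] at h4
    have h5 := Complex.abs_im_le_norm (1 + W t x)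
    nlinarith [ht.1]
  · refine (min_le_left _ _).trans ?_
    have h1 := norm_sub_le_of_lip (hC 0 ⟨le_rfl, h.time_pos.le⟩ t ⟨ht0, ht1.trans hT₁T⟩ x)
    rw [sub_zero, abs_of_nonneg ht0] at h1
    have h2 : C * t ≤ c / 2 := by
      have := ht.2.trans (min_le_right _ _)
      rw [le_div_iff₀ (by positivity)] at this
      nlinarith
    have h3 : c ≤ ‖1 + W 0 x‖ := by
      rw [h.init x, Complex.norm_real]
      exact (hlow x hx).trans (Real.le_norm_self _)
    have h4 : ‖1 + W 0 x‖ ≤ ‖1 + W t x‖ + ‖W t x - W 0 x‖ := by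
      have := norm_sub_le (1 + W t x) (W t x - W 0 x)
      rwa [show 1 + W t x - (W t x - W 0 x) = 1 + W 0 x by ring] at this
    linarith

end Profile

/-! ### The Gross--Pitaevskii equation -/

section GrossPitaevskii

variable {d : ℕ} {g : ℝ → ℝ} {ψ₀ : RSpace d → ℝ} {T : ℝ} {W : ℝ → RSpace d → ℂ}

lemma norm_farField (g : ℝ → ℝ) (t : ℝ) : ‖farField g t‖ = 1 := by
  have : farField g t = Complex.exp ((-(g 1 * t / 2) : ℝ) * Complex.I) := by
    rw [farField]; congr 1; push_cast; ring
  rw [this, Complex.norm_exp_ofReal_mul_I]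

lemma contDiff_farField (g : ℝ → ℝ) : ContDiff ℝ ∞ (farField g) := by
  have h : ContDiff ℝ ∞ (fun t : ℝ => (t : ℂ)) := Complex.ofRealCLM.contDiff
  exact ((contDiff_const.mul h).div_const 2).neg.cexp

lemma hasDerivAt_farField (g : ℝ → ℝ) (t : ℝ) :
    HasDerivAt (farField g) (-(Complex.I * g 1 / 2) * farField g t) t := by
  have h1 : HasDerivAt (fun t : ℝ => (t : ℂ)) 1 t := by
    have := Complex.ofRealCLM.hasDerivAt (x := t)
    rwa [Complex.ofRealCLM_apply, Complex.ofReal_one] at this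
  have h2 : HasDerivAt (farField g) (Complex.exp (-(Complex.I * (g 1 : ℂ) * (t : ℂ) / 2)) *
      -(Complex.I * (g 1 : ℂ) * 1 / 2)) t := (((h1.const_mul (Complex.I * (g 1 : ℂ))).div_const 2).neg).cexp
  rw [farField]
  convert h2 using 1
  ring

/-- The wave function associated to a profile. -/
noncomputable def wave (g : ℝ → ℝ) (W : ℝ → RSpace d → ℂ) (t : ℝ) (x : RSpace d) : ℂ :=
  farField g t * (1 + W t x)

lemma norm_wave (t : ℝ) (x : RSpace d) : ‖wave g W t x‖ = ‖1 + W t x‖ := by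
  rw [wave, norm_mul, norm_farField, one_mul]

lemma laplacian_const_mul_one_add {f : RSpace d → ℂ} (hf : ContDiff ℝ ∞ f) (c : ℂ) (x : RSpace d) :
    Laplacian.laplacian (fun y => c * (1 + f y)) x = c * Laplacian.laplacian f x := by
  have h1 : fderiv ℝ (fun y => c * (1 + f y)) = fun y => c • fderiv ℝ f y := by
    ext1 y
    rw [fderiv_const_mul ((hf.differentiable (by simp) y).const_add 1), fderiv_const_add]
  have h2 : DifferentiableAt ℝ (fderiv ℝ f) x :=
    (hf.fderiv_right (m := ∞) (by simp)).differentiable (by simp) x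
  rw [laplacian_eq_sum_fderiv, laplacian_eq_sum_fderiv, h1, fderiv_fun_const_smul h2,
    Finset.mul_sum]
  simp

lemma IsProfile.contDiffOn (h : IsProfile g ψ₀ T W) :
    ContDiffOn ℝ ∞ (fun p : ℝ × RSpace d => W p.1 p.2) (Icc 0 T ×ˢ univ) :=
  contDiffOn_infty.2 fun n => (h.jointly n).apply

lemma IsProfile.contDiff (h : IsProfile g ψ₀ T W) {t : ℝ} (ht : t ∈ Icc 0 T) :
    ContDiff ℝ ∞ (W t) := (h.jointly 0).1 t ht

lemma IsProfile.isSmoothGPSolution (h : IsProfile g ψ₀ T W) :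
    IsSmoothGPSolution g T (wave g W) := by
  refine ⟨?_, fun t ht x => ?_⟩
  · exact ((contDiff_farField g).comp contDiff_fst).contDiffOn.mul
      (contDiffOn_const.add h.contDiffOn)
  · have h1 := ((hasDerivAt_farField g t).hasDerivWithinAt (s := Icc 0 T)).mul
      ((h.hasDeriv t ht x).const_add 1)
    have h2 : derivWithin (fun s => wave g W s x) (Icc 0 T) t = _ :=
      h1.derivWithin (uniqueDiffOn_Icc h.time_pos t ht)
    have h3 : Laplacian.laplacian (wave g W t) x = farField g t * Laplacian.laplacian (W t) x :=
      laplacian_const_mul_one_add (h.contDiff ht) _ x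
    -- The time derivative of `farField` produces the term in `g 1` that was subtracted in
    -- `profileNonlin`.
    rw [h2, h3, norm_wave, wave, profileNonlin]
    push_cast
    linear_combination (farField g t) * (Laplacian.laplacian (W t) x - ((g (‖1 + W t x‖ ^ 2) : ℂ)
      - g 1) * (1 + W t x) / 2 - (g 1 : ℂ) / 2 * (1 + W t x)) * Complex.I_mul_I

lemma laplacian_conj {f : RSpace d → ℂ} (hf : ContDiff ℝ ∞ f) (x : RSpace d) :
    Laplacian.laplacian (fun y => conj (f y)) x = conj (Laplacian.laplacian f x) :=
  ContDiffAt.laplacian_CLM_comp_left (l := Complex.conjCLE.toContinuousLinearMap)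
    (hf.of_le (nat_le_smooth 2)).contDiffAt

/-- The Gross--Pitaevskii equation is reversible. -/
lemma IsSmoothGPSolution.reverse {ψ : ℝ → RSpace d → ℂ} (hT : 0 < T)
    (h : IsSmoothGPSolution g T ψ) :
    IsSmoothGPSolution g T (fun t x => conj (ψ (T - t) x)) := by
  have hm : ∀ t ∈ Icc 0 T, T - t ∈ Icc 0 T := fun t ht => ⟨by linarith [ht.2], by linarith [ht.1]⟩
  have hsm : ∀ t ∈ Icc 0 T, ContDiff ℝ ∞ (ψ t) := fun t ht =>
    h.smooth.comp_contDiff (contDiff_const.prodMk contDiff_id) fun x => ⟨ht, mem_univ _⟩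
  refine ⟨?_, fun t ht x => ?_⟩
  · have h1 : ContDiff ℝ ∞ (fun p : ℝ × RSpace d => (T - p.1, p.2)) :=
      (contDiff_const.sub contDiff_fst).prodMk contDiff_snd
    exact Complex.conjCLE.contDiff.comp_contDiffOn
      (h.smooth.comp h1.contDiffOn fun p hp => ⟨hm _ hp.1, mem_univ _⟩)
  · have h0 := h.equation (T - t) (hm t ht) x
    have hdiff : DifferentiableWithinAt ℝ (fun s => ψ s x) (Icc 0 T) (T - t) := by
      have := (h.smooth.differentiableOn (by simp)) (T - t, x) ⟨hm t ht, mem_univ _⟩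
      exact DifferentiableWithinAt.comp (T - t) (t := Icc 0 T ×ˢ univ)
        (f := fun s : ℝ => (s, x)) this
        (by fun_prop) fun s hs => mk_mem_prod hs (mem_univ _)
    have h1 : HasDerivWithinAt (fun s => ψ (T - s) x)
        (-derivWithin (fun s => ψ s x) (Icc 0 T) (T - t)) (Icc 0 T) t := by
      have := HasDerivWithinAt.scomp t (h := fun s : ℝ => T - s) (h' := -1) (s := Icc 0 T)
        hdiff.hasDerivWithinAt
        ((hasDerivAt_id t).const_sub T).hasDerivWithinAt fun s hs => hm s hs
      simpa [Function.comp_def] using this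
    have h2 : HasDerivWithinAt (fun s => conj (ψ (T - s) x))
        (conj (-derivWithin (fun s => ψ s x) (Icc 0 T) (T - t))) (Icc 0 T) t :=
      (Complex.conjCLE.toContinuousLinearMap.hasFDerivAt.comp_hasDerivWithinAt t h1)
    rw [h2.derivWithin (uniqueDiffOn_Icc hT t ht), laplacian_conj (hsm _ (hm t ht)),
      Complex.norm_conj]
    -- Conjugation turns `i` into `-i`, and reversing time restores the sign of the time derivative.
    have := congrArg conj h0
    simp only [map_add, map_mul, map_div₀, Complex.conj_I, Complex.conj_ofReal, map_ofNat] at this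
    rw [map_neg, ← this]
    ring

end GrossPitaevskii

/-! ### Sobolev regularity -/

section SobolevContinuity

variable {d : ℕ} {V V' : Type} [NormedAddCommGroup V] [NormedSpace ℝ V]
  [NormedAddCommGroup V'] [NormedSpace ℝ V'] {I : Set ℝ}

/-- Families which are continuous in all Sobolev spaces and bounded with all their derivatives. -/
structure SobolevBounded (I : Set ℝ) (v : ℝ → RSpace d → V) : Prop where
  continuous : ContinuousInSobolev I v
  bounded : ∀ j, ∃ C, ∀ t ∈ I, ∀ x, ‖iteratedFDeriv ℝ j (v t) x‖ ≤ C

/-- Continuity in time with values in `L²`. -/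
def ContinuousInL2 (I : Set ℝ) (v : ℝ → RSpace d → V) : Prop :=
  ∀ t ∈ I, MemLp (v t) 2 volume ∧
    Tendsto (fun s => eLpNorm (fun x => v s x - v t x) 2 volume) (𝓝[I] t) (𝓝 0)

lemma ContinuousInL2.of_norm_le {X Y : Type} [NormedAddCommGroup X] [NormedAddCommGroup Y]
    {v : ℝ → RSpace d → X} {w : ℝ → RSpace d → Y}
    (hv : ContinuousInL2 I v) (hw : ∀ t ∈ I, Continuous (w t)) (C : ℝ)
    (h1 : ∀ t ∈ I, ∀ x, ‖w t x‖ ≤ C * ‖v t x‖)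
    (h2 : ∀ t ∈ I, ∀ s ∈ I, ∀ x, ‖w s x - w t x‖ ≤ C * ‖v s x - v t x‖) :
    ContinuousInL2 I w := by
  intro t ht
  refine ⟨(hv t ht).1.of_le_mul (hw t ht).aestronglyMeasurable
    (Eventually.of_forall fun x => h1 t ht x), ?_⟩
  have h3 : Tendsto (fun s => ENNReal.ofReal C * eLpNorm (fun x => v s x - v t x) 2 volume)
      (𝓝[I] t) (𝓝 0) := by
    simpa using ENNReal.Tendsto.const_mul (a := ENNReal.ofReal C) (hv t ht).2
      (Or.inr ENNReal.ofReal_ne_top)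
  refine tendsto_of_tendsto_of_tendsto_of_le_of_le' tendsto_const_nhds h3
    (Eventually.of_forall fun s => zero_le) ?_
  filter_upwards [eventually_mem_nhdsWithin] with s hs
  exact eLpNorm_le_mul_eLpNorm_of_ae_le_mul (Eventually.of_forall fun x => h2 t ht s hs x) 2

lemma continuousInSobolev_iff {v : ℝ → RSpace d → V} : ContinuousInSobolev I v ↔
    (∀ t ∈ I, ContDiff ℝ ∞ (v t)) ∧
      ∀ j : ℕ, ContinuousInL2 I (fun t x => iteratedFDeriv ℝ j (v t) x) :=
  ⟨fun h => ⟨fun t ht => (h t ht).1, fun j t ht => (h t ht).2 j⟩,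
    fun h t ht => ⟨h.1 t ht, fun j => h.2 j t ht⟩⟩

lemma ContinuousInSobolev.of_norm_le {v : ℝ → RSpace d → V} {w : ℝ → RSpace d → V'}
    (hv : ContinuousInSobolev I v) (hw : ∀ t ∈ I, ContDiff ℝ ∞ (w t))
    (hb : ∀ j, ∃ k : ℕ, ∃ C : ℝ, ∀ t ∈ I, ∀ x,
      ‖iteratedFDeriv ℝ j (w t) x‖ ≤ C * ‖iteratedFDeriv ℝ k (v t) x‖ ∧
      ∀ s ∈ I, ‖iteratedFDeriv ℝ j (w s) x - iteratedFDeriv ℝ j (w t) x‖ ≤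
        C * ‖iteratedFDeriv ℝ k (v s) x - iteratedFDeriv ℝ k (v t) x‖) :
    ContinuousInSobolev I w := by
  refine continuousInSobolev_iff.2 ⟨hw, fun j => ?_⟩
  obtain ⟨k, C, hC⟩ := hb j
  exact ((continuousInSobolev_iff.1 hv).2 k).of_norm_le
    (fun t ht => (hw t ht).continuous_iteratedFDeriv (nat_le_smooth j)) C
    (fun t ht x => (hC t ht x).1) (fun t ht s hs x => (hC t ht x).2 s hs)

lemma ContinuousInSobolev.add {v w : ℝ → RSpace d → V} (hv : ContinuousInSobolev I v)
    (hw : ContinuousInSobolev I w) : ContinuousInSobolev I (fun t x => v t x + w t x) := by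
  have he : ∀ t ∈ I, ∀ j : ℕ, iteratedFDeriv ℝ j (fun x => v t x + w t x) =
      iteratedFDeriv ℝ j (v t) + iteratedFDeriv ℝ j (w t) := fun t ht j => funext fun x =>
    iteratedFDeriv_add_apply (((hv t ht).1).of_le (nat_le_smooth j)).contDiffAt
      (((hw t ht).1).of_le (nat_le_smooth j)).contDiffAt
  refine fun t ht => ⟨(hv t ht).1.add (hw t ht).1, fun j => ⟨?_, ?_⟩⟩
  · rw [he t ht]
    exact ((hv t ht).2 j).1.add ((hw t ht).2 j).1
  · have h3 := ((hv t ht).2 j).2.add ((hw t ht).2 j).2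
    rw [add_zero] at h3
    refine tendsto_of_tendsto_of_tendsto_of_le_of_le' tendsto_const_nhds h3
      (Eventually.of_forall fun s => zero_le) ?_
    filter_upwards [eventually_mem_nhdsWithin] with s hs
    have e : (fun x => iteratedFDeriv ℝ j (fun x => v s x + w s x) x -
        iteratedFDeriv ℝ j (fun x => v t x + w t x) x) =
        (fun x => iteratedFDeriv ℝ j (v s) x - iteratedFDeriv ℝ j (v t) x) +
        (fun x => iteratedFDeriv ℝ j (w s) x - iteratedFDeriv ℝ j (w t) x) := by
      ext1 x
      rw [he s hs, he t ht]
      simp only [Pi.add_apply]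
      abel
    rw [e]
    have hm : ∀ {u : ℝ → RSpace d → V}, ContinuousInSobolev I u → AEStronglyMeasurable
        (fun x => iteratedFDeriv ℝ j (u s) x - iteratedFDeriv ℝ j (u t) x) volume := fun hu =>
      (((hu s hs).1.continuous_iteratedFDeriv (nat_le_smooth j)).sub
        ((hu t ht).1.continuous_iteratedFDeriv (nat_le_smooth j))).aestronglyMeasurable
    exact eLpNorm_add_le (hm hv) (hm hw) (by norm_num)

lemma SobolevBounded.add {v w : ℝ → RSpace d → V} (hv : SobolevBounded I v)
    (hw : SobolevBounded I w) : SobolevBounded I (fun t x => v t x + w t x) := by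
  refine ⟨hv.continuous.add hw.continuous, fun j => ?_⟩
  obtain ⟨C, hC⟩ := hv.bounded j
  obtain ⟨C', hC'⟩ := hw.bounded j
  refine ⟨C + C', fun t ht x => ?_⟩
  have := iteratedFDeriv_add_apply (x := x)
    (((hv.continuous t ht).1).of_le (nat_le_smooth j)).contDiffAt
    (((hw.continuous t ht).1).of_le (nat_le_smooth j)).contDiffAt
  have h2 : iteratedFDeriv ℝ j (fun x => v t x + w t x) x = _ := this
  rw [h2]
  exact (norm_add_le _ _).trans (add_le_add (hC t ht x) (hC' t ht x))

lemma SobolevBounded.clm_comp {v : ℝ → RSpace d → V} (hv : SobolevBounded I v) (L : V →L[ℝ] V') :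
    SobolevBounded I (fun t x => L (v t x)) := by
  have hs : ∀ t ∈ I, ContDiff ℝ ∞ (fun x => L (v t x)) := fun t ht =>
    L.contDiff.comp (hv.continuous t ht).1
  have he : ∀ t ∈ I, ∀ (j : ℕ) x, iteratedFDeriv ℝ j (fun x => L (v t x)) x =
      L.compContinuousMultilinearMap (iteratedFDeriv ℝ j (v t) x) := fun t ht j x =>
    L.iteratedFDeriv_comp_left (hv.continuous t ht).1.contDiffAt (nat_le_smooth j)
  refine ⟨hv.continuous.of_norm_le hs fun j => ⟨j, ‖L‖, fun t ht x => ⟨?_, fun s hs' => ?_⟩⟩,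
    fun j => ?_⟩
  · rw [he t ht]
    exact L.norm_compContinuousMultilinearMap_le _
  · have e : iteratedFDeriv ℝ j (fun x => L (v s x)) x - iteratedFDeriv ℝ j (fun x => L (v t x)) x
        = L.compContinuousMultilinearMap (iteratedFDeriv ℝ j (v s) x -
          iteratedFDeriv ℝ j (v t) x) := by
      rw [he t ht, he s hs']
      ext; simp
    rw [e]
    exact L.norm_compContinuousMultilinearMap_le _
  · obtain ⟨C, hC⟩ := hv.bounded j
    refine ⟨‖L‖ * C, fun t ht x => ?_⟩
    rw [he t ht]
    exact (L.norm_compContinuousMultilinearMap_le _).trans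
      (mul_le_mul_of_nonneg_left (hC t ht x) (norm_nonneg _))

lemma iteratedFDeriv_fderiv_eq {u : RSpace d → V} (j : ℕ) (x : RSpace d) :
    iteratedFDeriv ℝ j (fun y => fderiv ℝ u y) x =
      continuousMultilinearCurryRightEquiv' ℝ j (RSpace d) V (iteratedFDeriv ℝ (j + 1) u x) := by
  simp [iteratedFDeriv_succ_eq_comp_right]

lemma SobolevBounded.fderiv {v : ℝ → RSpace d → V} (hv : SobolevBounded I v) :
    SobolevBounded I (fun t x => fderiv ℝ (v t) x) := by
  have hs : ∀ t ∈ I, ContDiff ℝ ∞ (fun x => _root_.fderiv ℝ (v t) x) := fun t ht =>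
    (hv.continuous t ht).1.fderiv_right (by simp)
  refine ⟨hv.continuous.of_norm_le hs fun j => ⟨j + 1, 1, fun t ht x => ⟨?_, fun s hs' => ?_⟩⟩,
    fun j => ?_⟩
  · rw [iteratedFDeriv_fderiv_eq, LinearIsometryEquiv.norm_map, one_mul]
  · rw [iteratedFDeriv_fderiv_eq, iteratedFDeriv_fderiv_eq, ← dist_eq_norm,
      LinearIsometryEquiv.dist_map, dist_eq_norm, one_mul]
  · obtain ⟨C, hC⟩ := hv.bounded (j + 1)
    refine ⟨C, fun t ht x => ?_⟩
    rw [iteratedFDeriv_fderiv_eq, LinearIsometryEquiv.norm_map]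
    exact hC t ht x

lemma SobolevBounded.prodMk {v : ℝ → RSpace d → V} {w : ℝ → RSpace d → V'}
    (hv : SobolevBounded I v) (hw : SobolevBounded I w) :
    SobolevBounded I (fun t x => (v t x, w t x)) := by
  have := (hv.clm_comp (ContinuousLinearMap.inl ℝ V V')).add
    (hw.clm_comp (ContinuousLinearMap.inr ℝ V V'))
  simpa using this

/-- Smooth maps are Lipschitz continuous on balls of finite dimensional spaces. -/
lemma exists_lipschitz_on_closedBall [FiniteDimensional ℝ V] {F : V → V'} (hF : ContDiff ℝ ∞ F)
    (R : ℝ) : ∃ C : ℝ, ∀ p q, ‖p‖ ≤ R → ‖q‖ ≤ R → ‖F p - F q‖ ≤ C * ‖p - q‖ := by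
  have : ProperSpace V := FiniteDimensional.proper ℝ V
  have hc : Continuous (fun p => ‖_root_.fderiv ℝ F p‖) := (hF.continuous_fderiv (by simp)).norm
  obtain ⟨C, hC⟩ := (isCompact_closedBall (0 : V) R).bddAbove_image hc.continuousOn
  refine ⟨C, fun p q hp hq => ?_⟩
  refine (convex_closedBall (0 : V) R).norm_image_sub_le_of_norm_fderiv_le
    (fun z _ => hF.differentiable (by simp) z) (fun z hz => hC ⟨z, hz, rfl⟩)
    (by simpa using hq) (by simpa using hp)

/-- Superposition by smooth maps vanishing at `0` preserves continuity in Sobolev spaces. -/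
theorem SobolevBounded.comp [FiniteDimensional ℝ V] {v : ℝ → RSpace d → V}
    (hv : SobolevBounded I v) {F : V → V'} (hF : ContDiff ℝ ∞ F) (h0 : F 0 = 0) :
    ContinuousInSobolev I (fun t x => F (v t x)) := by
  refine continuousInSobolev_iff.2 ⟨fun t ht => hF.comp (hv.continuous t ht).1, fun j => ?_⟩
  induction j generalizing V V' with
  | zero =>
    -- All values lie in one ball, compact in finite dimension, on which `F` is Lipschitz. Together
    -- with `F 0 = 0` this controls both size and differences in `L²`.
    obtain ⟨R, hR⟩ := hv.bounded 0
    obtain ⟨C, hC⟩ := exists_lipschitz_on_closedBall hF (max R 0)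
    have hR' : ∀ t ∈ I, ∀ x, ‖v t x‖ ≤ max R 0 := fun t ht x => by
      have := hR t ht x
      rw [norm_iteratedFDeriv_zero] at this
      exact this.trans (le_max_left _ _)
    have e : ∀ {X : Type} [NormedAddCommGroup X] [NormedSpace ℝ X] (u u' : RSpace d → X) x,
        ‖iteratedFDeriv ℝ 0 u x - iteratedFDeriv ℝ 0 u' x‖ = ‖u x - u' x‖ := by
      intro X _ _ u u' x
      have : iteratedFDeriv ℝ 0 u x - iteratedFDeriv ℝ 0 u' x =
          (continuousMultilinearCurryFin0 ℝ (RSpace d) X).symm (u x - u' x) := by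
        ext; simp
      rw [this, LinearIsometryEquiv.norm_map]
    refine ((continuousInSobolev_iff.1 hv.continuous).2 0).of_norm_le (fun t ht =>
      (hF.comp (hv.continuous t ht).1).continuous_iteratedFDeriv (nat_le_smooth 0)) C
      (fun t ht x => ?_) (fun t ht s hs x => ?_)
    · rw [norm_iteratedFDeriv_zero, norm_iteratedFDeriv_zero]
      simpa [h0] using hC (v t x) 0 (hR' t ht x) (by simp)
    · rw [e, e]
      exact hC _ _ (hR' s hs x) (hR' t ht x)
  | succ j ih =>
    -- The pair `(v, Dv)` again takes values in a finite dimensional space, and `chainMap d F`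
    -- vanishes at `0` because it is linear in its second component.
    have h1 := ih (hv.prodMk hv.fderiv) (contDiff_chainMap (d := d) hF) (by simp [chainMap])
    have e : ∀ t ∈ I, ∀ x, iteratedFDeriv ℝ (j + 1) (fun x => F (v t x)) x =
        (continuousMultilinearCurryRightEquiv' ℝ j (RSpace d) V').symm
          (iteratedFDeriv ℝ j (fun x => chainMap d F (v t x, _root_.fderiv ℝ (v t) x)) x) := by
      intro t ht x
      rw [iteratedFDeriv_succ_eq_comp_right, fderiv_comp_eq_chainMap hF (hv.continuous t ht).1]
      rfl
    refine h1.of_norm_le (fun t ht =>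
      (hF.comp (hv.continuous t ht).1).continuous_iteratedFDeriv (nat_le_smooth (j + 1))) 1
      (fun t ht x => ?_) (fun t ht s hs x => ?_)
    · rw [e t ht, LinearIsometryEquiv.norm_map, one_mul]
    · rw [e t ht, e s hs, ← dist_eq_norm, LinearIsometryEquiv.dist_map, dist_eq_norm, one_mul]

end SobolevContinuity

/-! ### Sobolev continuity of profiles and of the wave function -/

section ProfileSobolev

variable {d : ℕ} {g : ℝ → ℝ} {ψ₀ : RSpace d → ℝ} {T : ℝ} {W : ℝ → RSpace d → ℂ}

lemma IsProfile.memLp (h : IsProfile g ψ₀ T W) (j : ℕ) {t : ℝ} (ht : t ∈ Icc 0 T) :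
    MemLp (iteratedFDeriv ℝ j (W t)) 2 volume := by
  obtain ⟨f, hf⟩ := h.schwartz
  have e0 : W 0 = f := funext hf
  have h0 : MemLp (iteratedFDeriv ℝ j (W 0)) 2 volume := by
    rw [e0]
    obtain ⟨C, hC0, hC⟩ := exists_eLpNorm_iteratedFDeriv_le_sob d j
    exact ⟨((sch_contDiff f).continuous_iteratedFDeriv (nat_le_smooth j)).aestronglyMeasurable,
      (hC f).trans_lt ENNReal.ofReal_lt_top⟩
  have m0 : (0 : ℝ) ∈ Icc 0 T := ⟨le_rfl, h.time_pos.le⟩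
  obtain ⟨C, -, hC⟩ := h.l2lip j
  have h1 : MemLp (fun x => iteratedFDeriv ℝ j (W t) x - iteratedFDeriv ℝ j (W 0) x) 2 volume :=
    ⟨(((h.contDiff ht).continuous_iteratedFDeriv (nat_le_smooth j)).sub
      ((h.contDiff m0).continuous_iteratedFDeriv (nat_le_smooth j))).aestronglyMeasurable,
      (hC 0 m0 t ht).trans_lt ENNReal.ofReal_lt_top⟩
  have e : (fun x => iteratedFDeriv ℝ j (W t) x - iteratedFDeriv ℝ j (W 0) x) +
      iteratedFDeriv ℝ j (W 0) = iteratedFDeriv ℝ j (W t) := funext fun x => by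
    simp only [Pi.add_apply, sub_add_cancel]
  exact e ▸ h1.add h0

/-- The reparametrisation `σ` allows one statement to serve both the forward flow, with `σ = id`,
and the reversed one, with `σ t = τ - t`. -/
lemma IsProfile.sobolevBounded (h : IsProfile g ψ₀ T W) {I : Set ℝ} {σ : ℝ → ℝ}
    (hσ : MapsTo σ I (Icc 0 T)) (hσ' : ∀ s t, |σ s - σ t| ≤ |s - t|) :
    SobolevBounded I (fun t => W (σ t)) := by
  refine ⟨fun t ht => ⟨h.contDiff (hσ ht), fun j => ⟨h.memLp j (hσ ht), ?_⟩⟩, fun j => ?_⟩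
  · obtain ⟨C, hC0, hC⟩ := h.l2lip j
    have h3 : Tendsto (fun s => ENNReal.ofReal (C * |s - t|)) (𝓝[I] t) (𝓝 0) := by
      have hc : Continuous (fun s => ENNReal.ofReal (C * |s - t|)) :=
        ENNReal.continuous_ofReal.comp (by fun_prop)
      have := hc.tendsto t
      simp only [sub_self, abs_zero, mul_zero, ENNReal.ofReal_zero] at this
      exact this.mono_left nhdsWithin_le_nhds
    refine tendsto_of_tendsto_of_tendsto_of_le_of_le' tendsto_const_nhds h3
      (Eventually.of_forall fun s => zero_le) ?_
    filter_upwards [eventually_mem_nhdsWithin] with s hs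
    exact (hC _ (hσ ht) _ (hσ hs)).trans (ENNReal.ofReal_le_ofReal
      (mul_le_mul_of_nonneg_left (hσ' s t) hC0))
  · obtain ⟨f, hf⟩ := h.schwartz
    have e0 : W 0 = f := funext hf
    obtain ⟨M, hM⟩ := f.decay 0 j
    obtain ⟨C, hC0, hC⟩ := h.lip j
    refine ⟨M + C * T, fun t ht x => ?_⟩
    have h1 := hC 0 ⟨le_rfl, h.time_pos.le⟩ _ (hσ ht) x
    have h2 := hM.2 x
    rw [pow_zero, one_mul] at h2
    rw [e0, sub_zero, abs_of_nonneg (hσ ht).1] at h1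
    have h3 : C * σ t ≤ C * T := mul_le_mul_of_nonneg_left (hσ ht).2 hC0
    have := norm_le_norm_add_norm_sub' (iteratedFDeriv ℝ j (W (σ t)) x) (iteratedFDeriv ℝ j f x)
    linarith

lemma IsProfile.continuousInSobolev_wave (h : IsProfile g ψ₀ T W) :
    ContinuousInSobolev (Icc 0 T) (fun t x => wave g W t x - farField g t) := by
  have hW := (h.sobolevBounded (I := Icc 0 T) (σ := id) (fun t ht => ht)
    fun s t => le_rfl).continuous
  have e : ∀ t x, wave g W t x - farField g t = farField g t • W t x := fun t x => by
    rw [wave, smul_eq_mul]; ring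
  simp only [e]
  have eD : ∀ t ∈ Icc 0 T, ∀ (j : ℕ), iteratedFDeriv ℝ j (fun x => farField g t • W t x) =
      farField g t • iteratedFDeriv ℝ j (W t) := fun t ht j => funext fun x => by
    have := iteratedFDeriv_const_smul_apply (𝕜 := ℝ) (a := farField g t) (i := j) (x := x)
      ((h.contDiff ht).of_le (nat_le_smooth j)).contDiffAt
    exact this
  refine fun t ht => ⟨ContDiff.const_smul (farField g t) (h.contDiff ht), fun j => ⟨?_, ?_⟩⟩
  · rw [eD t ht]
    exact (h.memLp j ht).const_smul _
  · have h1 := ((hW t ht).2 j).2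
    have h2 : Tendsto (fun s => ‖farField g s - farField g t‖ₑ *
        eLpNorm (iteratedFDeriv ℝ j (W t)) 2 volume) (𝓝[Icc 0 T] t) (𝓝 0) := by
      have hc : Continuous (fun s => ‖farField g s - farField g t‖ₑ) :=
        ((contDiff_farField g).continuous.sub continuous_const).enorm
      have := (hc.tendsto t).mono_left (nhdsWithin_le_nhds (s := Icc 0 T))
      rw [sub_self, enorm_zero] at this
      simpa using ENNReal.Tendsto.mul_const this (Or.inr (h.memLp j ht).2.ne)
    have h3 := h1.add h2
    rw [add_zero] at h3
    refine tendsto_of_tendsto_of_tendsto_of_le_of_le' tendsto_const_nhds h3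
      (Eventually.of_forall fun s => zero_le) ?_
    filter_upwards [eventually_mem_nhdsWithin] with s hs
    have e : (fun x => iteratedFDeriv ℝ j (fun x => farField g s • W s x) x -
        iteratedFDeriv ℝ j (fun x => farField g t • W t x) x) =
        farField g s • (fun x => iteratedFDeriv ℝ j (W s) x - iteratedFDeriv ℝ j (W t) x) +
        (farField g s - farField g t) • iteratedFDeriv ℝ j (W t) := by
      ext1 x
      rw [eD t ht, eD s hs]
      change farField g s • iteratedFDeriv ℝ j (W s) x - farField g t • iteratedFDeriv ℝ j (W t) x =
        farField g s • (iteratedFDeriv ℝ j (W s) x - iteratedFDeriv ℝ j (W t) x) +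
          (farField g s - farField g t) • iteratedFDeriv ℝ j (W t) x
      rw [smul_sub, sub_smul]
      abel
    rw [e]
    have c1 := (h.contDiff ht).continuous_iteratedFDeriv (nat_le_smooth j)
    have c2 := (h.contDiff hs).continuous_iteratedFDeriv (nat_le_smooth j)
    refine (eLpNorm_add_le ((c2.sub c1).aestronglyMeasurable.const_smul _)
      (c1.aestronglyMeasurable.const_smul _) (by norm_num)).trans ?_
    rw [eLpNorm_const_smul, eLpNorm_const_smul]
    have : ‖farField g s‖ₑ = 1 := by
      rw [← ofReal_norm, norm_farField, ENNReal.ofReal_one]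
    rw [this, one_mul]
    exact le_rfl

end ProfileSobolev

/-! ### The Madelung transform -/

section Madelung

variable {d : ℕ} {V : Type} [NormedAddCommGroup V] [NormedSpace ℝ V]

/-- The derivative in direction `v`. -/
noncomputable def dirD (v : ℝ × RSpace d) (F : ℝ × RSpace d → V) (p : ℝ × RSpace d) : V :=
  fderiv ℝ F p v

/-- The unit vector in the time direction. -/
def timeVec (d : ℕ) : ℝ × RSpace d := (1, 0)

/-- The unit vectors in the space directions. -/
noncomputable def spaceVec (i : Fin d) : ℝ × RSpace d := (0, stdVec i)

lemma contDiff_dirD {F : ℝ × RSpace d → V} (hF : ContDiff ℝ ∞ F) (v : ℝ × RSpace d) :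
    ContDiff ℝ ∞ (dirD v F) :=
  (hF.fderiv_right (by simp)).clm_apply contDiff_const

lemma dirD_comm {F : ℝ × RSpace d → V} (hF : ContDiff ℝ ∞ F) (v w : ℝ × RSpace d)
    (p : ℝ × RSpace d) : dirD v (dirD w F) p = dirD w (dirD v F) p := by
  have h1 : DifferentiableAt ℝ (fderiv ℝ F) p :=
    (hF.fderiv_right (m := ∞) (by simp)).differentiable (by simp) p
  have h2 : ∀ v w : ℝ × RSpace d, dirD v (dirD w F) p = fderiv ℝ (fderiv ℝ F) p v w := by
    intro v w
    have : dirD w F = fun p => fderiv ℝ F p w := rfl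
    rw [dirD, this, fderiv_clm_apply h1 (differentiableAt_const _)]
    simp
  rw [h2, h2]
  exact (hF.contDiffAt.isSymmSndFDerivAt
    (by simpa using nat_le_smooth 2)).eq v w

lemma fderiv_slice {F : ℝ × RSpace d → V} (hF : ContDiff ℝ ∞ F) (t : ℝ) (x e : RSpace d) :
    fderiv ℝ (fun y => F (t, y)) x e = dirD (0, e) F (t, x) := by
  have h1 := (hF.differentiable (by simp) (t, x)).hasFDerivAt
  have h2 : HasFDerivAt (fun y => F (t, y)) _ x := h1.comp x (hasFDerivAt_prodMk_right t x)
  rw [h2.fderiv]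
  simp [dirD]

lemma hasDerivAt_slice {F : ℝ × RSpace d → V} (hF : ContDiff ℝ ∞ F) (t : ℝ) (x : RSpace d) :
    HasDerivAt (fun s => F (s, x)) (dirD (timeVec d) F (t, x)) t := by
  have h1 := (hF.differentiable (by simp) (t, x)).hasFDerivAt
  have h2 : HasFDerivAt (fun s => F (s, x)) _ t := h1.comp t (hasFDerivAt_prodMk_left t x)
  simpa [dirD, timeVec] using h2.hasDerivAt

lemma laplacian_slice {F : ℝ × RSpace d → V} (hF : ContDiff ℝ ∞ F) (t : ℝ) (x : RSpace d) :
    Laplacian.laplacian (fun y => F (t, y)) x =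
      ∑ i, dirD (spaceVec i) (dirD (spaceVec i) F) (t, x) := by
  rw [laplacian_eq_sum_fderiv]
  refine Finset.sum_congr rfl fun i _ => ?_
  have hs : ContDiff ℝ ∞ (fun y => F (t, y)) := hF.comp (contDiff_const.prodMk contDiff_id)
  have h1 : DifferentiableAt ℝ (fderiv ℝ (fun y => F (t, y))) x :=
    (hs.fderiv_right (m := ∞) (by simp)).differentiable (by simp) x
  have h2 : fderiv ℝ (fun y => fderiv ℝ (fun y => F (t, y)) y (stdVec i)) x (stdVec i) =
      fderiv ℝ (fderiv ℝ (fun y => F (t, y))) x (stdVec i) (stdVec i) := by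
    rw [fderiv_clm_apply h1 (differentiableAt_const _)]
    simp
  rw [← h2]
  have h3 : (fun y => fderiv ℝ (fun y => F (t, y)) y (stdVec i)) =
      fun y => dirD (spaceVec i) F (t, y) := funext fun y => fderiv_slice hF t y _
  rw [h3, fderiv_slice (contDiff_dirD hF _)]
  rfl

section Field

variable {K : Type} [NormedField K] [NormedAlgebra ℝ K]

lemma dirD_mul {F G : ℝ × RSpace d → K} (hF : ContDiff ℝ ∞ F) (hG : ContDiff ℝ ∞ G)
    (v p : ℝ × RSpace d) :
    dirD v (fun p => F p * G p) p = F p * dirD v G p + G p * dirD v F p := by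
  rw [dirD, fderiv_fun_mul (hF.differentiable (by simp) p) (hG.differentiable (by simp) p)]
  rfl

/-- The second derivative of a function whose logarithmic derivative is `Du`. -/
lemma dirD_dirD_of_log {F u : ℝ × RSpace d → K} (hF : ContDiff ℝ ∞ F) (hu : ContDiff ℝ ∞ u)
    (v : ℝ × RSpace d) (h : ∀ p, dirD v F p = F p * dirD v u p) (p : ℝ × RSpace d) :
    dirD v (dirD v F) p = F p * (dirD v (dirD v u) p + dirD v u p ^ 2) := by
  have e : dirD v F = fun p => F p * dirD v u p := funext h
  rw [e, dirD_mul hF (contDiff_dirD hu v), h]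
  ring

end Field

lemma dirD_cexp {u : ℝ × RSpace d → ℂ} (hu : ContDiff ℝ ∞ u) (v p : ℝ × RSpace d) :
    dirD v (fun p => Complex.exp (u p)) p = Complex.exp (u p) * dirD v u p := by
  have := ((hu.differentiable (by simp) p).hasFDerivAt.cexp).fderiv
  rw [dirD, this]
  rfl

lemma dirD_exp {u : ℝ × RSpace d → ℝ} (hu : ContDiff ℝ ∞ u) (v p : ℝ × RSpace d) :
    dirD v (fun p => Real.exp (u p)) p = Real.exp (u p) * dirD v u p := by
  have := ((hu.differentiable (by simp) p).hasFDerivAt.exp).fderiv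
  rw [dirD, this]
  rfl

/-- The complex function with given real and imaginary parts. -/
noncomputable def complexOf (A Φ : ℝ × RSpace d → ℝ) (p : ℝ × RSpace d) : ℂ :=
  A p + Complex.I * Φ p

lemma contDiff_complexOf {A Φ : ℝ × RSpace d → ℝ} (hA : ContDiff ℝ ∞ A) (hΦ : ContDiff ℝ ∞ Φ) :
    ContDiff ℝ ∞ (complexOf A Φ) :=
  (Complex.ofRealCLM.contDiff.comp hA).add
    (contDiff_const.mul (Complex.ofRealCLM.contDiff.comp hΦ))

lemma dirD_complexOf {A Φ : ℝ × RSpace d → ℝ} (hA : ContDiff ℝ ∞ A) (hΦ : ContDiff ℝ ∞ Φ)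
    (v : ℝ × RSpace d) : dirD v (complexOf A Φ) = complexOf (dirD v A) (dirD v Φ) := by
  ext1 p
  have h1 := Complex.ofRealCLM.hasFDerivAt.comp p (hA.differentiable (by simp) p).hasFDerivAt
  have h2 := Complex.ofRealCLM.hasFDerivAt.comp p (hΦ.differentiable (by simp) p).hasFDerivAt
  have h3 : HasFDerivAt (complexOf A Φ) _ p := h1.add (h2.const_mul Complex.I)
  rw [dirD, h3.fderiv]
  simp [complexOf, dirD]

/-- Nonvanishing smooth functions have local smooth logarithms. -/
lemma exists_local_phase {U : Set (ℝ × RSpace d)} (hU : IsOpen U) {χ : ℝ × RSpace d → ℂ}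
    (hχ : ContDiffOn ℝ ∞ χ U) {p₀ : ℝ × RSpace d} (hp : p₀ ∈ U) (hne : χ p₀ ≠ 0) :
    ∃ A Φ : ℝ × RSpace d → ℝ, ContDiff ℝ ∞ A ∧ ContDiff ℝ ∞ Φ ∧
      ∀ᶠ p in 𝓝 p₀, χ p = Complex.exp (complexOf A Φ p) := by
  have hquot : ContDiffOn ℝ ∞ (fun p => χ p / χ p₀) U := hχ.div_const _
  -- Division by `χ p₀` brings the values near `p₀` close to `1`, away from the cut of the
  -- logarithm.
  set O : Set (ℝ × RSpace d) := U ∩ (fun p => χ p / χ p₀) ⁻¹' Complex.slitPlane with hO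
  have hOo : IsOpen O := hquot.continuousOn.isOpen_inter_preimage hU Complex.isOpen_slitPlane
  have hpO : p₀ ∈ O := ⟨hp, by simp [hne, Complex.one_mem_slitPlane]⟩
  set θ : ℝ × RSpace d → ℂ := fun p => Complex.log (χ p / χ p₀) + Complex.log (χ p₀) with hθ
  have hθO : ∀ p ∈ O, ContDiffAt ℝ ∞ θ p := fun p hp' => by
    have h1 : ContDiffAt ℝ ∞ (fun p => χ p / χ p₀) p := hquot.contDiffAt (hU.mem_nhds hp'.1)
    have h2 : ContDiffAt ℝ ∞ Complex.log (χ p / χ p₀) :=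
      (Complex.contDiffAt_log hp'.2).restrict_scalars ℝ
    exact (h2.comp p h1).add contDiffAt_const
  have hexp : ∀ p ∈ O, Complex.exp (θ p) = χ p := fun p hp' => by
    have h1 : χ p / χ p₀ ≠ 0 := Complex.slitPlane_ne_zero hp'.2
    rw [hθ]
    simp only
    rw [Complex.exp_add, Complex.exp_log h1, Complex.exp_log hne, div_mul_cancel₀ _ hne]
  obtain ⟨ε, hε, hball⟩ := Metric.isOpen_iff.1 hOo p₀ hpO
  -- The cutoff makes the logarithm globally smooth without changing it near `p₀`, so that `A` and
  -- `Φ` can be differentiated without domain conditions.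
  let b : ContDiffBump p₀ := ⟨ε / 4, ε / 2, by positivity, by linarith⟩
  have hsm : ContDiff ℝ ∞ (fun p => b p • θ p) := by
    refine contDiff_iff_contDiffAt.2 fun p => ?_
    by_cases hp' : p ∈ tsupport (fun p => b p • θ p)
    swap
    · exact contDiffAt_const.congr_of_eventuallyEq (notMem_tsupport_iff_eventuallyEq.1 hp')
    have h1 : p ∈ tsupport b := tsupport_smul_subset_left _ _ hp'
    rw [b.tsupport_eq] at h1
    refine b.contDiff.contDiffAt.smul (hθO p (hball ?_))
    exact Metric.closedBall_subset_ball (by simp [b]; linarith) h1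
  refine ⟨fun p => (b p • θ p).re, fun p => (b p • θ p).im, Complex.reCLM.contDiff.comp hsm,
    Complex.imCLM.contDiff.comp hsm, ?_⟩
  filter_upwards [b.eventuallyEq_one, hOo.mem_nhds hpO] with p hb hpO'
  have : complexOf (fun p => (b p • θ p).re) (fun p => (b p • θ p).im) p = θ p := by
    simp only [complexOf, hb, Pi.one_apply, one_smul]
    rw [mul_comm]; exact Complex.re_add_im _
  rw [this, hexp p hpO']

end Madelung

/-! ### The hydrodynamic equations for `exp (A + iΦ)` -/

section MadelungSystem

variable {d : ℕ} {X : Type*}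

lemma eventuallyEq_slice_space {F G : ℝ × RSpace d → X} {t : ℝ} {x : RSpace d}
    (h : F =ᶠ[𝓝 (t, x)] G) : (fun y => F (t, y)) =ᶠ[𝓝 x] fun y => G (t, y) :=
  (Continuous.prodMk_right t).continuousAt.eventually h

lemma eventuallyEq_slice_time {F G : ℝ × RSpace d → X} {t : ℝ} {x : RSpace d}
    (h : F =ᶠ[𝓝 (t, x)] G) : (fun s => F (s, x)) =ᶠ[𝓝 t] fun s => G (s, x) :=
  (Continuous.prodMk_left x).continuousAt.eventually h

/-- The density of `exp (A + iΦ)`. -/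
noncomputable def densityOf (A : ℝ × RSpace d → ℝ) (p : ℝ × RSpace d) : ℝ := Real.exp (2 * A p)

/-- The velocity of `exp (A + iΦ)`. -/
noncomputable def velocityOf (Φ : ℝ × RSpace d → ℝ) (p : ℝ × RSpace d) : RSpace d :=
  WithLp.toLp 2 fun i => 2 * dirD (spaceVec i) Φ p

variable {A Φ : ℝ × RSpace d → ℝ}

lemma contDiff_densityOf (hA : ContDiff ℝ ∞ A) : ContDiff ℝ ∞ (densityOf A) :=
  (contDiff_const.mul hA).exp

lemma contDiff_velocityOf (hΦ : ContDiff ℝ ∞ Φ) : ContDiff ℝ ∞ (velocityOf Φ) :=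
  contDiff_euclidean.2 fun i => contDiff_const.mul (contDiff_dirD hΦ (spaceVec i))

lemma norm_sq_cexp_complexOf (p : ℝ × RSpace d) :
    ‖Complex.exp (complexOf A Φ p)‖ ^ 2 = densityOf A p := by
  rw [Complex.norm_exp, densityOf, ← Real.exp_nat_mul]
  simp [complexOf]

variable {χ : ℝ → RSpace d → ℂ} {t : ℝ} {x : RSpace d}

lemma madelungDensity_eq (h : χ t x = Complex.exp (complexOf A Φ (t, x))) :
    madelungDensity χ t x = densityOf A (t, x) := by
  rw [madelungDensity, h, norm_sq_cexp_complexOf]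

lemma madelungVelocity_eq (hA : ContDiff ℝ ∞ A) (hΦ : ContDiff ℝ ∞ Φ)
    (h : (fun p : ℝ × RSpace d => χ p.1 p.2) =ᶠ[𝓝 (t, x)] fun p => Complex.exp (complexOf A Φ p)) :
    madelungVelocity χ t x = velocityOf Φ (t, x) := by
  have hΘ := contDiff_complexOf hA hΦ
  rw [madelungVelocity, velocityOf]
  congr 1
  ext1 i
  have h1 : fderiv ℝ (χ t) x (stdVec i) =
      Complex.exp (complexOf A Φ (t, x)) * dirD (spaceVec i) (complexOf A Φ) (t, x) := by
    have := (eventuallyEq_slice_space h).fderiv_eq (𝕜 := ℝ)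
    simp only at this
    rw [this, fderiv_slice hΘ.cexp, ← dirD_cexp hΘ]
    rfl
  have h2 : χ t x = Complex.exp (complexOf A Φ (t, x)) := h.self_of_nhds
  have h3 : ‖χ t x‖ ^ 2 ≠ 0 := by
    rw [h2]
    exact pow_ne_zero 2 (norm_ne_zero_iff.2 (Complex.exp_ne_zero _))
  have h4 : conj (χ t x) * fderiv ℝ (χ t) x (stdVec i) =
      ((‖χ t x‖ ^ 2 : ℝ) : ℂ) * dirD (spaceVec i) (complexOf A Φ) (t, x) := by
    rw [h1, ← h2, ← mul_assoc, Complex.conj_mul']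
    push_cast; rfl
  have h5 : (EuclideanSpace.single i 1 : RSpace d) = stdVec i := rfl
  rw [h5, h4, Complex.im_ofReal_mul, dirD_complexOf hA hΦ]
  simp only [complexOf, Complex.add_im, Complex.ofReal_im, Complex.I_mul_im, Complex.ofReal_re,
    zero_add]
  rw [mul_div_assoc, mul_div_cancel_left₀ _ h3]

/-- The real and imaginary parts of the Gross--Pitaevskii equation for `exp (A + iΦ)`. -/
lemma hydrodynamic_of_grossPitaevskii {g : ℝ → ℝ} (hA : ContDiff ℝ ∞ A) (hΦ : ContDiff ℝ ∞ Φ)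
    (h : (fun p : ℝ × RSpace d => χ p.1 p.2) =ᶠ[𝓝 (t, x)] fun p => Complex.exp (complexOf A Φ p))
    (heq : Complex.I * deriv (fun s => χ s x) t + Laplacian.laplacian (χ t) x =
      (g (‖χ t x‖ ^ 2) : ℂ) * χ t x / 2) :
    dirD (timeVec d) A (t, x) + ∑ i, (dirD (spaceVec i) (dirD (spaceVec i) Φ) (t, x) +
        2 * (dirD (spaceVec i) A (t, x) * dirD (spaceVec i) Φ (t, x))) = 0 ∧
      ∑ i, (dirD (spaceVec i) (dirD (spaceVec i) A) (t, x) + dirD (spaceVec i) A (t, x) ^ 2) =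
        dirD (timeVec d) Φ (t, x) + ∑ i, dirD (spaceVec i) Φ (t, x) ^ 2 +
          g (densityOf A (t, x)) / 2 := by
  have hΘ := contDiff_complexOf hA hΦ
  have h1 : deriv (fun s => χ s x) t =
      Complex.exp (complexOf A Φ (t, x)) * dirD (timeVec d) (complexOf A Φ) (t, x) := by
    have := (eventuallyEq_slice_time h).deriv_eq
    simp only at this
    rw [this, (hasDerivAt_slice hΘ.cexp t x).deriv, dirD_cexp hΘ]
  have h2 : Laplacian.laplacian (χ t) x = Complex.exp (complexOf A Φ (t, x)) *
      ∑ i, (dirD (spaceVec i) (dirD (spaceVec i) (complexOf A Φ)) (t, x) +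
        dirD (spaceVec i) (complexOf A Φ) (t, x) ^ 2) := by
    have := InnerProductSpace.laplacian_congr_nhds (eventuallyEq_slice_space h)
    have := this.self_of_nhds
    have e : Laplacian.laplacian (χ t) x = _ := this
    rw [e, laplacian_slice hΘ.cexp, Finset.mul_sum]
    exact Finset.sum_congr rfl fun i _ => dirD_dirD_of_log hΘ.cexp hΘ _ (dirD_cexp hΘ _) _
  have h3 : χ t x = Complex.exp (complexOf A Φ (t, x)) := h.self_of_nhds
  rw [h1, h2, h3, norm_sq_cexp_complexOf] at heq
  have hne := Complex.exp_ne_zero (complexOf A Φ (t, x))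
  -- Division by the nonvanishing exponential leaves an equation for `A + iΦ`. Its imaginary part is
  -- conservation of mass and its real part is the Bernoulli law.
  have heq' : Complex.I * dirD (timeVec d) (complexOf A Φ) (t, x) +
      ∑ i, (dirD (spaceVec i) (dirD (spaceVec i) (complexOf A Φ)) (t, x) +
        dirD (spaceVec i) (complexOf A Φ) (t, x) ^ 2) = (g (densityOf A (t, x)) : ℂ) / 2 := by
    apply mul_left_cancel₀ hne
    linear_combination heq
  have hsum : ∑ i, (dirD (spaceVec i) (dirD (spaceVec i) (complexOf A Φ)) (t, x) +
        dirD (spaceVec i) (complexOf A Φ) (t, x) ^ 2) =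
      complexOf (fun p => ∑ i, (dirD (spaceVec i) (dirD (spaceVec i) A) p +
        dirD (spaceVec i) A p ^ 2) - ∑ i, dirD (spaceVec i) Φ p ^ 2)
        (fun p => ∑ i, (dirD (spaceVec i) (dirD (spaceVec i) Φ) p +
        2 * (dirD (spaceVec i) A p * dirD (spaceVec i) Φ p))) (t, x) := by
    simp only [complexOf]
    rw [← Finset.sum_sub_distrib]
    push_cast
    rw [Finset.mul_sum, ← Finset.sum_add_distrib]
    refine Finset.sum_congr rfl fun i _ => ?_
    rw [dirD_complexOf hA hΦ, dirD_complexOf (contDiff_dirD hA _) (contDiff_dirD hΦ _)]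
    simp only [complexOf]
    linear_combination ((dirD (spaceVec i) Φ (t, x) : ℝ) : ℂ) ^ 2 * Complex.I_sq
  rw [hsum, dirD_complexOf hA hΦ] at heq'
  have e1 := congrArg Complex.re heq'
  have e2 := congrArg Complex.im heq'
  have e3 : (g (densityOf A (t, x)) : ℂ) / 2 = ((g (densityOf A (t, x)) / 2 : ℝ) : ℂ) := by
    push_cast; rfl
  rw [e3] at e1 e2
  simp only [complexOf, Complex.add_re, Complex.add_im, Complex.ofReal_re, Complex.ofReal_im,
    Complex.I_mul_re, Complex.I_mul_im, zero_add, mul_add] at e1 e2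
  constructor
  · simpa [complexOf] using e2
  · linarith

lemma dirD_coord {F : ℝ × RSpace d → RSpace d} (hF : ContDiff ℝ ∞ F) (v p : ℝ × RSpace d)
    (j : Fin d) : (dirD v F p) j = dirD v (fun p => F p j) p := by
  have := ((EuclideanSpace.proj j : RSpace d →L[ℝ] ℝ).hasFDerivAt.comp p
    (hF.differentiable (by simp) p).hasFDerivAt).fderiv
  have e : (fun p => F p j) = (EuclideanSpace.proj j : RSpace d →L[ℝ] ℝ) ∘ F := rfl
  rw [e, dirD, dirD, this]
  rfl

lemma dirD_add {F G : ℝ × RSpace d → ℝ} (hF : ContDiff ℝ ∞ F) (hG : ContDiff ℝ ∞ G)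
    (v p : ℝ × RSpace d) : dirD v (fun p => F p + G p) p = dirD v F p + dirD v G p := by
  rw [dirD, fderiv_fun_add (hF.differentiable (by simp) p) (hG.differentiable (by simp) p)]
  rfl

lemma dirD_sum {ι : Type*} (s : Finset ι) {F : ι → ℝ × RSpace d → ℝ} (hF : ∀ i, ContDiff ℝ ∞ (F i))
    (v p : ℝ × RSpace d) : dirD v (fun p => ∑ i ∈ s, F i p) p = ∑ i ∈ s, dirD v (F i) p := by
  rw [dirD, fderiv_fun_sum fun i _ => (hF i).differentiable (by simp) p]
  simp [dirD]

lemma dirD_const_mul {F : ℝ × RSpace d → ℝ} (hF : ContDiff ℝ ∞ F) (c : ℝ) (v p : ℝ × RSpace d) :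
    dirD v (fun p => c * F p) p = c * dirD v F p := by
  rw [dirD, fderiv_const_mul (hF.differentiable (by simp) p)]
  rfl

lemma dirD_space {F : ℝ × RSpace d → ℝ} (w : RSpace d) (p : ℝ × RSpace d) :
    dirD (0, w) F p = ∑ i, w i * dirD (spaceVec i) F p := by
  have e : ((0, w) : ℝ × RSpace d) = ∑ i, w i • spaceVec i := by
    have : ((0, w) : ℝ × RSpace d) = ContinuousLinearMap.inr ℝ ℝ (RSpace d) w := rfl
    conv_lhs => rw [this, eq_sum_stdVec w]
    simp [spaceVec]
  rw [dirD, e, map_sum]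
  simp [dirD]

lemma gradient_apply (f : RSpace d → ℝ) (x : RSpace d) (j : Fin d) :
    gradient f x j = fderiv ℝ f x (stdVec j) := by
  have h1 : inner ℝ (gradient f x) (stdVec j) = fderiv ℝ f x (stdVec j) := by
    rw [gradient, InnerProductSpace.toDual_symm_apply]
  rw [← h1, stdVec, EuclideanSpace.inner_single_right]
  simp

lemma dirD_densityOf (hA : ContDiff ℝ ∞ A) (v p : ℝ × RSpace d) :
    dirD v (densityOf A) p = densityOf A p * (2 * dirD v A p) := by
  have : densityOf A = fun p => Real.exp (2 * A p) := rfl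
  rw [this, dirD_exp (contDiff_const.mul hA), dirD_const_mul hA]

lemma velocityOf_apply (p : ℝ × RSpace d) (j : Fin d) :
    velocityOf Φ p j = 2 * dirD (spaceVec j) Φ p := rfl

lemma contDiff_comp_densityOf {g : ℝ → ℝ} (hg : ContDiffOn ℝ ∞ g (Ici 0))
    (hA : ContDiff ℝ ∞ A) : ContDiff ℝ ∞ (fun p => g (densityOf A p)) :=
  hg.comp_contDiff (contDiff_densityOf hA) fun _ => (Real.exp_pos _).le

/-- The Madelung transform of a nonvanishing solution of the Gross--Pitaevskii equation is a
solution of the quantum Euler--Korteweg system. -/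
theorem isQuantumEulerSolution_madelung {g : ℝ → ℝ} (hg : ContDiffOn ℝ ∞ g (Ici 0)) {a T : ℝ}
    (ha : a < 0) (hχ : ContDiffOn ℝ ∞ (fun p : ℝ × RSpace d => χ p.1 p.2) (Ioo a T ×ˢ univ))
    (hne : ∀ t ∈ Ioo a T, ∀ x, χ t x ≠ 0)
    (heq : ∀ t ∈ Ioo a T, ∀ x, Complex.I * deriv (fun s => χ s x) t +
      Laplacian.laplacian (χ t) x = (g (‖χ t x‖ ^ 2) : ℂ) * χ t x / 2) :
    IsQuantumEulerSolution g T (madelungDensity χ) (madelungVelocity χ) := by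
  -- The open interval reaches below `0`, so every time of `[0, T[` is interior: local logarithms
  -- exist there, and one-sided time derivatives are ordinary ones.
  have hsub : Ico 0 T ⊆ Ioo a T := fun t ht => ⟨ha.trans_le ht.1, ht.2⟩
  have hU : IsOpen (Ioo a T ×ˢ (univ : Set (RSpace d))) := isOpen_Ioo.prod isOpen_univ
  -- Both equations are local. Near each point `ρ = exp (2A)` and `u = 2∇Φ` with smooth `A` and `Φ`,
  -- and derivatives may be computed on these expressions.
  have hloc : ∀ t ∈ Ico 0 T, ∀ x : RSpace d, ∃ A Φ : ℝ × RSpace d → ℝ, ContDiff ℝ ∞ A ∧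
      ContDiff ℝ ∞ Φ ∧ (∀ᶠ p in 𝓝 (t, x), p.1 ∈ Ioo a T ∧
        (fun p : ℝ × RSpace d => χ p.1 p.2) =ᶠ[𝓝 p] fun p => Complex.exp (complexOf A Φ p)) ∧
      (fun p : ℝ × RSpace d => madelungDensity χ p.1 p.2) =ᶠ[𝓝 (t, x)] densityOf A ∧
      (fun p : ℝ × RSpace d => madelungVelocity χ p.1 p.2) =ᶠ[𝓝 (t, x)] velocityOf Φ := by
    intro t ht x
    have hpU : (t, x) ∈ Ioo a T ×ˢ (univ : Set (RSpace d)) := ⟨hsub ht, mem_univ _⟩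
    obtain ⟨A, Φ, hA, hΦ, h⟩ := exists_local_phase hU hχ hpU (hne t (hsub ht) x)
    refine ⟨A, Φ, hA, hΦ, ?_, ?_, ?_⟩
    · filter_upwards [h.eventually_nhds, hU.mem_nhds hpU] with p hp hp'
      exact ⟨hp'.1, hp⟩
    · filter_upwards [h] with p hp
      exact madelungDensity_eq hp
    · filter_upwards [h.eventually_nhds] with p hp
      exact madelungVelocity_eq hA hΦ hp
  constructor
  · rintro ⟨t, x⟩ ⟨ht, -⟩
    obtain ⟨A, Φ, hA, hΦ, -, hρ, -⟩ := hloc t ht x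
    exact ((contDiff_densityOf hA).contDiffAt.congr_of_eventuallyEq hρ).contDiffWithinAt
  · rintro ⟨t, x⟩ ⟨ht, -⟩
    obtain ⟨A, Φ, hA, hΦ, -, -, hu⟩ := hloc t ht x
    exact ((contDiff_velocityOf hΦ).contDiffAt.congr_of_eventuallyEq hu).contDiffWithinAt
  · intro t ht x
    have := norm_pos_iff.2 (hne t (hsub ht) x)
    rw [madelungDensity]
    positivity
  · intro t ht x
    obtain ⟨A, Φ, hA, hΦ, h, hρ, hu⟩ := hloc t ht x
    obtain ⟨hcont, -⟩ := hydrodynamic_of_grossPitaevskii hA hΦ h.self_of_nhds.2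
      (heq t (hsub ht) x)
    have h1 : derivWithin (fun s => madelungDensity χ s x) (Ico 0 T) t =
        dirD (timeVec d) (densityOf A) (t, x) :=
      ((hasDerivAt_slice (contDiff_densityOf hA) t x).congr_of_eventuallyEq
        (eventuallyEq_slice_time hρ)).hasDerivWithinAt.derivWithin (uniqueDiffOn_Ico 0 T t ht)
    have hM : ContDiff ℝ ∞ (fun p => densityOf A p • velocityOf Φ p) :=
      (contDiff_densityOf hA).smul (contDiff_velocityOf hΦ)
    have h2 : fderiv ℝ (fun y => madelungDensity χ t y • madelungVelocity χ t y) x =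
        fderiv ℝ (fun y => densityOf A (t, y) • velocityOf Φ (t, y)) x :=
      (eventuallyEq_slice_space (hρ.smul hu)).fderiv_eq
    have h3 : ∀ i, fderiv ℝ (fun y => densityOf A (t, y) • velocityOf Φ (t, y)) x (stdVec i) i =
        densityOf A (t, x) * (2 * dirD (spaceVec i) (dirD (spaceVec i) Φ) (t, x)) +
        2 * dirD (spaceVec i) Φ (t, x) * (densityOf A (t, x) * (2 * dirD (spaceVec i) A (t, x))) := by
      intro i
      have e : (fun p => (densityOf A p • velocityOf Φ p) i) =
          fun p => densityOf A p * (2 * dirD (spaceVec i) Φ p) := rfl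
      rw [fderiv_slice hM, dirD_coord hM, e, dirD_mul (contDiff_densityOf hA)
        (contDiff_const.mul (contDiff_dirD hΦ _)), dirD_densityOf hA,
        dirD_const_mul (contDiff_dirD hΦ _)]
      rfl
    have h4 : divergence (fun y => madelungDensity χ t y • madelungVelocity χ t y) x =
        2 * densityOf A (t, x) * ∑ i, (dirD (spaceVec i) (dirD (spaceVec i) Φ) (t, x) +
          2 * (dirD (spaceVec i) A (t, x) * dirD (spaceVec i) Φ (t, x))) := by
      rw [divergence, h2, Finset.mul_sum]
      refine Finset.sum_congr rfl fun i _ => (h3 i).trans ?_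
      ring
    rw [h1, h4, dirD_densityOf hA]
    linear_combination 2 * densityOf A (t, x) * hcont
  · intro t ht x
    obtain ⟨A, Φ, hA, hΦ, h, hρ, hu⟩ := hloc t ht x
    have h1 : derivWithin (fun s => madelungVelocity χ s x) (Ico 0 T) t =
        dirD (timeVec d) (velocityOf Φ) (t, x) :=
      ((hasDerivAt_slice (contDiff_velocityOf hΦ) t x).congr_of_eventuallyEq
        (eventuallyEq_slice_time hu)).hasDerivWithinAt.derivWithin (uniqueDiffOn_Ico 0 T t ht)
    have h2 : fderiv ℝ (madelungVelocity χ t) x (madelungVelocity χ t x) =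
        dirD (0, velocityOf Φ (t, x)) (velocityOf Φ) (t, x) := by
      have e1 : madelungVelocity χ t x = velocityOf Φ (t, x) := hu.self_of_nhds
      have e2 : fderiv ℝ (madelungVelocity χ t) x = fderiv ℝ (fun y => velocityOf Φ (t, y)) x :=
        (eventuallyEq_slice_space hu).fderiv_eq
      rw [e1, e2, fderiv_slice (contDiff_velocityOf hΦ)]
    have hgc := contDiff_comp_densityOf hg hA
    have h3 : fderiv ℝ (fun y => g (madelungDensity χ t y)) x =
        fderiv ℝ (fun y => g (densityOf A (t, y))) x :=
      ((eventuallyEq_slice_space hρ).fun_comp g).fderiv_eq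
    -- By the Bernoulli law `Q` is the quantum pressure `Δ√ρ / √ρ` near the point. Since `u = 2∇Φ`,
    -- the momentum equation is twice the gradient of this identity, by symmetry of second
    -- derivatives.
    set Q : ℝ × RSpace d → ℝ := fun p => dirD (timeVec d) Φ p +
      (∑ i, dirD (spaceVec i) Φ p * dirD (spaceVec i) Φ p) + 2⁻¹ * g (densityOf A p) with hQ
    have hsq : ContDiff ℝ ∞ (fun p => ∑ i, dirD (spaceVec i) Φ p * dirD (spaceVec i) Φ p) :=
      ContDiff.sum fun i _ => (contDiff_dirD hΦ _).mul (contDiff_dirD hΦ _)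
    have hQs : ContDiff ℝ ∞ Q :=
      ((contDiff_dirD hΦ _).add hsq).add (contDiff_const.mul hgc)
    have h4 : fderiv ℝ (fun y => Laplacian.laplacian (fun z => √(madelungDensity χ t z)) y /
        √(madelungDensity χ t y)) x = fderiv ℝ (fun y => Q (t, y)) x := by
      refine EventuallyEq.fderiv_eq ?_
      have h5 := (Continuous.prodMk_right t).continuousAt.eventually (f := fun y => (t, y))
        (h.and hρ.eventually_nhds)
      filter_upwards [h5] with y hy
      obtain ⟨⟨hyt, hy1⟩, hy2⟩ := hy
      obtain ⟨-, hbern⟩ := hydrodynamic_of_grossPitaevskii hA hΦ hy1 (heq t hyt y)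
      have hsqrt : (fun z => √(madelungDensity χ t z)) =ᶠ[𝓝 y] fun z => Real.exp (A (t, z)) := by
        filter_upwards [eventuallyEq_slice_space hy2] with z hz
        rw [hz, densityOf, two_mul, Real.exp_add, Real.sqrt_mul_self (Real.exp_pos _).le]
      have e1 : √(madelungDensity χ t y) = Real.exp (A (t, y)) := hsqrt.self_of_nhds
      have e2 : Laplacian.laplacian (fun z => √(madelungDensity χ t z)) y =
          Laplacian.laplacian (fun z => Real.exp (A (t, z))) y :=
        (InnerProductSpace.laplacian_congr_nhds hsqrt).self_of_nhds
      have e3 : Laplacian.laplacian (fun z => Real.exp (A (t, z))) y = Real.exp (A (t, y)) *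
          ∑ i, (dirD (spaceVec i) (dirD (spaceVec i) A) (t, y) +
            dirD (spaceVec i) A (t, y) ^ 2) := by
        rw [laplacian_slice hA.exp, Finset.mul_sum]
        exact Finset.sum_congr rfl fun i _ => dirD_dirD_of_log hA.exp hA _ (dirD_exp hA _) _
      rw [e1, e2, e3, mul_div_cancel_left₀ _ (Real.exp_ne_zero _), hbern, hQ]
      simp only [pow_two]
      ring
    ext j
    simp only [PiLp.add_apply, PiLp.smul_apply, gradient_apply, smul_eq_mul]
    have hvel := contDiff_velocityOf hΦ
    have ev : (fun p => velocityOf Φ p j) = fun p => 2 * dirD (spaceVec j) Φ p := rfl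
    rw [h1, h2, h3, h4, dirD_coord hvel, dirD_coord hvel, ev, dirD_space, fderiv_slice hgc,
      fderiv_slice hQs, hQ, dirD_add ((contDiff_dirD hΦ _).add hsq) (contDiff_const.mul hgc),
      dirD_add (contDiff_dirD hΦ _) hsq, dirD_const_mul hgc,
      dirD_sum _ fun i => (contDiff_dirD hΦ _).mul (contDiff_dirD hΦ _)]
    simp only [dirD_const_mul (contDiff_dirD hΦ _), velocityOf_apply,
      dirD_mul (contDiff_dirD hΦ _) (contDiff_dirD hΦ _)]
    have c1 : dirD (timeVec d) (dirD (spaceVec j) Φ) (t, x) =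
        dirD (0, stdVec j) (dirD (timeVec d) Φ) (t, x) := dirD_comm hΦ _ _ _
    have c2 : ∑ i, 2 * dirD (spaceVec i) Φ (t, x) *
          (2 * dirD (spaceVec i) (dirD (spaceVec j) Φ) (t, x)) =
        2 * ∑ i, (dirD (spaceVec i) Φ (t, x) * dirD (0, stdVec j) (dirD (spaceVec i) Φ) (t, x) +
          dirD (spaceVec i) Φ (t, x) * dirD (0, stdVec j) (dirD (spaceVec i) Φ) (t, x)) := by
      rw [Finset.mul_sum]
      refine Finset.sum_congr rfl fun i _ => ?_
      have c3 : dirD (spaceVec i) (dirD (spaceVec j) Φ) (t, x) =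
        dirD (0, stdVec j) (dirD (spaceVec i) Φ) (t, x) := dirD_comm hΦ _ _ _
      rw [c3]; ring
    rw [c1, c2]
    ring

end MadelungSystem

/-! ### Blow-up at the vacuum point -/

section BlowUp

variable {d : ℕ}

/-- By continuity, the set where `f` exceeds its essential supremum is open; it is null, hence
empty. -/
lemma enorm_le_eLpNorm_top {F : Type*} [NormedAddCommGroup F] {f : RSpace d → F}
    (hf : Continuous f) (x : RSpace d) : ‖f x‖ₑ ≤ eLpNorm f ⊤ volume := by
  rw [eLpNorm_exponent_top]
  by_contra! hlt
  have hO : IsOpen {y | eLpNormEssSup f volume < ‖f y‖ₑ} :=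
    isOpen_lt continuous_const hf.enorm
  have h0 : volume {y | eLpNormEssSup f volume < ‖f y‖ₑ} = 0 := by
    have := enorm_ae_le_eLpNormEssSup f (volume : Measure (RSpace d))
    rw [ae_iff] at this
    simpa using this
  have := hO.eq_empty_of_measure_zero h0
  have hx : x ∈ {y | eLpNormEssSup f volume < ‖f y‖ₑ} := hlt
  rw [this] at hx
  exact hx

lemma lintegral_eq_top_of_inv_le {T δ c : ℝ} (hδ : 0 < δ) (hδT : δ ≤ T) (hc : 0 < c)
    {F : ℝ → ENNReal} (hF : ∀ t ∈ Ico (T - δ) T, ENNReal.ofReal (c / (T - t)) ≤ F t) :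
    ∫⁻ t in Ico 0 T, F t = ⊤ := by
  have h1 : ¬ IntervalIntegrable (fun t => (t - T)⁻¹) volume (T - δ) T := by
    rw [intervalIntegrable_sub_inv_iff]
    rintro (h | h)
    · linarith
    · exact h right_mem_uIcc
  have h2 : ¬ IntegrableOn (fun t => c / (T - t)) (Ico (T - δ) T) volume := by
    intro h
    apply h1
    rw [intervalIntegrable_iff_integrableOn_Ico_of_le (by linarith)]
    have h3 : IntegrableOn (fun t => (-c⁻¹) * (c / (T - t))) (Ico (T - δ) T) volume :=
      Integrable.const_mul h _
    refine h3.congr_fun (fun t ht => ?_) measurableSet_Ico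
    have h4 : T - t ≠ 0 := by linarith [ht.2]
    have h5 : t - T ≠ 0 := by linarith [ht.2]
    field_simp
    ring
  have h3 : ∫⁻ t in Ico (T - δ) T, ENNReal.ofReal (c / (T - t)) = ⊤ := by
    by_contra hne
    apply h2
    have hm : Measurable (fun t => c / (T - t)) := measurable_const.div (measurable_const.sub
      measurable_id)
    refine ⟨hm.aestronglyMeasurable, ?_⟩
    rw [hasFiniteIntegral_iff_ofReal]
    · exact lt_top_iff_ne_top.2 hne
    · refine (ae_restrict_mem measurableSet_Ico).mono fun t ht => ?_
      exact div_nonneg hc.le (by linarith [ht.2])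
  refine top_le_iff.1 ?_
  rw [← h3]
  exact (setLIntegral_mono' measurableSet_Ico hF).trans
    (lintegral_mono_set (Ico_subset_Ico_left (by linarith)))

lemma IsQuantumEulerSolution.contDiff_density {g : ℝ → ℝ} {T : ℝ} {ρ : ℝ → RSpace d → ℝ}
    {u : ℝ → RSpace d → RSpace d} (h : IsQuantumEulerSolution g T ρ u) {t : ℝ}
    (ht : t ∈ Ico 0 T) : ContDiff ℝ ∞ (ρ t) :=
  h.smooth_density.comp_contDiff (contDiff_const.prodMk contDiff_id) fun _ => ⟨ht, mem_univ _⟩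

lemma IsQuantumEulerSolution.contDiff_velocity {g : ℝ → ℝ} {T : ℝ} {ρ : ℝ → RSpace d → ℝ}
    {u : ℝ → RSpace d → RSpace d} (h : IsQuantumEulerSolution g T ρ u) {t : ℝ}
    (ht : t ∈ Ico 0 T) : ContDiff ℝ ∞ (u t) :=
  h.smooth_velocity.comp_contDiff (contDiff_const.prodMk contDiff_id) fun _ => ⟨ht, mem_univ _⟩

/-- Conservation of mass reads `∂ₜρ = -ρ div u - u · ∇ρ`. It is the only equation of the system used
for the blow-up. -/
lemma IsQuantumEulerSolution.abs_derivWithin_le {g : ℝ → ℝ} {T : ℝ} {ρ : ℝ → RSpace d → ℝ}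
    {u : ℝ → RSpace d → RSpace d} (h : IsQuantumEulerSolution g T ρ u) {t : ℝ}
    (ht : t ∈ Ico 0 T) (x : RSpace d) : |derivWithin (fun s => ρ s x) (Ico 0 T) t| ≤
      d * (ρ t x * ‖fderiv ℝ (u t) x‖) + ‖fderiv ℝ (ρ t) x‖ * ‖u t x‖ := by
  have hρ := h.contDiff_density ht
  have hu := h.contDiff_velocity ht
  have h1 : divergence (fun y => ρ t y • u t y) x =
      ∑ i, ρ t x * fderiv ℝ (u t) x (stdVec i) i + fderiv ℝ (ρ t) x (u t x) := by
    have e := eq_sum_stdVec (u t x)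
    conv_rhs => rw [e, map_sum]
    rw [divergence, ← Finset.sum_add_distrib]
    refine Finset.sum_congr rfl fun i _ => ?_
    rw [fderiv_fun_smul (hρ.differentiable (by simp) x) (hu.differentiable (by simp) x)]
    simp [stdVec, mul_comm]
  have h2 := h.mass t ht x
  rw [eq_neg_of_add_eq_zero_left h2, abs_neg, h1]
  refine (abs_add_le _ _).trans (add_le_add ?_ ?_)
  · refine (Finset.abs_sum_le_sum_abs _ _).trans ?_
    calc ∑ i : Fin d, |ρ t x * fderiv ℝ (u t) x (stdVec i) i|
        ≤ ∑ i : Fin d, ρ t x * ‖fderiv ℝ (u t) x‖ := by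
          refine Finset.sum_le_sum fun i _ => ?_
          rw [abs_mul, abs_of_pos (h.pos t ht x)]
          refine mul_le_mul_of_nonneg_left ?_ (h.pos t ht x).le
          refine (abs_coord_le _ _).trans ?_
          have := (fderiv ℝ (u t) x).le_opNorm (stdVec i)
          rwa [norm_stdVec, mul_one] at this
      _ = _ := by simp
  · exact (fderiv ℝ (ρ t) x).le_opNorm (u t x)

variable {g : ℝ → ℝ} {ψ₀ : RSpace d → ℝ} {T : ℝ} {W : ℝ → RSpace d → ℂ}

lemma IsProfile.fderiv_zero (hψ : IsVacuumDatum ψ₀) (h : IsProfile g ψ₀ T W) :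
    fderiv ℝ (W 0) 0 = 0 := by
  have h2 : W 0 = fun x => Complex.ofRealCLM (ψ₀ x) + (-1) := funext fun x => by
    have := h.init x
    simp only [Complex.ofRealCLM_apply]
    linear_combination this
  have h3 := (Complex.ofRealCLM.hasFDerivAt.comp (0 : RSpace d)
      (hψ.contDiff.differentiable (by simp) 0).hasFDerivAt)
  rw [hψ.fderiv_zero, ContinuousLinearMap.comp_zero] at h3
  rw [h2, fderiv_add_const]
  exact h3.fderiv

/-- Estimates on the wave function at the vacuum point. -/
lemma IsProfile.exists_origin_bounds (hg : ContDiffOn ℝ ∞ g (Ici 0)) (hψ : IsVacuumDatum ψ₀)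
    (h : IsProfile g ψ₀ T W) : ∃ δ, 0 < δ ∧ δ ≤ T ∧ ∃ c, 0 < c ∧ ∃ C, 0 ≤ C ∧ ∀ s ∈ Icc 0 δ,
      c * s ≤ inner ℝ (1 + W s 0) (profileDeriv g W s 0) ∧ ‖1 + W s 0‖ ≤ C * s ∧
      ‖fderiv ℝ (W s) 0‖ ≤ C * s := by
  set κ : ℝ := Laplacian.laplacian ψ₀ 0 with hκ
  have hκ0 : 0 < |κ| := abs_pos.mpr hψ.laplacian_ne
  obtain ⟨r, hr, T₁, hT₁, hT₁T, H⟩ := h.exists_approx hg hψ (show 0 < |κ| / 4 by positivity)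
  obtain ⟨C, hC0, hC⟩ := h.lip 1
  refine ⟨T₁, hT₁, hT₁T, |κ| ^ 2 / 4, by positivity, 2 * |κ| + C, by positivity, fun s hs => ?_⟩
  obtain ⟨h1, h2⟩ := H s hs 0 (by simpa using hr.le)
  rw [← hκ] at h1 h2
  rw [hψ.zero, Complex.ofReal_zero, sub_zero] at h2
  set v := 1 + W s 0
  set v' := profileDeriv g W s 0
  have hk : ‖Complex.I * (κ : ℂ)‖ = |κ| := by simp
  have hks : ‖Complex.I * (κ : ℂ) * s‖ = |κ| * s := by
    rw [norm_mul, hk, Complex.norm_real, Real.norm_of_nonneg hs.1]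
  refine ⟨?_, ?_, ?_⟩
  -- The main term is `|κ|² s`. With relative errors `1/4` in `v` and in `v'`, the three other terms
  -- cost at most `1/4 + 1/4 + 1/16` of it, so more than `|κ|² s / 4` remains.
  · have e : inner ℝ v v' = inner ℝ (Complex.I * (κ : ℂ) * s) (Complex.I * (κ : ℂ)) +
        inner ℝ (Complex.I * (κ : ℂ) * s) (v' - Complex.I * (κ : ℂ)) +
        inner ℝ (v - Complex.I * (κ : ℂ) * s) (Complex.I * (κ : ℂ)) +
        inner ℝ (v - Complex.I * (κ : ℂ) * s) (v' - Complex.I * (κ : ℂ)) := by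
      rw [← inner_add_right, add_assoc, ← inner_add_right, ← inner_add_left]
      congr 1 <;> ring
    have e1 : inner ℝ (Complex.I * (κ : ℂ) * s) (Complex.I * (κ : ℂ)) = |κ| ^ 2 * s := by
      rw [Complex.inner, sq_abs]
      simp
      ring
    have b1 := (abs_le.1 ((abs_real_inner_le_norm (Complex.I * (κ : ℂ) * s)
      (v' - Complex.I * (κ : ℂ))).trans (mul_le_mul_of_nonneg_left h1 (norm_nonneg _)))).1
    have b2 := (abs_le.1 ((abs_real_inner_le_norm (v - Complex.I * (κ : ℂ) * s)
      (Complex.I * (κ : ℂ))).trans (mul_le_mul_of_nonneg_right h2 (norm_nonneg _)))).1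
    have b3 := (abs_le.1 ((abs_real_inner_le_norm (v - Complex.I * (κ : ℂ) * s)
      (v' - Complex.I * (κ : ℂ))).trans (mul_le_mul h2 h1 (norm_nonneg _)
        (mul_nonneg (by positivity) hs.1)))).1
    rw [hks] at b1
    rw [hk] at b2
    rw [e, e1]
    have : 0 ≤ |κ| ^ 2 * s := mul_nonneg (by positivity) hs.1
    nlinarith
  · have := norm_le_norm_add_norm_sub' v (Complex.I * (κ : ℂ) * s)
    rw [hks] at this
    have h3 := mul_nonneg hC0 hs.1
    have h4 := mul_nonneg hκ0.le hs.1
    nlinarith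
  · have := norm_fderiv_sub_le_of_lip (hC 0 ⟨le_rfl, h.time_pos.le⟩ s ⟨hs.1, hs.2.trans hT₁T⟩ 0)
    rw [h.fderiv_zero hψ, sub_zero, sub_zero, abs_of_nonneg hs.1] at this
    have h4 := mul_nonneg hκ0.le hs.1
    nlinarith

/-- The time reversed wave function. -/
noncomputable def revWave (g : ℝ → ℝ) (W : ℝ → RSpace d → ℂ) (τ : ℝ) (t : ℝ) (x : RSpace d) : ℂ :=
  conj (wave g W (τ - t) x)

lemma madelungDensity_revWave (τ t : ℝ) (x : RSpace d) :
    madelungDensity (revWave g W τ) t x = ‖1 + W (τ - t) x‖ ^ 2 := by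
  rw [madelungDensity, revWave, Complex.norm_conj, norm_wave]

/-- At the origin, at distance `s` from the vacuum time, `1 + W` and `∇W` are `O(s)`, so `ρ` and
`∇ρ` are `O(s²)`, while `|∂ₜρ| ≥ 2cs`. Conservation of mass then forces `|u| + |∇u|` to be at least
a constant over `s`. -/
lemma IsProfile.blow_up (hg : ContDiffOn ℝ ∞ g (Ici 0)) (hψ : IsVacuumDatum ψ₀)
    (h : IsProfile g ψ₀ T W) {τ : ℝ} (hτ : 0 < τ) (hτT : τ ≤ T)
    (hE : IsQuantumEulerSolution g τ (madelungDensity (revWave g W τ))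
      (madelungVelocity (revWave g W τ))) :
    ∫⁻ t in Ico 0 τ, (eLpNorm (madelungVelocity (revWave g W τ) t) ⊤ volume +
      eLpNorm (fderiv ℝ (madelungVelocity (revWave g W τ) t)) ⊤ volume) = ⊤ := by
  obtain ⟨δ, hδ, hδT, c, hc, C, hC0, H⟩ := h.exists_origin_bounds hg hψ
  have hτm : min δ τ ≤ τ := min_le_right _ _
  -- The first term comes from `ρ div u`, the second from `u · ∇ρ`; the `1` only makes `M` positive.
  set M : ℝ := d * C ^ 2 + 2 * C ^ 2 + 1 with hM
  have hM0 : 0 < M := by positivity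
  refine lintegral_eq_top_of_inv_le (δ := min δ τ) (c := 2 * c / M) (lt_min hδ hτ) hτm
    (by positivity) fun t ht => ?_
  have ht0 : t ∈ Ico 0 τ := ⟨by linarith [ht.1], ht.2⟩
  set s := τ - t with hs
  have hs0 : 0 < s := by linarith [ht.2]
  have hsδ : s ∈ Icc 0 δ := ⟨hs0.le, by linarith [ht.1, min_le_left δ τ]⟩
  have hsT : s ∈ Icc 0 T := ⟨hs0.le, hsδ.2.trans hδT⟩
  obtain ⟨b1, b2, b3⟩ := H s hsδ
  set u := madelungVelocity (revWave g W τ) t with hu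
  have hkey := hE.abs_derivWithin_le ht0 0
  have hder : derivWithin (fun s => madelungDensity (revWave g W τ) s 0) (Ico 0 τ) t =
      -(2 * inner ℝ (1 + W s 0) (profileDeriv g W s 0)) := by
    have h1 : HasDerivWithinAt (fun r => W (τ - r) 0) (-profileDeriv g W s 0) (Ico 0 τ) t := by
      have := HasDerivWithinAt.scomp t (h := fun r : ℝ => τ - r) (h' := -1) (s := Ico 0 τ)
        (h.hasDeriv s hsT 0) ((hasDerivAt_id t).const_sub τ).hasDerivWithinAt
        fun r hr => ⟨by linarith [hr.2], by linarith [hr.1]⟩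
      simpa [Function.comp_def, profileDeriv] using this
    have h2 := ((h1.const_add 1).norm_sq).derivWithin (uniqueDiffOn_Ico 0 τ t ht0)
    simp only [madelungDensity_revWave]
    rw [h2, inner_neg_right]
    ring
  have hdρ : ‖fderiv ℝ (madelungDensity (revWave g W τ) t) 0‖ ≤
      2 * (‖1 + W s 0‖ * ‖fderiv ℝ (W s) 0‖) := by
    have e : madelungDensity (revWave g W τ) t = fun y => ‖1 + W s y‖ ^ 2 :=
      funext fun y => madelungDensity_revWave τ t y
    have h1 := (((h.contDiff hsT).differentiable (by simp) 0).hasFDerivAt.const_add 1).norm_sq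
    rw [e, h1.fderiv]
    refine ContinuousLinearMap.opNorm_le_bound _ (by positivity) fun y => ?_
    have h2 := (norm_inner_le_norm (𝕜 := ℝ) (1 + W s 0) (fderiv ℝ (W s) 0 y)).trans
      (mul_le_mul_of_nonneg_left ((fderiv ℝ (W s) 0).le_opNorm y) (norm_nonneg _))
    rw [smul_apply, ContinuousLinearMap.comp_apply, innerSL_apply_apply,
      nsmul_eq_mul, norm_mul, Nat.cast_ofNat, Real.norm_ofNat]
    linarith
  have hineq : 2 * c * s ≤ s ^ 2 * M * (‖u 0‖ + ‖fderiv ℝ u 0‖) := by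
    rw [hder, abs_neg, madelungDensity_revWave] at hkey
    have h1 := (le_abs_self _).trans hkey
    have hU := norm_nonneg (u 0)
    have hDU := norm_nonneg (fderiv ℝ u 0)
    have hv := norm_nonneg (1 + W s 0)
    have h2 : ‖1 + W s 0‖ ^ 2 ≤ C ^ 2 * s ^ 2 := by
      rw [← mul_pow]
      exact pow_le_pow_left₀ hv b2 2
    have h3 : (d : ℝ) * (‖1 + W s 0‖ ^ 2 * ‖fderiv ℝ u 0‖) ≤
        d * (C ^ 2 * s ^ 2 * ‖fderiv ℝ u 0‖) :=
      mul_le_mul_of_nonneg_left (mul_le_mul_of_nonneg_right h2 hDU) (Nat.cast_nonneg d)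
    have h4 : ‖1 + W s 0‖ * ‖fderiv ℝ (W s) 0‖ ≤ (C * s) * (C * s) :=
      mul_le_mul b2 b3 (norm_nonneg _) (mul_nonneg hC0 hs0.le)
    have h5 : ‖fderiv ℝ (madelungDensity (revWave g W τ) t) 0‖ * ‖u 0‖ ≤
        2 * ((C * s) * (C * s)) * ‖u 0‖ :=
      mul_le_mul_of_nonneg_right (hdρ.trans (by linarith)) hU
    have h6 : 2 * c * s ≤ d * (C ^ 2 * s ^ 2 * ‖fderiv ℝ u 0‖) +
        2 * ((C * s) * (C * s)) * ‖u 0‖ := by linarith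
    refine h6.trans ?_
    rw [hM]
    have p1 : 0 ≤ (d : ℝ) * C ^ 2 * s ^ 2 * ‖u 0‖ := by positivity
    have p2 : 0 ≤ 2 * C ^ 2 * s ^ 2 * ‖fderiv ℝ u 0‖ := by positivity
    have p3 : 0 ≤ s ^ 2 * (‖u 0‖ + ‖fderiv ℝ u 0‖) := by positivity
    linarith
  have hlow : 2 * c / M / s ≤ ‖u 0‖ + ‖fderiv ℝ u 0‖ := by
    rw [div_div, div_le_iff₀ (by positivity)]
    have : s * (2 * c) ≤ s * ((‖u 0‖ + ‖fderiv ℝ u 0‖) * (M * s)) := by linarith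
    exact le_of_mul_le_mul_left this hs0
  have hus := hE.contDiff_velocity ht0
  calc ENNReal.ofReal (2 * c / M / s) ≤ ENNReal.ofReal (‖u 0‖ + ‖fderiv ℝ u 0‖) :=
        ENNReal.ofReal_le_ofReal hlow
    _ = ‖u 0‖ₑ + ‖fderiv ℝ u 0‖ₑ := by
        rw [ENNReal.ofReal_add (norm_nonneg _) (norm_nonneg _), ofReal_norm, ofReal_norm]
    _ ≤ _ := add_le_add (enorm_le_eLpNorm_top hus.continuous 0)
        (enorm_le_eLpNorm_top (hus.continuous_fderiv (by simp)) 0)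

end BlowUp

/-! ### Sobolev regularity of the density and the velocity -/

section HydrodynamicSobolev

variable {d : ℕ} {g : ℝ → ℝ} {ψ₀ : RSpace d → ℝ} {T τ : ℝ} {W : ℝ → RSpace d → ℂ}

/-- A smooth function which coincides with `1 / (1 + z)` away from `-1`. -/
lemma exists_smooth_inv {c : ℝ} (hc : 0 < c) : ∃ m : ℂ → ℂ, ContDiff ℝ ∞ m ∧
    ∀ z, c ≤ ‖1 + z‖ → m z = (1 + z)⁻¹ := by
  let b : ContDiffBump (-1 : ℂ) := ⟨c / 4, c / 2, by positivity, by linarith⟩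
  refine ⟨fun z => (1 - b z) • (1 + z)⁻¹, contDiff_iff_contDiffAt.2 fun z => ?_, fun z hz => ?_⟩
  · by_cases hz : z = -1
    · subst hz
      refine (contDiffAt_const (c := (0 : ℂ))).congr_of_eventuallyEq ?_
      filter_upwards [b.eventuallyEq_one] with y hy
      rw [hy]; simp
    · have h1 : 1 + z ≠ 0 := fun h0 => hz (by linear_combination h0)
      exact (contDiffAt_const.sub b.contDiff.contDiffAt).smul
        ((contDiffAt_const.add contDiffAt_id).inv h1)
  · have : b z = 0 := b.zero_of_le_dist (by
      rw [dist_eq_norm, sub_neg_eq_add, add_comm z 1]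
      simp only [b]
      linarith)
    simp [this]

/-- The far field phase cancels and conjugation changes the sign. The velocity thus depends only on
`(W, ∇W)`, through an expression singular only at the vacuum, which prepares the superposition
theorem. -/
lemma madelungVelocity_revWave_apply {t : ℝ} {x : RSpace d}
    (hW : DifferentiableAt ℝ (W (τ - t)) x) (hne : 1 + W (τ - t) x ≠ 0) (i : Fin d) :
    madelungVelocity (revWave g W τ) t x i =
      -(2 * ((1 + W (τ - t) x)⁻¹ * fderiv ℝ (W (τ - t)) x (stdVec i)).im) := by
  set s := τ - t
  have h1 : HasFDerivAt (revWave g W τ t) _ x :=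
    Complex.conjCLE.toContinuousLinearMap.hasFDerivAt.comp x
      ((hW.hasFDerivAt.const_add 1).const_mul (farField g s))
  have h2 : fderiv ℝ (revWave g W τ t) x (stdVec i) =
      conj (farField g s * fderiv ℝ (W s) x (stdVec i)) := by
    rw [h1.fderiv]; rfl
  have h3 : revWave g W τ t x = conj (farField g s * (1 + W s x)) := rfl
  have hf : conj (farField g s) * farField g s = 1 := by
    rw [Complex.conj_mul', norm_farField]; simp
  have hn : ((‖1 + W s x‖ ^ 2 : ℝ) : ℂ) = conj (1 + W s x) * (1 + W s x) := by
    rw [Complex.conj_mul']; push_cast; rfl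
  have hn0 : ‖1 + W s x‖ ^ 2 ≠ 0 := pow_ne_zero 2 (norm_ne_zero_iff.2 hne)
  have h4 : conj (revWave g W τ t x) * fderiv ℝ (revWave g W τ t) x (stdVec i) =
      ((‖1 + W s x‖ ^ 2 : ℝ) : ℂ) * conj ((1 + W s x)⁻¹ * fderiv ℝ (W s) x (stdVec i)) := by
    have hc : conj (1 + W s x) ≠ 0 := (map_ne_zero _).2 hne
    rw [h2, h3, hn, Complex.conj_conj, map_mul, map_mul, map_inv₀]
    field_simp
    linear_combination conj (fderiv ℝ (W s) x (stdVec i)) * hf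
  have h5 : ‖revWave g W τ t x‖ = ‖1 + W s x‖ := by
    rw [revWave, Complex.norm_conj, norm_wave]
  have h6 : (EuclideanSpace.single i 1 : RSpace d) = stdVec i := rfl
  simp only [madelungVelocity]
  rw [h6, h4, h5, Complex.im_ofReal_mul, Complex.conj_im]
  field_simp

lemma IsProfile.continuousInSobolev_density (h : IsProfile g ψ₀ T W) (hτT : τ ≤ T) :
    ContinuousInSobolev (Ico 0 τ) (fun t x => madelungDensity (revWave g W τ) t x - 1) := by
  have hB := h.sobolevBounded (I := Ico 0 τ) (σ := fun t => τ - t)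
    (fun t ht => ⟨by linarith [ht.2], by linarith [ht.1]⟩)
    fun s t => by rw [sub_sub_sub_cancel_left, abs_sub_comm]
  simp only [madelungDensity_revWave]
  exact hB.comp (F := fun z : ℂ => ‖1 + z‖ ^ 2 - 1)
    (((contDiff_norm_sq ℝ).comp (contDiff_const.add contDiff_id)).sub contDiff_const) (by simp)

/-- Continuity at `t` only concerns `[0, r]` with `t < r < τ`, where the reversed wave stays at a
positive distance from the vacuum. There the inverse can be replaced by a globally smooth `m`, and
the velocity is a smooth function of `(W, ∇W)` vanishing at `0`. -/
lemma IsProfile.continuousInSobolev_velocity (h : IsProfile g ψ₀ T W) (hτT : τ ≤ T)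
    (hpos : ∀ ε, 0 < ε → ∃ c : ℝ, 0 < c ∧ ∀ t ∈ Icc ε T, ∀ x, c ≤ ‖1 + W t x‖) :
    ContinuousInSobolev (Ico 0 τ) (madelungVelocity (revWave g W τ)) := by
  intro t ht
  set r := (t + τ) / 2 with hr
  have hrt : t < r := by linarith [ht.2]
  have hrτ : r < τ := by linarith [ht.2]
  have hm : ∀ s ∈ Icc 0 r, τ - s ∈ Icc 0 T := fun s hs =>
    ⟨by linarith [hs.2], by linarith [hs.1]⟩
  have hB := h.sobolevBounded (I := Icc 0 r) (σ := fun t => τ - t) hm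
    fun s t => by rw [sub_sub_sub_cancel_left, abs_sub_comm]
  obtain ⟨c, hc, hcW⟩ := hpos (τ - r) (by linarith)
  obtain ⟨m, hmC, hmE⟩ := exists_smooth_inv hc
  set F : ℂ × (RSpace d →L[ℝ] ℂ) → RSpace d := fun q =>
    WithLp.toLp 2 fun i => -(2 * (m q.1 * q.2 (stdVec i)).im) with hF
  have hFs : ContDiff ℝ ∞ F := by
    refine contDiff_euclidean.2 fun i => ?_
    have h1 : ContDiff ℝ ∞ (fun q : ℂ × (RSpace d →L[ℝ] ℂ) => m q.1 * q.2 (stdVec i)) :=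
      (hmC.comp contDiff_fst).mul (contDiff_snd.clm_apply contDiff_const)
    exact (contDiff_const.mul (Complex.imCLM.contDiff.comp h1)).neg
  have hF0 : F 0 = 0 := by
    ext i; simp [hF]
  have hS := (hB.prodMk hB.fderiv).comp hFs hF0
  have he : ∀ s ∈ Icc 0 r, madelungVelocity (revWave g W τ) s =
      fun x => F (W (τ - s) x, fderiv ℝ (W (τ - s)) x) := by
    intro s hs
    ext1 x
    ext i
    have hl := hcW (τ - s) ⟨by linarith [hs.2], (hm s hs).2⟩ x
    rw [madelungVelocity_revWave_apply ((h.contDiff (hm s hs)).differentiable (by simp) x)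
      (norm_pos_iff.1 (hc.trans_le hl))]
    simp only [hF]
    rw [hmE _ hl]
  have htI : t ∈ Icc 0 r := ⟨ht.1, hrt.le⟩
  have hle : 𝓝[Ico 0 τ] t ≤ 𝓝[Icc 0 r] t := by
    refine nhdsWithin_le_of_mem ?_
    have : Iio r ∈ 𝓝[Ico 0 τ] t := mem_nhdsWithin_of_mem_nhds (Iio_mem_nhds hrt)
    filter_upwards [this, self_mem_nhdsWithin] with s hs hs'
    exact ⟨hs'.1, hs.le⟩
  refine ⟨?_, fun k => ⟨?_, ?_⟩⟩
  · rw [he t htI]; exact (hS t htI).1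
  · rw [he t htI]; exact ((hS t htI).2 k).1
  · have := ((hS t htI).2 k).2.mono_left hle
    refine this.congr' ?_
    filter_upwards [hle self_mem_nhdsWithin] with s hs
    rw [he t htI, he s hs]

end HydrodynamicSobolev

/-! ### Main results -/

section Main

variable {d : ℕ} {g : ℝ → ℝ} {ψ₀ : RSpace d → ℝ} {T τ : ℝ} {W : ℝ → RSpace d → ℂ}

/-- The strict inequality `τ < T` leaves a margin: the reversed wave is a time shift of the one
reversed at `T`, hence is defined on `]τ - T, τ[`, which contains `0` in its interior. -/
lemma IsProfile.isQuantumEulerSolution (hg : ContDiffOn ℝ ∞ g (Ici 0)) (h : IsProfile g ψ₀ T W)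
    (hτT : τ < T) (hpos : ∀ t ∈ Ioc 0 T, ∀ x, 1 + W t x ≠ 0) :
    IsQuantumEulerSolution g τ (madelungDensity (revWave g W τ))
      (madelungVelocity (revWave g W τ)) := by
  have hrev := h.isSmoothGPSolution.reverse h.time_pos
  have hshift : ∀ t x, revWave g W τ t x = conj (wave g W (T - (t + (T - τ))) x) := fun t x => by
    rw [revWave, show τ - t = T - (t + (T - τ)) by ring]
  have hmem : ∀ t ∈ Ioo (τ - T) τ, t + (T - τ) ∈ Ioo 0 T := fun t ht =>
    ⟨by linarith [ht.1], by linarith [ht.2]⟩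
  refine isQuantumEulerSolution_madelung hg (a := τ - T) (by linarith) ?_ ?_ ?_
  · have h1 : ContDiff ℝ ∞ (fun p : ℝ × RSpace d => (p.1 + (T - τ), p.2)) :=
      (contDiff_fst.add contDiff_const).prodMk contDiff_snd
    refine (hrev.smooth.comp h1.contDiffOn fun p hp => ?_).congr fun p hp => hshift p.1 p.2
    exact ⟨Ioo_subset_Icc_self (hmem _ hp.1), mem_univ _⟩
  · intro t ht x
    rw [← norm_pos_iff, revWave, Complex.norm_conj, norm_wave, norm_pos_iff]
    exact hpos _ ⟨by linarith [ht.2], by linarith [ht.1]⟩ x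
  · intro t ht x
    have h1 := hrev.equation _ (Ioo_subset_Icc_self (hmem t ht)) x
    rw [derivWithin_of_mem_nhds (Icc_mem_nhds (hmem t ht).1 (hmem t ht).2)] at h1
    have h2 : deriv (fun s => revWave g W τ s x) t =
        deriv (fun s => conj (wave g W (T - s) x)) (t + (T - τ)) := by
      simp only [hshift]
      exact deriv_comp_add_const (fun s => conj (wave g W (T - s) x)) (T - τ) t
    have h3 : revWave g W τ t = fun x => conj (wave g W (T - (t + (T - τ))) x) := funext (hshift t)
    rw [h2, h3]
    exact h1

theorem exists_blow_up_of_isVacuumDatum (hg : ContDiffOn ℝ ∞ g (Ici 0))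
    (hψ : IsVacuumDatum ψ₀) : ∃ T : ℝ, 0 < T ∧ ∃ ψ : ℝ → RSpace d → ℂ,
        IsSmoothGPSolution g T ψ ∧
        ContinuousInSobolev (Icc 0 T) (fun t x => ψ t x - farField g t) ∧
        (∀ x, ψ 0 x = (ψ₀ x : ℂ)) ∧
        (∀ t ∈ Ioc 0 T, ∀ x, 0 < ‖ψ t x‖) ∧
        IsSmoothGPSolution g T (fun t x => conj (ψ (T - t) x)) ∧
        IsBlowUpSolution g T 0
          (madelungDensity (fun t x => conj (ψ (T - t) x)))
          (madelungVelocity (fun t x => conj (ψ (T - t) x))) := by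
  obtain ⟨T₀, W, hW₀⟩ := exists_isProfile hg hψ
  obtain ⟨T₁, hT₁, hT₁₀, hpos⟩ := hW₀.exists_pos hg hψ
  have hW := hW₀.mono hT₁ hT₁₀
  -- Half of the available time is kept in reserve, so that the reversed wave extends to negative
  -- times.
  set T := T₁ / 2 with hT
  have hT0 : 0 < T := by positivity
  have hTT : T < T₁ := by linarith
  have hWT := hW.mono hT0 hTT.le
  have hne : ∀ t ∈ Ioc 0 T₁, ∀ x, 0 < ‖1 + W t x‖ := fun t ht x => by
    obtain ⟨c, hc, hcW⟩ := hpos t ht.1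
    exact hc.trans_le (hcW t ⟨le_rfl, ht.2⟩ x)
  have hE := hW.isQuantumEulerSolution hg hTT fun t ht x => norm_pos_iff.1 (hne t ht x)
  refine ⟨T, hT0, wave g W, hWT.isSmoothGPSolution, hWT.continuousInSobolev_wave, fun x => ?_,
    fun t ht x => ?_, hWT.isSmoothGPSolution.reverse hT0, ⟨hT0, hE,
      hW.continuousInSobolev_density hTT.le, hW.continuousInSobolev_velocity hTT.le hpos,
      fun T' hT' => ?_, ?_, hW.blow_up hg hψ hT0 hTT.le hE⟩⟩
  · rw [wave, hWT.init]
    simp [farField]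
  · rw [norm_wave]
    exact hne t ⟨ht.1, ht.2.trans hTT.le⟩ x
  · obtain ⟨c, hc, hcW⟩ := hpos (T - T') (by linarith [hT'.2])
    refine ⟨c ^ 2, by positivity, fun t ht x => ?_⟩
    have e : madelungDensity (fun t x => conj (wave g W (T - t) x)) t x = _ :=
      madelungDensity_revWave (g := g) (W := W) T t x
    rw [e]
    exact pow_le_pow_left₀ hc.le (hcW _ ⟨by linarith [ht.2], by linarith [ht.1]⟩ x) 2
  · have e : (fun t => madelungDensity (fun t x => conj (wave g W (T - t) x)) t 0) =
        fun t => ‖1 + W (T - t) 0‖ ^ 2 :=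
      funext fun t => madelungDensity_revWave (g := g) (W := W) T t 0
    rw [e]
    have h0 : 1 + W 0 0 = 0 := by rw [hW.init, hψ.zero, Complex.ofReal_zero]
    have hc := (hW.hasDeriv 0 ⟨le_rfl, hT₁.le⟩ 0).continuousWithinAt
    have ht : Tendsto (fun t => T - t) (𝓝[<] T) (𝓝[Icc 0 T₁] 0) := by
      refine tendsto_nhdsWithin_iff.2 ⟨?_, ?_⟩
      · have : ContinuousAt (fun t => T - t) T := by fun_prop
        have := this.tendsto
        rw [sub_self] at this
        exact this.mono_left nhdsWithin_le_nhds
      · filter_upwards [Ioo_mem_nhdsLT hT0] with t ht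
        exact ⟨by linarith [ht.2], by linarith [ht.1]⟩
    have := (((hc.tendsto.comp ht).const_add 1).norm).pow 2
    rw [h0] at this
    simpa using this

/-- For a bump `b` equal to `1` near the origin, `1 - b (1 - |x|²) = (1 - b) + b |x|²` is positive
away from `0` and equals `|x|²` near it. Its Laplacian at the origin is `2d`, nonzero because `d ≥
1`. -/
lemma exists_isVacuumDatum (hd : 1 ≤ d) : ∃ ψ₀ : RSpace d → ℝ, IsVacuumDatum ψ₀ := by
  let b : ContDiffBump (0 : RSpace d) := ⟨1 / 2, 3 / 4, by norm_num, by norm_num⟩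
  have hn : ContDiff ℝ ∞ (fun x : RSpace d => 1 - ‖x‖ ^ 2) :=
    contDiff_const.sub (contDiff_norm_sq ℝ)
  have hs : ContDiff ℝ ∞ (fun x => b x * (1 - ‖x‖ ^ 2)) := b.contDiff.mul hn
  have hc : HasCompactSupport (fun x => b x * (1 - ‖x‖ ^ 2)) := b.hasCompactSupport.mul_right
  refine ⟨fun x => 1 - b x * (1 - ‖x‖ ^ 2), ⟨⟨hc.toSchwartzMap hs, fun x => ?_⟩, fun x hx => ?_,
    ?_, ?_⟩⟩
  · change b x * (1 - ‖x‖ ^ 2) = _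
    ring
  · have h1 : 0 < ‖x‖ ^ 2 := by have := norm_pos_iff.2 hx; positivity
    have h2 := b.nonneg (x := x)
    have h3 := b.le_one (x := x)
    rcases h2.eq_or_lt with h4 | h4
    · rw [← h4]; norm_num
    · nlinarith [mul_pos h4 h1]
  · have : b 0 = 1 := b.one_of_mem_closedBall (by simp [b])
    simp [this]
  · have he : (fun x => 1 - b x * (1 - ‖x‖ ^ 2)) =ᶠ[𝓝 (0 : RSpace d)] fun x => ‖x‖ ^ 2 := by
      filter_upwards [b.eventuallyEq_one] with x hx
      rw [hx]; simp
    rw [(InnerProductSpace.laplacian_congr_nhds he).self_of_nhds]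
    have hf : fderiv ℝ (fun x : RSpace d => ‖x‖ ^ 2) = fun x => (2 : ℝ) • innerSL ℝ x := by
      ext1 x
      have := (hasStrictFDerivAt_norm_sq x).hasFDerivAt.fderiv
      rw [this]; ext y; simp [two_mul]
    rw [laplacian_eq_sum_fderiv, hf]
    have hg : HasFDerivAt (fun x : RSpace d => (2 : ℝ) • innerSL ℝ x) ((2 : ℝ) • innerSL ℝ) 0 :=
      ((2 : ℝ) • innerSL ℝ : RSpace d →L[ℝ] RSpace d →L[ℝ] ℝ).hasFDerivAt
    rw [hg.fderiv]
    have h1 : ∀ i : Fin d, ((2 : ℝ) • innerSL ℝ : RSpace d →L[ℝ] RSpace d →L[ℝ] ℝ) (stdVec i)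
        (stdVec i) = 2 := fun i => by
      change (2 : ℝ) * inner ℝ (stdVec i) (stdVec i) = 2
      rw [real_inner_self_eq_norm_sq, norm_stdVec]
      norm_num
    rw [Finset.sum_congr rfl fun i _ => h1 i]
    have h2 : (0 : ℝ) < d := by exact_mod_cast hd
    simp [h2.ne']

end Main

theorem mainTheorem3 (d : ℕ) (hd : 1 ≤ d) (g : ℝ → ℝ) (hg : ContDiffOn ℝ ∞ g (Ici 0)) :
    (∀ ψ₀ : RSpace d → ℝ, IsVacuumDatum ψ₀ →
      ∃ T : ℝ, 0 < T ∧ ∃ ψ : ℝ → RSpace d → ℂ,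
        IsSmoothGPSolution g T ψ ∧
        ContinuousInSobolev (Icc 0 T) (fun t x => ψ t x - farField g t) ∧
        (∀ x, ψ 0 x = (ψ₀ x : ℂ)) ∧
        (∀ t ∈ Ioc 0 T, ∀ x, 0 < ‖ψ t x‖) ∧
        IsSmoothGPSolution g T (fun t x => conj (ψ (T - t) x)) ∧
        IsBlowUpSolution g T 0
          (madelungDensity (fun t x => conj (ψ (T - t) x)))
          (madelungVelocity (fun t x => conj (ψ (T - t) x)))) ∧
    (∃ (T : ℝ) (x₀ : RSpace d) (ρ : ℝ → RSpace d → ℝ) (u : ℝ → RSpace d → RSpace d),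
      IsBlowUpSolution g T x₀ ρ u) := by
  refine ⟨fun ψ₀ hψ => exists_blow_up_of_isVacuumDatum hg hψ, ?_⟩
  obtain ⟨ψ₀, hψ⟩ := exists_isVacuumDatum hd
  obtain ⟨T, -, ψ, -, -, -, -, -, h⟩ := exists_blow_up_of_isVacuumDatum hg hψ
  exact ⟨T, 0, _, _, h⟩
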